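/- **Setting.** Let $H$ be the bipartite graph with vertices $z_0,z_1,z_2,b_0,b_1,b_2,c,d$ and edges $z_i b_i$, $b_i c$ $(i=0,1,2)$ and $cd$; the vertices $z_i,c$ are even, the vertices $b_i,d$ odd. Its Perron–Frobenius eigenvalue is $\delta=\sqrt{(5+\sqrt{21})/2}$, with eigenvector $$\lambda(z_i)=\sqrt{\tfrac{7-\sqrt{21}}{42}},\quad \lambda(b_i)=\sqrt{\tfrac{7+\sqrt{21}}{42}},\quad \lambda(d)=\sqrt{\tfrac{21-3\sqrt{21}}{42}},\quad \lambda(c)=\sqrt{\tfrac{21+3\sqrt{21}}{42}} .$$ Let $q>1$ with $q+q^{-1}=\delta$ and $[n]=\frac{q^n-q^{-n}}{q-q^{-1}}$. In the graph planar algebra $PABG(H)$ the space $PABG(H)_{k,+}$ (resp. $PABG(H)_{k,-}$) has as basis the loops of length $2k$ on $H$ based at an even (resp. odd) vertex. A diagram is evaluated as a sum over states, i.e. labellings of unshaded regions by even and of shaded regions by odd vertices, with adjacent regions labelled by adjacent vertices: each box (a rectangle with its marked region on the left, half of its strings on top and half at the bottom) contributes the coefficient of the loop read clockwise around it from its marked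 region, and each local maximum or minimum of a string contributes $\sqrt{\lambda(x)/\lambda(y)}$, where $x$ is the label on the inner and $y$ the label on the outer side of the bend. Diagrams with eight boundary points are drawn with all of them at the bottom; they are linear combinations of based loops of length $8$, read along the regions at the bottom from left to right. **Generators.** On loops of length $6$, let $\alpha$ replace every $z_j,b_j$ by $z_{j+1},b_{j+1}$ (indices mod $3$); let $$\rho(l_1l_2l_3l_4l_5l_6)=\sqrt{\tfrac{\lambda(l_1)\lambda(l_4)}{\lambda(l_5)\lambda(l_2)}}\;l_5l_6l_1l_2l_3l_4 ;$$ and, if $l_i=l_{i+2}$ has exactly two neighbours, $l_{i+1}$ and $w$, let $f_i(l_1\cdots l_6)$ be $-\sqrt{\lambda(l_{i+1})/\lambda(w)}$ times the loop with $l_{i+1}$ replaced by $w$. Put $A=1+\alpha+\alpha^2$, $R=\sqrt{\lambda(d)/\lambda(b_0)}$, $\theta=\sqrt{\lambda(c)/\lambda(z_0)}$, $\omega=e^{2\pi i/3}$, $\eta=1+i\sqrt3$. Define $T\in PABG(H)_{3,+}$ by $$\begin{aligned}T=(1+\rho+\rho^2)\Big(& tA(1+f_2)(cb_0cb_0cb_1)+t'A(1+f_2)(cb_0cb_0cb_2)+s(cb_0cb_1cb_2)+\bar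 s(cb_0cb_2cb_1)\\ &-\tfrac{t+t'}{R}A(1+f_4)(cdcb_0cb_0)-\tfrac{t+t'+s}{R}A(cdcb_0cb_1)+\tfrac{2(t+t')+s}{R}A(cdcb_0cb_2)\Big),\end{aligned}$$ with $t=\frac{1}{12}\big(-3+\sqrt{21}+\sqrt{-114+26\sqrt{21}}\big)$, $t'=\frac14\big(-7-\sqrt{21}+\sqrt{54+14\sqrt{21}}\big)t$, $s=\frac14(3-\sqrt{21})+\frac i2\sqrt{\frac{-57+13\sqrt{21}}{6}}$. Define $Q\in PABG(H)_{3,+}$ by $$\begin{aligned}Q=\eta(1+\omega^2\rho+\omega\rho^2)\Big(& rA(1+f_2)(cb_0cb_0cb_1)+r'A(1+f_2)(cb_0cb_0cb_2)\\ &-\tfrac{\omega^2}{R}(r+r')A(1+f_4)(cdcb_0cb_0)-\tfrac1R(r+\omega r')A(cdcb_0cb_1)-\tfrac1R(r'+\omega r)A(cdcb_0cb_2)\Big),\end{aligned}$$ with $\Psi=\frac{1-\theta^2-\theta}{2}$, $r=\sqrt{\frac{[4]}{1+\Psi^2}\cdot\frac{5}{(246+54\sqrt{21})\sqrt3}}$,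 $r'=\Psi r$. **Diagrams.** Let $f^{(8)}$ be the Jones–Wenzl idempotent on eight strings, given by Wenzl's relation $f^{(1)}=1$, $f^{(n+1)}=f^{(n)}-\frac{[n]}{[n+1]}f^{(n)}E_nf^{(n)}$, where $E_n$ is the cup–cap on strings $n$ and $n+1$. All diagrams below stand on $f^{(8)}$, which is attached to their eight bottom strings. For boxes $E,F,G\in\{T,Q\}$: * *Unshaded* (outer region unshaded). In $\langle E\rangle$ the box $E$ has all its six strings going down, one to the left and five to the right of its marked region, and one further strand passes over the whole of it, from the first to the eighth bottom point. In $(F,G)$ the boxes $F$ (left) and $G$ (right) are joined by two strings, each sends its other four strings down, and both marked regions are the outer region. Put $u=\langle T\rangle$, $v=\langle Q\rangle$. * *Shaded* (outer region shaded). In $\langle E\rangle_0$ the box $E$ has all its six strings going down, with its marked region to the left of all of them, and one further strand passes over the whole of it, from the first to the eighth bottom point. In $(F,G)_0$ the boxes $F$ (left) and $G$ (right) are joined by two strings and each sends its other four strings down; the marked region of $F$ is the one between its first and second, that of $G$ the one between its third and fourth downward string. Put $u_0=\langle T\rangle_0$, $v_0=\langle Q\rangle_0$. **Theorem.** In $PABG(H)$,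 $$u,\,v\in\operatorname{span}_{\mathbb C}\{(T,T),(Q,Q),(T,Q),(Q,T)\}$$ and $$u_0,\,v_0\in\operatorname{span}_{\mathbb C}\{(T,T)_0,(Q,Q)_0,(T,Q)_0,(Q,T)_0\}.$$ -/

import Mathlib

namespace Haagerup2221

/-! ## The graph, its Perron-Frobenius data and quantum numbers -/

/-- Vertices of the graph `H`: a centre `c` joined to the leaf `d` and to `b 0`, `b 1`, `b 2`,
with each `b i` joined to the leaf `z i`. -/
inductive Vtx where
  | z (i : Fin 3)
  | b (i : Fin 3)
  | c
  | d
  deriving DecidableEq, Fintype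

/-- Adjacency in `H`. -/
def adj : Vtx → Vtx → Bool
  | .z i, .b j => i == j
  | .b i, .z j => i == j
  | .b _, .c => true
  | .c, .b _ => true
  | .c, .d => true
  | .d, .c => true
  | _, _ => false

/-- The even vertices are `z 0`, `z 1`, `z 2`, `c`; the odd ones are `b 0`, `b 1`, `b 2`, `d`. -/
def isEven : Vtx → Bool
  | .z _ => true
  | .b _ => false
  | .c => true
  | .d => false

/-- The Perron-Frobenius eigenvector of `H`, of norm one on the even and on the odd vertices. -/
noncomputable def weight : Vtx → ℝ
  | .z _ => √((7 - √21) / 42)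
  | .b _ => √((7 + √21) / 42)
  | .c => √((21 + 3 * √21) / 42)
  | .d => √((21 - 3 * √21) / 42)

/-- The loop value: the norm of `H`. -/
noncomputable def loopValue : ℝ := √((5 + √21) / 2)

/-- The number `q > 1` with `q + q⁻¹ = loopValue`. -/
noncomputable def q : ℝ := (loopValue + √(loopValue ^ 2 - 4)) / 2

/-- The quantum number `[n]`. -/
noncomputable def qnum (n : ℕ) : ℝ := (q ^ n - (q⁻¹) ^ n) / (q - q⁻¹)

/-! ## Three-boxes and the two generators -/

/-- A three-box, given by its coefficients on based loops of length six.  A loop is read clockwise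
from the marked (starred) region: in standard form (star on the left, three strings on top, three
at the bottom) the top regions are read from left to right, then the bottom ones from right to
left.  The generators below are supported on even-based loops of `H`. -/
abbrev ThreeBox : Type := (Fin 6 → Vtx) → ℂ

/-- The basis element belonging to a loop. -/
def basisLoop (l : Fin 6 → Vtx) : ThreeBox := Pi.single l 1

/-- The graph automorphism permuting the three long legs. -/
def shift (k : Fin 3) : Vtx → Vtx
  | .z i => .z (i + k)
  | .b i => .b (i + k)
  | .c => .c
  | .d => .d

/-- The linear map `α` with `α (l₁ ⋯ l₆) = shift 1 l₁ ⋯ shift 1 l₆` on basis loops. -/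
def alpha (X : ThreeBox) : ThreeBox := fun l => X (fun i => shift (-1) (l i))

/-- `1 + α + α²`. -/
def sumAlpha (X : ThreeBox) : ThreeBox := X + alpha X + alpha (alpha X)

/-- The rotation: the linear map with
`ρ (l₁ ⋯ l₆) = √(λ(l₁) λ(l₄) / (λ(l₅) λ(l₂))) • l₅ l₆ l₁ l₂ l₃ l₄` on basis loops. -/
noncomputable def rho (X : ThreeBox) : ThreeBox := fun m =>
  (√((weight (m 2) * weight (m 5)) / (weight (m 0) * weight (m 3))) : ℝ) *
    X ![m 2, m 3, m 4, m 5, m 0, m 1]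

/-- The flip of the vertex of index `i` (counted from `0`) of a loop whose neighbouring vertices
agree: that vertex `x` is replaced by the other neighbour `w` of the preceding vertex, with
coefficient `-√(λ(x) / λ(w))`. Only used where there is exactly one such `w`. -/
noncomputable def flip (i : Fin 6) (l : Fin 6 → Vtx) : ThreeBox :=
  ∑ w : Vtx, if adj (l (i - 1)) w = true ∧ w ≠ l i then
    (-(√(weight (l i) / weight w) : ℝ) : ℂ) • basisLoop (Function.update l i w) else 0

/-- `(1 + f) (l)`, where `f` flips the vertex of index `i`. -/
noncomputable def withFlip (i : Fin 6) (l : Fin 6 → Vtx) : ThreeBox := basisLoop l + flip i l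

/-- `R = √(λ(d) / λ(b))`. -/
noncomputable def bigR : ℝ := √(weight .d / weight (.b 0))

/-- `θ = √(λ(c) / λ(z))`. -/
noncomputable def theta : ℝ := √(weight .c / weight (.z 0))

/-- The cube root of unity `exp (2πi/3)`. -/
noncomputable def omega : ℂ := Complex.exp (2 * Real.pi * Complex.I / 3)

noncomputable def eta : ℂ := 1 + Complex.I * (√3 : ℝ)

noncomputable def tT : ℝ := (-3 + √21 + √(-114 + 26 * √21)) / 12

noncomputable def tT' : ℝ := (-7 - √21 + √(54 + 14 * √21)) / 4 * tT

noncomputable def sT : ℂ :=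
  (((3 - √21) / 4 : ℝ) : ℂ) + ((1 / 2 * √((-57 + 13 * √21) / 6) : ℝ) : ℂ) * Complex.I

open Vtx in
noncomputable def seedT : ThreeBox :=
  (tT : ℂ) • sumAlpha (withFlip 2 ![c, b 0, c, b 0, c, b 1])
  + (tT' : ℂ) • sumAlpha (withFlip 2 ![c, b 0, c, b 0, c, b 2])
  + sT • basisLoop ![c, b 0, c, b 1, c, b 2]
  + (starRingEnd ℂ sT) • basisLoop ![c, b 0, c, b 2, c, b 1]
  - (((tT : ℂ) + tT') / bigR) • sumAlpha (withFlip 4 ![c, d, c, b 0, c, b 0])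
  - (((tT : ℂ) + tT' + sT) / bigR) • sumAlpha (basisLoop ![c, d, c, b 0, c, b 1])
  + ((2 * ((tT : ℂ) + tT') + sT) / bigR) • sumAlpha (basisLoop ![c, d, c, b 0, c, b 2])

/-- The generator `T`, with rotational eigenvalue `1`. -/
noncomputable def genT : ThreeBox := seedT + rho seedT + rho (rho seedT)

noncomputable def psi : ℝ := (1 - theta ^ 2 - theta) / 2

noncomputable def tQ : ℝ := √(qnum 4 / (1 + psi ^ 2) * (5 / ((246 + 54 * √21) * √3)))

noncomputable def tQ' : ℝ := psi * tQ

open Vtx in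
noncomputable def seedQ : ThreeBox :=
  (tQ : ℂ) • sumAlpha (withFlip 2 ![c, b 0, c, b 0, c, b 1])
  + (tQ' : ℂ) • sumAlpha (withFlip 2 ![c, b 0, c, b 0, c, b 2])
  - (omega ^ 2 / bigR * ((tQ : ℂ) + tQ')) • sumAlpha (withFlip 4 ![c, d, c, b 0, c, b 0])
  - (1 / bigR * ((tQ : ℂ) + omega * tQ')) • sumAlpha (basisLoop ![c, d, c, b 0, c, b 1])
  - (1 / bigR * ((tQ' : ℂ) + omega * tQ)) • sumAlpha (basisLoop ![c, d, c, b 0, c, b 2])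

/-- The generator `Q`, with rotational eigenvalue `ω`. -/
noncomputable def genQ : ThreeBox :=
  eta • (seedQ + omega ^ 2 • rho seedQ + omega • rho (rho seedQ))

/-! ## Evaluation of diagrams in the graph planar algebra

A diagram with all `n` boundary strings at the bottom is evaluated to a combination of closed walks
`v₀ v₁ … vₙ = v₀` on `H`, the labels of the `n + 1` bottom regions read from left to right
(`v₀ = vₙ` labels the outer region).  It is cut into horizontal layers, each containing one local
maximum, one local minimum or one box in standard form, read from top to bottom; the evaluation is
the sum over all states, each extremum contributing the square root of the ratio of the weight of
the region inside it to that of the region outside it. -/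

/-- Coefficient functions.  Those produced by diagrams vanish off the closed walks on `H`. -/
abbrev WalkVec : Type := List Vtx → ℂ

/-- A local maximum (`∩`) whose two strings become the two leftmost ones. -/
noncomputable def capLeft (ψ : WalkVec) : WalkVec
  | x :: y :: x' :: l =>
      if x = x' ∧ adj x y = true then (√(weight y / weight x) : ℝ) * ψ (x :: l) else 0
  | _ => 0

/-- A local minimum (`∪`) joining the two leftmost strings. -/
noncomputable def cupLeft (ψ : WalkVec) : WalkVec
  | x :: l => ∑ y : Vtx,
      if adj x y = true then (√(weight y / weight x) : ℝ) * ψ (x :: y :: x :: l) else 0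
  | [] => 0

/-- The box `X`, in standard form, on the three leftmost strings. -/
noncomputable def boxLeft (X : ThreeBox) (ψ : WalkVec) : WalkVec
  | w :: x :: y :: v :: l => ∑ a : Vtx, ∑ e : Vtx, X ![w, a, e, v, y, x] * ψ (w :: a :: e :: v :: l)
  | _ => 0

/-- Add `i` through strings on the left of a layer. -/
def whisker : ℕ → (WalkVec → WalkVec) → WalkVec → WalkVec
  | 0, f, ψ => f ψ
  | i + 1, f, ψ => fun walk =>
    match walk with
    | [] => 0
    | x :: l => whisker i f (fun m => ψ (x :: m)) l

/-- The layers of a diagram; the first argument is the number of strings to the left. -/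
inductive Layer where
  | cap (i : ℕ)
  | cup (i : ℕ)
  | box (i : ℕ) (X : ThreeBox)

noncomputable def Layer.act : Layer → WalkVec → WalkVec
  | .cap i => whisker i capLeft
  | .cup i => whisker i cupLeft
  | .box i X => whisker i (boxLeft X)

/-- The empty diagram whose outer region is unshaded: the sum of the even vertices. -/
def emptyUnshaded : WalkVec
  | [v] => if isEven v = true then 1 else 0
  | _ => 0

/-- The empty diagram whose outer region is shaded: the sum of the odd vertices. -/
def emptyShaded : WalkVec
  | [v] => if isEven v = true then 0 else 1
  | _ => 0

/-- Evaluate a diagram, its layers listed from top to bottom. -/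
noncomputable def evalDiagram (start : WalkVec) (layers : List Layer) : WalkVec :=
  layers.foldl (fun ψ layer => layer.act ψ) start

/-- The Jones-Wenzl idempotent on the `n` leftmost strings, as an operator attached at the bottom
of a diagram, by Wenzl's relation
`f⁽ⁿ⁺¹⁾ = f⁽ⁿ⁾ - [n] / [n + 1] • f⁽ⁿ⁾ Eₙ f⁽ⁿ⁾`, where `Eₙ` is a local minimum above a local
maximum on the strings `n`, `n + 1`. -/
noncomputable def jonesWenzl : ℕ → WalkVec → WalkVec
  | 0, ψ => ψ
  | 1, ψ => ψ
  | n + 2, ψ => jonesWenzl (n + 1) ψ - ((qnum (n + 1) / qnum (n + 2) : ℝ) : ℂ) •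
      jonesWenzl (n + 1) (evalDiagram (jonesWenzl (n + 1) ψ) [.cup n, .cap n])

/-! ## The diagrams on `f⁽⁸⁾` -/

open Layer

/-- The unshaded diagrams `u` (for `X = T`) and `v` (for `X = Q`) on `f⁽⁸⁾`.  All six strings of
the box `X` go down, one to the left and five to the right of the marked region, and the whole is
placed under one further strand; the outer region is unshaded. -/
noncomputable def underStrand (X : ThreeBox) : WalkVec :=
  jonesWenzl 8 (evalDiagram emptyUnshaded [cap 0, cap 1, cap 3, cap 4, box 2 X])

/-- The unshaded diagram `(F, G)` on `f⁽⁸⁾`.  The boxes `F` (left) and `G` (right) are joined by two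
strings, and each sends its four other strings down; both are marked in the outer region, which is
unshaded. -/
noncomputable def pair (F G : ThreeBox) : WalkVec :=
  jonesWenzl 8 (evalDiagram emptyUnshaded
    [cap 0, cap 1, cap 2, box 0 F, cap 6, cap 7, cap 8, box 6 G, cup 5, cup 4])

/-- The shaded diagrams `u₀` (for `X = T`) and `v₀` (for `X = Q`) on `f⁽⁸⁾`.  All six strings of the
box `X` go down, to the right of the marked region, and the whole is placed under one further
strand; the outer region is shaded. -/
noncomputable def underStrandShaded (X : ThreeBox) : WalkVec :=
  jonesWenzl 8 (evalDiagram emptyShaded [cap 0, cap 1, cap 2, cap 3, box 1 X])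

/-- The shaded diagram `(F, G)` on `f⁽⁸⁾`.  The boxes `F` (left) and `G` (right) are joined by two
strings, and each sends its four other strings down: the marked region of `F` lies between the first
and the second of its four strings, that of `G` between the third and the fourth of its; the outer
region is shaded. -/
noncomputable def pairShaded (F G : ThreeBox) : WalkVec :=
  jonesWenzl 8 (evalDiagram emptyShaded
    [cap 0, cap 2, cap 3, box 1 F, cap 6, cap 7, cap 8, cap 9, box 7 G, cup 6, cup 5, cup 4])

end Haagerup2221

/-! The Jones-Wenzl idempotent `f⁽⁸⁾` annihilates cups, and so in the image of `f⁽⁸⁾` the closed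
walks of length eight on `H` satisfy one relation for every walk `⋯ x y x ⋯`: the sum over the
neighbours `y` of `x`, weighted with `√λ(y)`, vanishes.  The theorem is a finite computation modulo
these relations, and the proof arranges it so that it becomes small and exact.

*The relations.*  On walks the cup-caps satisfy the Temperley-Lieb relations, because `λ` is an
eigenvector of the adjacency matrix (`isTemperleyLieb_tlGen`); Wenzl's induction
(`wenzl_induction`) then gives the vanishing of cups (`jw_succ_tlGen`, `sum_jwWalk`).  The relation
at `x = b i` removes `z i` in favour of `c`, the one at `x = c` removes `d` in favour of the `b i`,
and those at the leaves say that backtracking at a leaf gives zero (`walkClass_b_z_b`,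
`walkClass_c_d_c`, `walkClass_z_b_z`, `walkClass_d_c_d`).  What is left are words: walks which away
from the outer region alternate between `c` and the legs `b i`.  The words still satisfy the
relations that follow from the leaves, such as the vanishing of `⋯ b i c b i c b i ⋯` and of the sum
of all `⋯ c b i c b j c ⋯` (`walkClass_b_c_b_c_b`, `sum_sum_walkClass`).

*Exact arithmetic.*  The square roots occurring in the weights and in the generators are removed
by a gauge: multiply the coefficient of a loop `l` by `√(λ(l₁) λ(l₄))` and divide it by `R` for each
`d`, and multiply a walk by `R` for each `d`.  Afterwards the rotation is a permutation of the
loops, and up to a scalar the generators have coefficients in `ℤ[θ, ω]`, where `θ⁴ = 3 θ² + 3`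
(`seedT_eq`, `seedQ_eq`, `hasTable_T`, `hasTable_Q`).  The remaining square roots in a diagram
on `f⁽⁸⁾` depend on its outer region only.

*The computation.*  The four kinds of diagrams are evaluated in closed form (`underVec_apply`,
`pairVec_apply`, `underVecShaded_apply`, `pairVecShaded_apply`), and the coefficients of the words
with outer region `w` are obtained from these by removing `z i` and `d` (`sum_underTable`,
`sum_pairTable` and their shaded forms).  For each of `u`, `v`, `u₀` and `v₀` there is an explicit
combination of the diagrams `(T, T)`, `(T, Q)` and `(Q, T)` whose coefficients, for every outer
region, differ from its own by a relation among the words; `(Q, Q)` is not needed.  The words and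
the relations being few, this is decided by evaluation in `ℤ[θ, ω]` (`check_c_T` and the seven
statements after it).  By the symmetry `α` of the generators the relations can be chosen invariant
under the permutation of the legs, which is why their coefficients depend on differences of indices
only. -/

namespace Haagerup2221

/-! ### Wenzl's recursion in a Temperley-Lieb representation -/

section Wenzl

variable {A : Type*} [Ring A] [Algebra ℂ A]

/-- Wenzl's recursion for elements `E 0, E 1, …` of an algebra, with "quantum numbers" `a`. -/
noncomputable def wenzl (E : ℕ → A) (a : ℕ → ℂ) : ℕ → A
  | 0 => 1
  | 1 => 1
  | n + 2 => wenzl E a (n + 1) -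
      (a (n + 1) / a (n + 2)) • (wenzl E a (n + 1) * E n * wenzl E a (n + 1))

/-- Those Temperley-Lieb relations that Wenzl's recursion needs, for `E 0, …, E (N - 1)` with loop
value `δ`. -/
structure IsTemperleyLieb (E : ℕ → A) (δ : ℂ) (N : ℕ) : Prop where
  sq : ∀ i < N, E i * E i = δ • E i
  down : ∀ i, i + 1 < N → E (i + 1) * E i * E (i + 1) = E (i + 1)
  comm : ∀ i j, i + 2 ≤ j → j < N → Commute (E i) (E j)

variable {E : ℕ → A} {δ : ℂ} {N : ℕ} {a : ℕ → ℂ}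

theorem wenzl_commute (h : IsTemperleyLieb E δ N) :
    ∀ n j, n ≤ j → j < N → Commute (wenzl E a n) (E j)
  | 0, _, _, _ => Commute.one_left _
  | 1, _, _, _ => Commute.one_left _
  | n + 2, j, hj, hN => by
    have h1 := wenzl_commute h (n + 1) j (by omega) hN
    exact h1.sub_left (((h1.mul_left (h.comm n j hj hN)).mul_left h1).smul_left _)

/-- The induction of Wenzl's theorem: besides idempotency and the vanishing of `f⁽ⁿ⁺¹⁾ Eᵢ`, it
carries the absorption rules and the partial trace relation for the last strand. -/
theorem wenzl_induction (h : IsTemperleyLieb E δ N) (a0 : a 0 = 0) (a1 : a 1 = 1)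
    (ha : ∀ n, a (n + 2) = δ * a (n + 1) - a n) (hne : ∀ n, a (n + 1) ≠ 0) (n : ℕ) (hn : n ≤ N) :
    wenzl E a (n + 1) * wenzl E a (n + 1) = wenzl E a (n + 1) ∧
    wenzl E a (n + 1) * wenzl E a n = wenzl E a (n + 1) ∧
    wenzl E a n * wenzl E a (n + 1) = wenzl E a (n + 1) ∧
    (∀ i < n, wenzl E a (n + 1) * E i = 0) ∧
    (n < N → E n * wenzl E a (n + 1) * E n = (a (n + 2) / a (n + 1)) • (wenzl E a n * E n)) := by
  induction n with
  | zero =>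
    refine ⟨by simp [wenzl], by simp [wenzl], by simp [wenzl], by simp, fun h0 => ?_⟩
    have : a 2 = δ := by rw [ha 0, a0, a1]; ring
    simp [wenzl, h.sq 0 h0, a1, this]
  | succ n ih =>
    obtain ⟨hid, hr, hl, hk, ht⟩ := ih (by omega)
    have ht := ht (by omega)
    have hc : Commute (wenzl E a n) (E n) := wenzl_commute h n n le_rfl (by omega)
    have hdef : wenzl E a (n + 2) = wenzl E a (n + 1) -
      (a (n + 1) / a (n + 2)) • (wenzl E a (n + 1) * E n * wenzl E a (n + 1)) := rfl
    set f := wenzl E a (n + 1) with hf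
    set g := wenzl E a n with hg
    have hq : a (n + 1) / a (n + 2) * (a (n + 2) / a (n + 1)) = 1 := by
      have := hne n; have := hne (n + 1); field_simp
    have hright : wenzl E a (n + 2) * f = wenzl E a (n + 2) := by
      rw [hdef, sub_mul, smul_mul_assoc, mul_assoc _ f f, hid]
    have hleft : f * wenzl E a (n + 2) = wenzl E a (n + 2) := by
      rw [hdef, mul_sub, mul_smul_comm, ← mul_assoc, ← mul_assoc, hid]
    have hkill : wenzl E a (n + 2) * E n = 0 := by
      rw [hdef, sub_mul, smul_mul_assoc, mul_assoc (f * E n), mul_assoc f, ← mul_assoc (E n), ht,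
        mul_smul_comm, smul_smul, hq, one_smul, ← mul_assoc, hr, sub_self]
    refine ⟨?_, hright, hleft, fun i hi => ?_, fun hN => ?_⟩
    · nth_rewrite 2 [hdef]
      rw [mul_sub, mul_smul_comm, hright, ← mul_assoc, ← mul_assoc, hright, hkill, zero_mul,
        smul_zero, sub_zero]
    · rcases Nat.lt_succ_iff_lt_or_eq.mp hi with hi | rfl
      · rw [hdef, sub_mul, smul_mul_assoc, mul_assoc _ f, hk i hi, mul_zero, smul_zero, sub_zero]
      · exact hkill
    · have hc' : Commute f (E (n + 1)) := wenzl_commute h (n + 1) (n + 1) le_rfl hN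
      have e1 : E (n + 1) * f * E (n + 1) = δ • (f * E (n + 1)) := by
        rw [← hc'.eq, mul_assoc, h.sq _ hN, mul_smul_comm]
      have e2 : E (n + 1) * (f * E n * f) * E (n + 1) = f * E (n + 1) := by
        calc E (n + 1) * (f * E n * f) * E (n + 1)
            = (E (n + 1) * f) * E n * (f * E (n + 1)) := by simp only [mul_assoc]
          _ = f * (E (n + 1) * E n * E (n + 1)) * f := by
            rw [← hc'.eq, hc'.eq]; nth_rewrite 1 [← hc'.eq]; simp only [mul_assoc]
          _ = f * E (n + 1) := by rw [h.down n hN, mul_assoc, ← hc'.eq, ← mul_assoc, hid]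
      have e3 : a (n + 3) / a (n + 2) = δ - a (n + 1) / a (n + 2) := by
        have := hne (n + 1)
        rw [ha (n + 1)]; field_simp
      rw [hdef, mul_sub, sub_mul, mul_smul_comm, smul_mul_assoc, e1, e2, ← sub_smul, e3]

end Wenzl

/-! ### The Temperley-Lieb action on walks -/

theorem adj_comm (x y : Vtx) : adj x y = adj y x := by
  cases x <;> cases y <;> simp [adj, eq_comm]

theorem adj_symm {x y : Vtx} (h : adj x y = true) : adj y x = true := by rwa [adj_comm]

theorem sum_vtx {M : Type*} [AddCommMonoid M] (f : Vtx → M) :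
    ∑ x, f x = ∑ i, f (.z i) + ∑ i, f (.b i) + f .c + f .d := by
  have : (Finset.univ : Finset Vtx) =
      {.z 0, .z 1, .z 2, .b 0, .b 1, .b 2, .c, .d} := by decide
  rw [this]
  simp [Finset.sum_insert, Fin.sum_univ_three, add_assoc]

theorem sqrt21_sq : √21 ^ 2 = (21 : ℝ) := Real.sq_sqrt (by norm_num)

theorem sqrt21_gt : (4.58 : ℝ) < √21 := by
  apply Real.lt_sqrt_of_sq_lt; norm_num

theorem sqrt21_lt : √21 < (4.6 : ℝ) := by
  rw [Real.sqrt_lt' (by norm_num)]; norm_num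

theorem weight_pos (x : Vtx) : 0 < weight x := by
  have h1 := sqrt21_gt
  have h2 := sqrt21_lt
  cases x <;> simp only [weight] <;> apply Real.sqrt_pos.mpr <;> linarith

theorem weight_ne (x : Vtx) : weight x ≠ 0 := (weight_pos x).ne'

theorem loopValue_pos : 0 < loopValue := Real.sqrt_pos.mpr (by positivity)

theorem loopValue_sq : loopValue ^ 2 = (5 + √21) / 2 := Real.sq_sqrt (by positivity)

theorem weight_b (i j : Fin 3) : weight (.b i) = loopValue * weight (.z j) := by
  have h1 := sqrt21_sq
  have h2 := sqrt21_lt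
  simp only [weight, loopValue]
  rw [← Real.sqrt_mul (by positivity)]
  congr 1
  linear_combination (-1 / 84 : ℝ) * h1 * (-1)

theorem weight_c (i : Fin 3) : weight .c = √3 * weight (.b i) := by
  simp only [weight]
  rw [← Real.sqrt_mul (by norm_num)]
  congr 1
  ring

theorem weight_d (i : Fin 3) : weight .d = √3 * weight (.z i) := by
  simp only [weight]
  rw [← Real.sqrt_mul (by norm_num)]
  congr 1
  ring

theorem loopValue_relation : loopValue ^ 2 = 1 + √3 * loopValue := by
  have h : √3 * loopValue = (3 + √21) / 2 := by
    have h1 := sqrt21_sq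
    rw [loopValue, ← Real.sqrt_mul (by norm_num), Real.sqrt_eq_iff_eq_sq (by positivity)
      (by positivity)]
    linear_combination (-1 / 4 : ℝ) * h1
  rw [loopValue_sq, h]
  ring

/-- The weights form an eigenvector of the adjacency matrix. -/
theorem sum_weight_adj (x : Vtx) :
    ∑ y, (if adj x y = true then weight y else 0) = loopValue * weight x := by
  have hr := loopValue_relation
  have h3 : √3 ^ 2 = (3 : ℝ) := Real.sq_sqrt (by norm_num)
  have hb (i) : weight (.b i) = loopValue * weight (.z 0) := weight_b i 0
  have hz (i) : weight (.z i) = weight (.z 0) := rfl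
  have hc : weight .c = √3 * (loopValue * weight (.z 0)) := by rw [weight_c 0, hb]
  have hd := weight_d 0
  rw [sum_vtx]
  cases x with
  | z i => simp [adj, hb, hz i]
  | b i =>
    simp only [adj, hb, hz, hc]
    simp
    linear_combination -weight (.z 0) * hr
  | c =>
    simp only [adj, hb, hz, hc, hd]
    simp
    linear_combination -√3 * weight (.z 0) * hr - weight (.z 0) * loopValue * h3
  | d =>
    simp only [adj, hc, hd]
    simp
    ring

theorem whisker_append (f : (WalkVec → WalkVec)) (p l : List Vtx) (ψ : WalkVec) :
    whisker p.length f ψ (p ++ l) = f (fun m => ψ (p ++ m)) l := by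
  induction p generalizing ψ with
  | nil => rfl
  | cons x p ih => exact ih fun m => ψ (x :: m)

theorem whisker_of_length_lt (f : (WalkVec → WalkVec)) {i : ℕ} {l : List Vtx} (h : l.length < i)
    (ψ : WalkVec) : whisker i f ψ l = 0 := by
  induction l generalizing i ψ with
  | nil => cases i with
    | zero => simp at h
    | succ i => rfl
  | cons x l ih => cases i with
    | zero => simp at h
    | succ i => exact ih (by simpa using h) _

theorem exists_append_of_le {i k : ℕ} {l : List Vtx} (h : i + k ≤ l.length) :
    ∃ p m : List Vtx, l = p ++ m ∧ p.length = i ∧ k ≤ m.length :=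
  ⟨l.take i, l.drop i, (List.take_append_drop i l).symm, by simp; omega, by simp; omega⟩

theorem exists_cons3 {l : List Vtx} (h : 3 ≤ l.length) :
    ∃ x y z m, l = x :: y :: z :: m := by
  match l, h with
  | x :: y :: z :: m, _ => exact ⟨x, y, z, m, rfl⟩

/-- The cup-cap on the strings of index `i` and `i + 1`. -/
noncomputable def cupCap (i : ℕ) (ψ : WalkVec) : WalkVec := evalDiagram ψ [.cup i, .cap i]

theorem cupCap_append (p : List Vtx) (x y x' : Vtx) (l : List Vtx) (ψ : WalkVec) :
    cupCap p.length ψ (p ++ x :: y :: x' :: l) =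
      if x = x' ∧ adj x y = true then (√(weight y / weight x) : ℝ) *
        ∑ y' : Vtx, (if adj x y' = true then
          (√(weight y' / weight x) : ℝ) * ψ (p ++ x :: y' :: x :: l) else 0) else 0 := by
  simp only [cupCap, evalDiagram, List.foldl, Layer.act, whisker_append, capLeft, cupLeft]

theorem cupCap_append' {i : ℕ} {p : List Vtx} (hp : p.length = i) (x y x' : Vtx) (l : List Vtx)
    (ψ : WalkVec) :
    cupCap i ψ (p ++ x :: y :: x' :: l) =
      if x = x' ∧ adj x y = true then (√(weight y / weight x) : ℝ) *
        ∑ y' : Vtx, (if adj x y' = true then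
          (√(weight y' / weight x) : ℝ) * ψ (p ++ x :: y' :: x :: l) else 0) else 0 := by
  rw [← hp, cupCap_append]

theorem ite_sum_zero' {ι : Type*} (s : Finset ι) (p : Prop) [Decidable p] (f : ι → ℂ) :
    (if p then ∑ i ∈ s, f i else 0) = ∑ i ∈ s, if p then f i else 0 := by
  split_ifs <;> simp

theorem cupCap_of_length_lt {i : ℕ} {l : List Vtx} (h : l.length < i + 3) (ψ : WalkVec) :
    cupCap i ψ l = 0 := by
  simp only [cupCap, evalDiagram, List.foldl, Layer.act]
  rcases lt_or_ge l.length i with h' | h'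
  · exact whisker_of_length_lt _ h' _
  · obtain ⟨p, m, rfl, rfl, -⟩ := exists_append_of_le (k := 0) h'
    rw [whisker_append]
    match m with
    | [] | [_] | [_, _] => rfl
    | _ :: _ :: _ :: _ => simp at h; omega

/-- Functions that vanish on short lists are compared on the lists that meet the strings of index
`i` and `i + 1`. -/
theorem cupCap_congr_split {i : ℕ} {φ χ : WalkVec} (hφ : ∀ l, l.length < i + 3 → φ l = 0)
    (hχ : ∀ l, l.length < i + 3 → χ l = 0)
    (h : ∀ p x y x' l, p.length = i → φ (p ++ x :: y :: x' :: l) = χ (p ++ x :: y :: x' :: l)) :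
    φ = χ := by
  funext l
  rcases lt_or_ge l.length (i + 3) with hl | hl
  · rw [hφ l hl, hχ l hl]
  · obtain ⟨p, m, rfl, hp, hm⟩ := exists_append_of_le hl
    obtain ⟨x, y, x', m, rfl⟩ := exists_cons3 hm
    exact h p x y x' m hp

/-- `cupCap` as a linear map. -/
noncomputable def cupCapₗ (i : ℕ) : WalkVec →ₗ[ℂ] WalkVec where
  toFun := cupCap i
  map_add' φ χ := by
    refine cupCap_congr_split (i := i) (fun l hl => cupCap_of_length_lt hl _)
      (fun l hl => by simp [cupCap_of_length_lt hl]) ?_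
    rintro p x y x' l rfl
    simp only [cupCap_append, Pi.add_apply]
    split_ifs
    · rw [← mul_add, ← Finset.sum_add_distrib]
      congr 1
      refine Finset.sum_congr rfl fun y' _ => ?_
      split_ifs <;> ring
    · simp
  map_smul' c φ := by
    refine cupCap_congr_split (i := i) (fun l hl => cupCap_of_length_lt hl _)
      (fun l hl => by simp [cupCap_of_length_lt hl]) ?_
    rintro p x y x' l rfl
    simp only [cupCap_append, Pi.smul_apply, smul_eq_mul, RingHom.id_apply]
    split_ifs
    · rw [Finset.mul_sum, Finset.mul_sum, Finset.mul_sum]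
      refine Finset.sum_congr rfl fun y' _ => ?_
      split_ifs <;> ring
    · simp

theorem sqrt_div_mul_sqrt_div_inv (x y : Vtx) :
    ((√(weight y / weight x) : ℝ) : ℂ) * (√(weight x / weight y) : ℝ) = 1 := by
  rw [← Complex.ofReal_mul, ← Real.sqrt_mul (div_pos (weight_pos _) (weight_pos _)).le,
    div_mul_div_cancel₀ (weight_ne x), div_self (weight_ne y)]
  simp

theorem sqrt_div_mul_self (x y : Vtx) :
    ((√(weight y / weight x) : ℝ) : ℂ) * (√(weight y / weight x) : ℝ) =
      ((weight y / weight x : ℝ) : ℂ) := by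
  rw [← Complex.ofReal_mul, Real.mul_self_sqrt (div_pos (weight_pos _) (weight_pos _)).le]

theorem cupCap_cupCap (i : ℕ) (ψ : WalkVec) :
    cupCap i (cupCap i ψ) = (loopValue : ℂ) • cupCap i ψ := by
  refine cupCap_congr_split (i := i) (fun l hl => cupCap_of_length_lt hl _)
    (fun l hl => by simp [cupCap_of_length_lt hl]) ?_
  rintro p x y x' l rfl
  rw [cupCap_append, Pi.smul_apply, cupCap_append]
  split_ifs with h
  · obtain ⟨rfl, h⟩ := h
    simp only [cupCap_append, true_and, smul_eq_mul]
    set S := ∑ y' : Vtx, (if adj x y' = true then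
          ((√(weight y' / weight x) : ℝ) : ℂ) * ψ (p ++ x :: y' :: x :: l) else 0)
    have : ∀ y', (if adj x y' = true then ((√(weight y' / weight x) : ℝ) : ℂ) *
        (if adj x y' = true then ((√(weight y' / weight x) : ℝ) : ℂ) * S else 0) else 0) =
        (((if adj x y' = true then weight y' else 0 : ℝ) / weight x : ℝ) : ℂ) * S := by
      intro y'
      split_ifs
      · rw [← mul_assoc, sqrt_div_mul_self]
      · simp
    simp only [this]
    rw [← Finset.sum_mul, ← Complex.ofReal_sum, ← Finset.sum_div, sum_weight_adj,
      mul_div_cancel_right₀ _ (weight_ne x)]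
    ring
  · simp

theorem cupCap_comm {i j : ℕ} (hij : i + 2 ≤ j) (ψ : WalkVec) :
    cupCap i (cupCap j ψ) = cupCap j (cupCap i ψ) := by
  refine cupCap_congr_split (i := j) (fun l hl => ?_) (fun l hl => cupCap_of_length_lt hl _) ?_
  · rcases lt_or_ge l.length (i + 3) with hl' | hl'
    · exact cupCap_of_length_lt hl' _
    · obtain ⟨p, m, rfl, rfl, hm⟩ := exists_append_of_le hl'
      obtain ⟨x, y, x', m, rfl⟩ := exists_cons3 hm
      rw [cupCap_append]
      split_ifs
      · rw [Finset.sum_eq_zero, mul_zero]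
        intro y' _
        rw [cupCap_of_length_lt (by simpa using hl)]
        simp
      · rfl
  rintro p u v u' l rfl
  obtain ⟨p, m, rfl, rfl, hm⟩ := exists_append_of_le hij
  -- the strings at `i` end either in the region `u` or strictly to the left of it
  match m, hm with
  | [x, y], _ =>
    have e1 (y' x' v' u'' : Vtx) : p ++ [x, y'] ++ x' :: v' :: u'' :: l =
      p ++ x :: y' :: x' :: v' :: u'' :: l := by simp
    have e2 (y' x') := cupCap_append' (i := (p ++ [x, y]).length) (p := p ++ [x, y']) (by simp)
      x' v u' l ψ
    simp only [e1] at e2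
    rw [cupCap_append, e1, cupCap_append]
    simp only [e2, e1, cupCap_append]
    by_cases h1 : x = u
    · subst h1
      simp only [mul_ite, mul_zero, ite_sum_zero', Finset.mul_sum]
      rw [Finset.sum_comm]
      refine Finset.sum_congr rfl fun y' _ => Finset.sum_congr rfl fun v' _ => ?_
      split_ifs <;> first | rfl | ring
    · simp [h1]
  | x :: y :: x' :: m, _ =>
    have e1 (y' x'' u v u' : Vtx) : p ++ x :: y' :: x'' :: m ++ u :: v :: u' :: l =
      p ++ x :: y' :: x'' :: (m ++ u :: v :: u' :: l) := by simp
    have e2 (y' x'') := cupCap_append' (i := (p ++ x :: y :: x' :: m).length)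
      (p := p ++ x :: y' :: x'' :: m) (by simp) u v u' l ψ
    simp only [e1] at e2
    rw [cupCap_append, e1, cupCap_append]
    simp only [e2, e1, cupCap_append]
    simp only [mul_ite, mul_zero, ite_sum_zero', Finset.mul_sum]
    rw [Finset.sum_comm]
    refine Finset.sum_congr rfl fun y' _ => Finset.sum_congr rfl fun v' _ => ?_
    split_ifs <;> first | rfl | ring

/-! ### The eighth Jones-Wenzl idempotent annihilates cups -/

/-- Being the list of vertices of a walk of length eight on the graph. -/
def IsWalk8 (l : List Vtx) : Prop := l.length = 9 ∧ l.IsChain (fun x y => adj x y = true)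

theorem isChain_append_cons3 {p l : List Vtx} {x y x' : Vtx} :
    (p ++ x :: y :: x' :: l).IsChain (fun x y => adj x y = true) ↔
      (p ++ [x]).IsChain (fun x y => adj x y = true) ∧ adj x y = true ∧ adj y x' = true ∧
        (x' :: l).IsChain (fun x y => adj x y = true) := by
  rw [List.isChain_split, List.isChain_cons_cons, List.isChain_cons_cons]

/-- Cup-caps preserve the functions supported on the walks of length eight. -/
theorem cupCap_support {i : ℕ} {ψ : WalkVec} (hψ : ∀ l, ¬ IsWalk8 l → ψ l = 0) (l : List Vtx)
    (hl : ¬ IsWalk8 l) : cupCap i ψ l = 0 := by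
  rcases lt_or_ge l.length (i + 3) with h | h
  · exact cupCap_of_length_lt h _
  obtain ⟨p, m, rfl, rfl, hm⟩ := exists_append_of_le h
  obtain ⟨x, y, x', m, rfl⟩ := exists_cons3 hm
  rw [cupCap_append]
  split_ifs with hx
  · obtain ⟨rfl, hx⟩ := hx
    rw [Finset.sum_eq_zero, mul_zero]
    intro y' _
    split_ifs with hy
    · rw [hψ, mul_zero]
      contrapose! hl
      obtain ⟨h1, h2⟩ := hl
      rw [isChain_append_cons3] at h2
      exact ⟨by simpa using h1, isChain_append_cons3.mpr ⟨h2.1, hx, adj_symm hx, h2.2.2.2⟩⟩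
    · rfl
  · rfl

/-- The relation `Eᵢ₊₁ Eᵢ Eᵢ₊₁ = Eᵢ₊₁`.  It is only claimed on walks: if the vertices of
index `i` and `i + 1` are not adjacent, then the left side vanishes but the right side need not. -/
theorem cupCap_down {i : ℕ} (ψ : WalkVec) {l : List Vtx}
    (hl : l.IsChain (fun x y => adj x y = true)) :
    cupCap (i + 1) (cupCap i (cupCap (i + 1) ψ)) l = cupCap (i + 1) ψ l := by
  rcases lt_or_ge l.length (i + 4) with h | h
  · rw [cupCap_of_length_lt h, cupCap_of_length_lt h]
  obtain ⟨p, m, rfl, rfl, hm⟩ := exists_append_of_le h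
  match m, hm with
  | x :: y :: x' :: u :: m, _ =>
    obtain ⟨-, hxy, hyx', -⟩ := isChain_append_cons3.mp hl
    have e1 (y x' u : Vtx) (χ : WalkVec) := cupCap_append' (i := p.length + 1) (p := p ++ [x])
      (by simp) y x' u m χ
    simp only [List.append_assoc, List.singleton_append] at e1
    rw [e1, e1]
    split_ifs with hu
    · obtain ⟨rfl, hyx'⟩ := hu
      congr 1
      simp only [cupCap_append, e1]
      rw [Finset.sum_eq_single x]
      -- of the two sums over intermediate labels only one term survives, in which the square roots
      -- cancel
      · simp only [hxy, adj_symm hxy, if_true, true_and]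
        rw [Finset.sum_eq_single y]
        · simp only [hxy, adj_symm hxy, if_true, and_self]
          generalize (∑ y' : Vtx, _ : ℂ) = S
          have h1 := sqrt_div_mul_sqrt_div_inv x y
          linear_combination ((√(weight y / weight x) : ℝ) * (√(weight x / weight y) : ℝ) * S +
            S : ℂ) * h1
        · intro b _ hb
          simp [hb]
        · simp
      · intro b _ hb
        simp [Ne.symm hb]
      · simp
    · rfl

open Classical in
/-- The projection onto the functions supported on the walks of length eight.  The algebra acts on
all functions on lists, but satisfies the Temperley-Lieb relations on this image only. -/
noncomputable def walkProj : WalkVec →ₗ[ℂ] WalkVec where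
  toFun ψ l := if IsWalk8 l then ψ l else 0
  map_add' φ ψ := by funext l; simp only [Pi.add_apply]; split_ifs <;> simp
  map_smul' c ψ := by
    funext l; simp only [Pi.smul_apply, RingHom.id_apply]; split_ifs <;> simp

theorem walkProj_eq_self {ψ : WalkVec} (hψ : ∀ l, ¬ IsWalk8 l → ψ l = 0) : walkProj ψ = ψ := by
  funext l
  simp only [walkProj, LinearMap.coe_mk, AddHom.coe_mk]
  split_ifs with h
  · rfl
  · exact (hψ l h).symm

theorem walkProj_apply_of_not {l : List Vtx} (h : ¬ IsWalk8 l) (ψ : WalkVec) :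
    walkProj ψ l = 0 := if_neg h

theorem walkProj_apply {l : List Vtx} (h : IsWalk8 l) (ψ : WalkVec) :
    walkProj ψ l = ψ l := if_pos h

theorem walkProj_cupCap (i : ℕ) (ψ : WalkVec) :
    walkProj (cupCap i (walkProj ψ)) = cupCap i (walkProj ψ) :=
  walkProj_eq_self (cupCap_support fun _ h => walkProj_apply_of_not h ψ)

/-- The cup-caps, cut down to the walks of length eight so that they satisfy the Temperley-Lieb
relations. -/
noncomputable def tlGen (i : ℕ) : Module.End ℂ WalkVec := cupCapₗ i ∘ₗ walkProj

theorem tlGen_apply (i : ℕ) (ψ : WalkVec) : tlGen i ψ = cupCap i (walkProj ψ) := rfl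

theorem isTemperleyLieb_tlGen (N : ℕ) : IsTemperleyLieb tlGen (loopValue : ℂ) N where
  sq i _ := by
    ext1 ψ
    simp only [Module.End.mul_apply, tlGen_apply, walkProj_cupCap, cupCap_cupCap,
      LinearMap.smul_apply]
  down i _ := by
    refine LinearMap.ext fun ψ => ?_
    have h0 : ∀ l, ¬ IsWalk8 l → walkProj ψ l = 0 := fun _ h => walkProj_apply_of_not h ψ
    simp only [Module.End.mul_apply, tlGen_apply, walkProj_cupCap]
    rw [walkProj_eq_self (cupCap_support (cupCap_support h0))]
    funext l
    by_cases hl : IsWalk8 l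
    · exact cupCap_down _ hl.2
    · rw [cupCap_support (cupCap_support (cupCap_support h0)) l hl, cupCap_support h0 l hl]
  comm i j hij _ := by
    refine LinearMap.ext fun ψ => ?_
    simp only [Module.End.mul_apply, tlGen_apply, walkProj_cupCap, cupCap_comm hij]

theorem q_add_inv : q + q⁻¹ = loopValue ∧ 1 < q := by
  have h4 : 4 < loopValue ^ 2 := by
    rw [loopValue_sq]; linarith [sqrt21_gt]
  have h2 : 2 < loopValue := by nlinarith [loopValue_pos]
  have hs : √(loopValue ^ 2 - 4) ^ 2 = loopValue ^ 2 - 4 := Real.sq_sqrt (by linarith)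
  have h0 := Real.sqrt_nonneg (loopValue ^ 2 - 4)
  have hq : 1 < q := by rw [q]; linarith
  refine ⟨?_, hq⟩
  have : q ≠ 0 := by positivity
  field_simp
  rw [q]
  linear_combination (1 / 4 : ℝ) * hs

theorem qnum_zero : qnum 0 = 0 := by simp [qnum]

theorem q_sub_inv_pos : 0 < q - q⁻¹ := by
  have h := q_add_inv.2
  have := inv_lt_one_of_one_lt₀ h
  linarith

theorem qnum_one : qnum 1 = 1 := by
  rw [qnum, pow_one, pow_one, div_self q_sub_inv_pos.ne']

theorem qnum_add_two (n : ℕ) : qnum (n + 2) = loopValue * qnum (n + 1) - qnum n := by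
  have h0 : q ≠ 0 := by linarith [q_add_inv.2]
  have h2 : q * q⁻¹ = 1 := mul_inv_cancel₀ h0
  rw [← q_add_inv.1, qnum, qnum, qnum, mul_div_assoc', ← sub_div]
  congr 1
  linear_combination (q⁻¹ ^ n - q ^ n) * h2

theorem qnum_pos (n : ℕ) : 0 < qnum (n + 1) := by
  have h := q_add_inv.2
  refine div_pos (sub_pos.mpr ?_) q_sub_inv_pos
  calc q⁻¹ ^ (n + 1) < 1 := pow_lt_one₀ (by positivity) (inv_lt_one_of_one_lt₀ h) (by omega)
    _ < q ^ (n + 1) := one_lt_pow₀ h (by omega)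

/-- Wenzl's idempotents in the endomorphisms of the space of functions on walks. -/
noncomputable def jw : ℕ → Module.End ℂ WalkVec := wenzl tlGen (fun n => (qnum n : ℂ))

theorem jw_add_two_apply (n : ℕ) (ψ : WalkVec) :
    jw (n + 2) ψ = jw (n + 1) ψ - ((qnum (n + 1) : ℂ) / (qnum (n + 2) : ℂ)) •
      jw (n + 1) (tlGen n (jw (n + 1) ψ)) := rfl

theorem walkProj_jw (n : ℕ) {ψ : WalkVec} (h : walkProj ψ = ψ) : walkProj (jw n ψ) = jw n ψ := by
  induction n using Nat.strong_induction_on generalizing ψ with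
  | _ n ih =>
    match n, ih with
    | 0, _ => exact h
    | 1, _ => exact h
    | n + 2, ih =>
      have h1 {ψ} := ih (n + 1) (by omega) (ψ := ψ)
      rw [jw_add_two_apply, map_sub, map_smul, h1 h, h1 (ψ := tlGen n _) (walkProj_cupCap _ _)]

/-- On walks of length eight the operator `jonesWenzl n` is the abstract idempotent. -/
theorem jonesWenzl_eq_jw (n : ℕ) {ψ : WalkVec} (h : walkProj ψ = ψ) :
    jonesWenzl n ψ = jw n ψ := by
  induction n using Nat.strong_induction_on generalizing ψ with
  | _ n ih =>
    match n, ih with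
    | 0, _ => rfl
    | 1, _ => rfl
    | n + 2, ih =>
      have h1 {ψ} := ih (n + 1) (by omega) (ψ := ψ)
      have h2 : evalDiagram (jw (n + 1) ψ) [.cup n, .cap n] = tlGen n (jw (n + 1) ψ) := by
        rw [tlGen_apply, walkProj_jw _ h]; rfl
      have h3 : walkProj (tlGen n (jw (n + 1) ψ)) = tlGen n (jw (n + 1) ψ) :=
        walkProj_cupCap _ _
      rw [jonesWenzl, h1 h, h2, h1 h3]
      rw [jw_add_two_apply, Complex.ofReal_div]

/-- The idempotent on `n + 1` strings annihilates the cups on these strings. -/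
theorem jw_succ_tlGen {i n : ℕ} (hi : i < n) (ψ : WalkVec) : jw (n + 1) (tlGen i ψ) = 0 := by
  have h := (wenzl_induction (isTemperleyLieb_tlGen n) (a := fun n => (qnum n : ℂ))
    (by simp [qnum_zero]) (by simp [qnum_one])
    (fun n => by simp only [qnum_add_two]; push_cast; ring)
    (fun n => by exact_mod_cast (qnum_pos n).ne') n le_rfl).2.2.2.1 i hi
  exact LinearMap.congr_fun h ψ

/-! ### The coefficient ring -/

/-- `a₀ + a₁ θ + a₂ θ² + a₃ θ³` in `ℤ[θ]`, where `θ⁴ = 3 θ² + 3`. -/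
structure ThetaInt where
  a0 : ℤ
  a1 : ℤ
  a2 : ℤ
  a3 : ℤ
  deriving DecidableEq

namespace ThetaInt

/-- The sum in `ℤ[θ]`. -/
def add (x y : ThetaInt) : ThetaInt := ⟨x.a0 + y.a0, x.a1 + y.a1, x.a2 + y.a2, x.a3 + y.a3⟩

/-- The difference in `ℤ[θ]`. -/
def sub (x y : ThetaInt) : ThetaInt := ⟨x.a0 - y.a0, x.a1 - y.a1, x.a2 - y.a2, x.a3 - y.a3⟩

/-- The product in `ℤ[θ]`, reduced with `θ⁴ = 3 θ² + 3`, `θ⁵ = 3 θ³ + 3 θ` and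
`θ⁶ = 12 θ² + 9`. -/
def mul (x y : ThetaInt) : ThetaInt :=
  ⟨x.a0 * y.a0 + 3 * (x.a1 * y.a3 + x.a2 * y.a2 + x.a3 * y.a1) + 9 * (x.a3 * y.a3),
   x.a0 * y.a1 + x.a1 * y.a0 + 3 * (x.a2 * y.a3 + x.a3 * y.a2),
   x.a0 * y.a2 + x.a1 * y.a1 + x.a2 * y.a0 + 3 * (x.a1 * y.a3 + x.a2 * y.a2 + x.a3 * y.a1) +
     12 * (x.a3 * y.a3),
   x.a0 * y.a3 + x.a1 * y.a2 + x.a2 * y.a1 + x.a3 * y.a0 + 3 * (x.a2 * y.a3 + x.a3 * y.a2)⟩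

end ThetaInt

/-- `x + y ω` in `ℤ[θ, ω]`, where `ω² = -1 - ω`. -/
structure CycInt where
  re : ThetaInt
  om : ThetaInt
  deriving DecidableEq

namespace CycInt

/-- The element with the given coordinates in the basis `θⁱ ωʲ`. -/
def of (a0 a1 a2 a3 b0 b1 b2 b3 : ℤ) : CycInt := ⟨⟨a0, a1, a2, a3⟩, ⟨b0, b1, b2, b3⟩⟩

instance : Zero CycInt := ⟨of 0 0 0 0 0 0 0 0⟩
instance : Add CycInt := ⟨fun x y => ⟨x.re.add y.re, x.om.add y.om⟩⟩
instance : Sub CycInt := ⟨fun x y => ⟨x.re.sub y.re, x.om.sub y.om⟩⟩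
instance : Mul CycInt := ⟨fun x y =>
  ⟨(x.re.mul y.re).sub (x.om.mul y.om),
    ((x.re.mul y.om).add (x.om.mul y.re)).sub (x.om.mul y.om)⟩⟩

end CycInt

theorem weight_c_div_z (i : Fin 3) : weight .c / weight (.z i) = (3 + √21) / 2 := by
  have h1 := weight_ne (.z i)
  rw [weight_c i, weight_b i i, div_eq_iff h1]
  have h2 : √3 * loopValue = (3 + √21) / 2 := by
    have := loopValue_relation
    rw [loopValue_sq] at this
    linarith
  linear_combination weight (.z i) * h2

theorem theta_sq : theta ^ 2 = (3 + √21) / 2 := by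
  rw [theta, Real.sq_sqrt (div_pos (weight_pos _) (weight_pos _)).le, weight_c_div_z]

theorem theta_pos : 0 < theta := Real.sqrt_pos.mpr (div_pos (weight_pos _) (weight_pos _))

theorem theta_pow_four : theta ^ 4 = 3 * theta ^ 2 + 3 := by
  have h : theta ^ 4 = (theta ^ 2) ^ 2 := by ring
  rw [h, theta_sq]
  linear_combination (1 / 4 : ℝ) * sqrt21_sq

theorem bigR_pos : 0 < bigR := Real.sqrt_pos.mpr (div_pos (weight_pos _) (weight_pos _))

theorem bigR_sq : bigR ^ 2 = theta ^ 2 - 3 := by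
  rw [bigR, Real.sq_sqrt (div_pos (weight_pos _) (weight_pos _)).le, theta,
    Real.sq_sqrt (div_pos (weight_pos _) (weight_pos _)).le, weight_c 0, weight_b 0 0, weight_d 0]
  have h1 := weight_ne (.z 0)
  have h2 := loopValue_pos.ne'
  have h3 : √3 ^ 2 = (3 : ℝ) := Real.sq_sqrt (by norm_num)
  field_simp
  linear_combination -√3 * loopValue_relation - loopValue * h3

theorem omega_eq : omega = -1 / 2 + (√3 : ℝ) / 2 * Complex.I := by
  have h : (2 * Real.pi * Complex.I / 3 : ℂ) = ((2 * Real.pi / 3 : ℝ) : ℂ) * Complex.I := by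
    push_cast; ring
  have h2 : 2 * Real.pi / 3 = Real.pi - Real.pi / 3 := by ring
  rw [omega, h, Complex.exp_mul_I, ← Complex.ofReal_cos, ← Complex.ofReal_sin, h2,
    Real.cos_pi_sub, Real.sin_pi_sub, Real.cos_pi_div_three, Real.sin_pi_div_three]
  push_cast
  ring

theorem omega_sq : omega ^ 2 = -1 - omega := by
  have h3 : ((√3 : ℝ) : ℂ) ^ 2 = 3 := by
    rw [← Complex.ofReal_pow, Real.sq_sqrt (by norm_num)]; norm_num
  rw [omega_eq]
  linear_combination (1 / 4 : ℂ) * Complex.I ^ 2 * h3 + (3 / 4 : ℂ) * Complex.I_sq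

theorem thetaC_pow_four : (theta : ℂ) ^ 4 = 3 * (theta : ℂ) ^ 2 + 3 := by
  exact_mod_cast congrArg (Complex.ofReal) theta_pow_four

/-- The value in `ℂ` of an element of `ℤ[θ]`. -/
noncomputable def ThetaInt.eval (x : ThetaInt) : ℂ :=
  x.a0 + x.a1 * theta + x.a2 * (theta : ℂ) ^ 2 + x.a3 * (theta : ℂ) ^ 3

theorem ThetaInt.eval_add (x y : ThetaInt) : (x.add y).eval = x.eval + y.eval := by
  simp only [eval, add]; push_cast; ring

theorem ThetaInt.eval_sub (x y : ThetaInt) : (x.sub y).eval = x.eval - y.eval := by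
  simp only [eval, sub]; push_cast; ring

theorem ThetaInt.eval_mul (x y : ThetaInt) : (x.mul y).eval = x.eval * y.eval := by
  have h4 := thetaC_pow_four
  simp only [eval, mul]
  push_cast
  linear_combination -(x.a1 * y.a3 + x.a2 * y.a2 + x.a3 * y.a1 +
    (x.a2 * y.a3 + x.a3 * y.a2) * (theta : ℂ) + x.a3 * y.a3 * ((theta : ℂ) ^ 2 + 3)) * h4

/-- The value in `ℂ` of an element of `ℤ[θ, ω]`. -/
noncomputable def CycInt.eval (x : CycInt) : ℂ := x.re.eval + x.om.eval * omega

namespace CycInt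

theorem eval_of (a0 a1 a2 a3 b0 b1 b2 b3 : ℤ) : (of a0 a1 a2 a3 b0 b1 b2 b3).eval =
    a0 + a1 * theta + a2 * (theta : ℂ) ^ 2 + a3 * (theta : ℂ) ^ 3 +
      (b0 + b1 * theta + b2 * (theta : ℂ) ^ 2 + b3 * (theta : ℂ) ^ 3) * omega := rfl

@[simp] theorem eval_zero : (0 : CycInt).eval = 0 := by
  change (of 0 0 0 0 0 0 0 0).eval = 0
  rw [eval_of]; simp

theorem eval_add (x y : CycInt) : (x + y).eval = x.eval + y.eval := by
  change ThetaInt.eval (x.re.add y.re) + ThetaInt.eval (x.om.add y.om) * omega = _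
  rw [ThetaInt.eval_add, ThetaInt.eval_add, eval, eval]; ring

theorem eval_sub (x y : CycInt) : (x - y).eval = x.eval - y.eval := by
  change ThetaInt.eval (x.re.sub y.re) + ThetaInt.eval (x.om.sub y.om) * omega = _
  rw [ThetaInt.eval_sub, ThetaInt.eval_sub, eval, eval]; ring

theorem eval_mul (x y : CycInt) : (x * y).eval = x.eval * y.eval := by
  change ThetaInt.eval ((x.re.mul y.re).sub (x.om.mul y.om)) +
    ThetaInt.eval (((x.re.mul y.om).add (x.om.mul y.re)).sub (x.om.mul y.om)) * omega = _
  simp only [ThetaInt.eval_sub, ThetaInt.eval_add, ThetaInt.eval_mul, eval]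
  linear_combination -(x.om.eval * y.om.eval) * omega_sq

/-- The product with `θ`.  It is much cheaper to evaluate than a general product. -/
def mulTh (x : CycInt) : CycInt :=
  ⟨⟨3 * x.re.a3, x.re.a0, x.re.a1 + 3 * x.re.a3, x.re.a2⟩,
    ⟨3 * x.om.a3, x.om.a0, x.om.a1 + 3 * x.om.a3, x.om.a2⟩⟩

theorem eval_mulTh (x : CycInt) : x.mulTh.eval = theta * x.eval := by
  simp only [eval, ThetaInt.eval, mulTh]
  push_cast
  linear_combination -(x.re.a3 + x.om.a3 * omega) * thetaC_pow_four

/-- The product with `ω`. -/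
def mulOm (x : CycInt) : CycInt :=
  ⟨⟨-x.om.a0, -x.om.a1, -x.om.a2, -x.om.a3⟩, x.re.sub x.om⟩

theorem eval_mulOm (x : CycInt) : x.mulOm.eval = omega * x.eval := by
  simp only [CycInt.eval, ThetaInt.eval, CycInt.mulOm, ThetaInt.sub]
  push_cast
  linear_combination -(((x.om.a0 : ℂ) + x.om.a1 * theta + x.om.a2 * theta ^ 2 +
    x.om.a3 * theta ^ 3)) * omega_sq

end CycInt

/-! ### Walks modulo cups -/

/-- The image under the idempotent of a single walk; zero on lists that are not walks. -/
noncomputable def jwWalk (l : List Vtx) : WalkVec := jw 8 (walkProj (Pi.single l 1))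

theorem walkProj_single_of_not {l : List Vtx} (h : ¬ IsWalk8 l) :
    walkProj (Pi.single l 1) = 0 := by
  funext m
  by_cases hm : IsWalk8 m
  · rw [walkProj_apply hm, Pi.single_eq_of_ne (by rintro rfl; exact h hm)]; rfl
  · exact walkProj_apply_of_not hm _

theorem jwWalk_of_not {l : List Vtx} (h : ¬ IsWalk8 l) : jwWalk l = 0 := by
  rw [jwWalk, walkProj_single_of_not h, map_zero]

theorem single_append_cons3 (p l : List Vtx) (x y : Vtx) (hxy : adj x y = true) :
    cupCap p.length (Pi.single (p ++ x :: y :: x :: l) 1) =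
      ((√(weight y / weight x) : ℝ) : ℂ) • ∑ y', (if adj x y' = true then
        ((√(weight y' / weight x) : ℝ) : ℂ) • (Pi.single (p ++ x :: y' :: x :: l) 1 : WalkVec)
          else 0) := by
  refine cupCap_congr_split (i := p.length) (fun m hm => cupCap_of_length_lt hm _)
    (fun m hm => ?_) ?_
  · rw [Pi.smul_apply, Finset.sum_apply, Finset.sum_eq_zero, smul_zero]
    intro y' _
    split_ifs
    · rw [Pi.smul_apply, Pi.single_eq_of_ne, smul_zero]
      rintro rfl
      simp at hm
      omega
    · rfl
  · intro p' u v u' m hp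
    rw [cupCap_append' hp, Pi.smul_apply, Finset.sum_apply]
    have key (v' : Vtx) : (Pi.single (p ++ x :: y :: x :: l) 1 : WalkVec)
        (p' ++ u :: v' :: u :: m) = if p' = p ∧ u = x ∧ v' = y ∧ m = l then 1 else 0 := by
      rw [Pi.single_apply]
      refine if_congr ⟨fun h => ?_, ?_⟩ rfl rfl
      · obtain ⟨rfl, h⟩ := List.append_inj h hp
        simp_all
      · rintro ⟨rfl, rfl, rfl, rfl⟩; rfl
    have key2 (y' : Vtx) : (Pi.single (p ++ x :: y' :: x :: l) 1 : WalkVec)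
        (p' ++ u :: v :: u' :: m) = if p' = p ∧ u = x ∧ v = y' ∧ u' = x ∧ m = l then 1 else 0 := by
      rw [Pi.single_apply]
      refine if_congr ⟨fun h => ?_, ?_⟩ rfl rfl
      · obtain ⟨rfl, h⟩ := List.append_inj h hp
        simp_all
      · rintro ⟨rfl, rfl, rfl, rfl, rfl⟩; rfl
    have e : ∀ y', (if adj x y' = true then ((√(weight y' / weight x) : ℝ) : ℂ) •
        (Pi.single (p ++ x :: y' :: x :: l) 1 : WalkVec) else 0) (p' ++ u :: v :: u' :: m) =
        if adj x y' = true then ((√(weight y' / weight x) : ℝ) : ℂ) *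
          (if p' = p ∧ u = x ∧ v = y' ∧ u' = x ∧ m = l then 1 else 0) else 0 := by
      intro y'
      split_ifs <;> simp_all
    simp only [key, e, smul_eq_mul]
    by_cases h0 : p' = p ∧ u = x ∧ m = l
    · obtain ⟨rfl, rfl, rfl⟩ := h0
      by_cases h1 : u = u'
      · subst h1
        simp only [true_and, and_true]
        rw [Finset.sum_eq_single y, Finset.sum_eq_single v]
        · simp only [hxy, if_true, mul_one]
          split_ifs <;> ring
        · intro b _ hb
          simp [Ne.symm hb]
        · simp
        · intro b _ hb
          simp [hb]
        · simp
      · simp [h1, Ne.symm h1]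
    · have h1 (y' : Vtx) : ¬ (p' = p ∧ u = x ∧ y' = y ∧ m = l) := by tauto
      have h2 (y' : Vtx) : ¬ (p' = p ∧ u = x ∧ v = y' ∧ u' = x ∧ m = l) := by tauto
      simp [h1, h2]

theorem sum_apply_walkProj_single {J : Module.End ℂ WalkVec}
    (hJ : ∀ i < 7, ∀ ψ, J (tlGen i ψ) = 0) (p l : List Vtx) (x : Vtx) :
    ∑ y, (if adj x y = true then ((√(weight y) : ℝ) : ℂ) •
      J (walkProj (Pi.single (p ++ x :: y :: x :: l) 1)) else 0) = 0 := by
  have h0 {m} (hm : ¬ IsWalk8 m) : J (walkProj (Pi.single m 1)) = 0 := by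
    rw [walkProj_single_of_not hm, map_zero]
  by_cases h : ∃ y, adj x y = true ∧ IsWalk8 (p ++ x :: y :: x :: l)
  · obtain ⟨y, hxy, hw⟩ := h
    have hlen : p.length < 7 := by
      have := hw.1
      simp at this
      omega
    have hw' (y') (hy' : adj x y' = true) : IsWalk8 (p ++ x :: y' :: x :: l) :=
      ⟨by simpa using hw.1, isChain_append_cons3.mpr
        ⟨(isChain_append_cons3.mp hw.2).1, hy', adj_symm hy', (isChain_append_cons3.mp hw.2).2.2.2⟩⟩
    have hs {m} (hm : IsWalk8 m) : walkProj (Pi.single m 1) = Pi.single m 1 :=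
      walkProj_eq_self fun l hl => Pi.single_eq_of_ne (by rintro rfl; exact hl hm) _
    have h0 := hJ _ hlen (Pi.single (p ++ x :: y :: x :: l) 1)
    rw [tlGen_apply, hs hw, single_append_cons3 _ _ _ _ hxy, map_smul, map_sum] at h0
    have hne (y') : ((√(weight y' / weight x) : ℝ) : ℂ) ≠ 0 := by
      exact_mod_cast (Real.sqrt_pos.mpr (div_pos (weight_pos _) (weight_pos _))).ne'
    have h1 := (smul_eq_zero.mp h0).resolve_left (hne y)
    have h2 : ∀ y', (if adj x y' = true then ((√(weight y') : ℝ) : ℂ) •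
        J (walkProj (Pi.single (p ++ x :: y' :: x :: l) 1)) else 0) =
        ((√(weight x) : ℝ) : ℂ) • J (if adj x y' = true then ((√(weight y' / weight x) : ℝ) : ℂ) •
          Pi.single (p ++ x :: y' :: x :: l) 1 else 0) := by
      intro y'
      split_ifs with hy
      · rw [map_smul, smul_smul, hs (hw' y' hy), ← Complex.ofReal_mul,
          ← Real.sqrt_mul (weight_pos _).le, mul_div_cancel₀ _ (weight_ne _)]
      · simp
    simp only [h2, ← Finset.smul_sum]
    rw [h1, smul_zero]
  · rw [Finset.sum_eq_zero]
    intro y _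
    split_ifs with hy
    · rw [h0 fun hw => h ⟨y, hy, hw⟩, smul_zero]
    · rfl

/-- The relation among the walks `⋯ x y x ⋯` with varying `y`: their sum with the weights `√λ(y)`
is, up to a scalar, a cup inserted at `x`. -/
theorem sum_jwWalk (p l : List Vtx) (x : Vtx) :
    ∑ y, (if adj x y = true then ((√(weight y) : ℝ) : ℂ) • jwWalk (p ++ x :: y :: x :: l)
      else 0) = 0 :=
  sum_apply_walkProj_single (fun _ hi => jw_succ_tlGen (n := 7) hi) p l x

/-- The class of a walk modulo cups, rescaled by a factor `R` for each passage through `d`.  In this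
normalization all relations have coefficients in `ℤ[θ]`. -/
noncomputable def walkClass (l : List Vtx) : WalkVec := (bigR : ℂ) ^ l.count .d • jwWalk l

theorem walkClass_of_not {l : List Vtx} (h : ¬ IsWalk8 l) : walkClass l = 0 := by
  rw [walkClass, jwWalk_of_not h, smul_zero]

theorem walkClass_of_not_adj_left (p l : List Vtx) {x y : Vtx} (h : ¬ adj x y = true) :
    walkClass (p ++ x :: y :: l) = 0 := by
  refine walkClass_of_not fun hw => h ?_
  have := hw.2
  rw [List.isChain_append_cons_cons] at this
  exact this.2.1

theorem walkClass_of_not_adj_right (p l : List Vtx) {x y z : Vtx} (h : ¬ adj y z = true) :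
    walkClass (p ++ x :: y :: z :: l) = 0 := by
  have := walkClass_of_not_adj_left (p ++ [x]) l h
  simpa using this

theorem sqrt_weight_ne (x : Vtx) : ((√(weight x) : ℝ) : ℂ) ≠ 0 := by
  exact_mod_cast (Real.sqrt_pos.mpr (weight_pos x)).ne'

theorem sqrt_weight_c (i : Fin 3) :
    ((√(weight .c) : ℝ) : ℂ) = theta * (√(weight (.z i)) : ℝ) := by
  rw [theta, ← Complex.ofReal_mul, ← Real.sqrt_mul (div_pos (weight_pos _) (weight_pos _)).le]
  rw [show weight (.z 0) = weight (.z i) from rfl, div_mul_cancel₀ _ (weight_ne _)]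

theorem sqrt_weight_d (i : Fin 3) :
    ((√(weight .d) : ℝ) : ℂ) = bigR * (√(weight (.b i)) : ℝ) := by
  rw [bigR, ← Complex.ofReal_mul, ← Real.sqrt_mul (div_pos (weight_pos _) (weight_pos _)).le]
  rw [show weight (.b 0) = weight (.b i) from rfl, div_mul_cancel₀ _ (weight_ne _)]

theorem walkClass_b_z_b (p l : List Vtx) (i : Fin 3) :
    walkClass (p ++ .b i :: .z i :: .b i :: l) =
      -(theta : ℂ) • walkClass (p ++ .b i :: .c :: .b i :: l) := by
  have h := sum_jwWalk p l (.b i)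
  rw [sum_vtx] at h
  simp only [adj] at h
  simp only [beq_iff_eq, Finset.sum_ite_eq, Finset.mem_univ, if_true, Finset.sum_const_zero,
    Bool.false_eq_true, if_false, add_zero, sqrt_weight_c i, mul_comm (theta : ℂ), mul_smul] at h
  rw [← smul_add] at h
  have h' := (smul_eq_zero.mp h).resolve_left (sqrt_weight_ne _)
  have e : jwWalk (p ++ .b i :: .z i :: .b i :: l) =
      -(theta : ℂ) • jwWalk (p ++ .b i :: .c :: .b i :: l) := by
    rw [neg_smul]; exact eq_neg_of_add_eq_zero_left h'
  rw [walkClass, walkClass, e, smul_comm]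
  simp

theorem walkClass_z_b_z (p l : List Vtx) (i j : Fin 3) :
    walkClass (p ++ .z i :: .b j :: .z i :: l) = 0 := by
  by_cases hij : i = j
  · subst hij
    have h := sum_jwWalk p l (.z i)
    rw [sum_vtx] at h
    simp only [adj] at h
    simp only [beq_iff_eq, Finset.sum_ite_eq, Finset.mem_univ, if_true, Finset.sum_const_zero,
      Bool.false_eq_true, if_false, add_zero, zero_add] at h
    rw [walkClass, (smul_eq_zero.mp h).resolve_left (sqrt_weight_ne _), smul_zero]
  · exact walkClass_of_not_adj_left _ _ (by simpa [adj] using hij)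

theorem walkClass_d_c_d (p l : List Vtx) : walkClass (p ++ .d :: .c :: .d :: l) = 0 := by
  have h := sum_jwWalk p l .d
  rw [sum_vtx] at h
  simp only [adj] at h
  simp only [if_true, Finset.sum_const_zero,
      Bool.false_eq_true, if_false, add_zero, zero_add] at h
  rw [walkClass, (smul_eq_zero.mp h).resolve_left (sqrt_weight_ne _), smul_zero]

theorem walkClass_c_d_c (p l : List Vtx) :
    walkClass (p ++ .c :: .d :: .c :: l) = -∑ i, walkClass (p ++ .c :: .b i :: .c :: l) := by
  have h := sum_jwWalk p l .c
  rw [sum_vtx] at h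
  simp only [adj] at h
  simp only [if_true, Finset.sum_const_zero,
      Bool.false_eq_true, if_false, add_zero, zero_add, sqrt_weight_d 0] at h
  have e : ∀ i, ((√(weight (.b i)) : ℝ) : ℂ) = (√(weight (.b 0)) : ℝ) := fun i => rfl
  simp only [e, mul_comm (bigR : ℂ), mul_smul] at h
  rw [← Finset.smul_sum, ← smul_add] at h
  have h' := (smul_eq_zero.mp h).resolve_left (sqrt_weight_ne _)
  have h2 := eq_neg_of_add_eq_zero_right h'
  simp only [walkClass]
  have e2 : (p ++ .c :: .d :: .c :: l).count .d = (p ++ .c :: .b 0 :: .c :: l).count .d + 1 := by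
    simp
    omega
  have e3 (i) : (p ++ .c :: .b i :: .c :: l).count .d = (p ++ .c :: .b 0 :: .c :: l).count .d := by
    simp
  simp only [e3]
  rw [e2, pow_succ, mul_smul, h2, smul_neg, Finset.smul_sum]

theorem theta_ne : (theta : ℂ) ≠ 0 := by exact_mod_cast theta_pos.ne'

theorem walkClass_z_b_c_b (p l : List Vtx) (i : Fin 3) :
    walkClass (p ++ .z i :: .b i :: .c :: .b i :: l) = 0 := by
  have h := walkClass_b_z_b (p ++ [.z i]) l i
  simp only [List.append_assoc, List.singleton_append] at h
  rw [walkClass_z_b_z] at h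
  exact (smul_eq_zero.mp h.symm).resolve_left (neg_ne_zero.mpr theta_ne)

theorem walkClass_b_c_b_z (p l : List Vtx) (i : Fin 3) :
    walkClass (p ++ .b i :: .c :: .b i :: .z i :: l) = 0 := by
  have h := walkClass_b_z_b p (.z i :: l) i
  have h2 := walkClass_z_b_z (p ++ [.b i]) l i i
  simp only [List.append_assoc, List.singleton_append] at h2
  rw [h2] at h
  exact (smul_eq_zero.mp h.symm).resolve_left (neg_ne_zero.mpr theta_ne)

theorem walkClass_b_c_b_c_b (p l : List Vtx) (i : Fin 3) :
    walkClass (p ++ .b i :: .c :: .b i :: .c :: .b i :: l) = 0 := by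
  have h := walkClass_b_z_b p (.c :: .b i :: l) i
  have h2 := walkClass_z_b_c_b (p ++ [.b i]) l i
  simp only [List.append_assoc, List.singleton_append] at h2
  rw [h2] at h
  exact (smul_eq_zero.mp h.symm).resolve_left (neg_ne_zero.mpr theta_ne)

theorem sum_walkClass_d_c_b (p l : List Vtx) :
    ∑ i, walkClass (p ++ .d :: .c :: .b i :: .c :: l) = 0 := by
  have h := walkClass_c_d_c (p ++ [.d]) l
  simp only [List.append_assoc, List.singleton_append] at h
  rw [walkClass_d_c_d] at h
  exact neg_eq_zero.mp h.symm

theorem sum_walkClass_b_c_d (p l : List Vtx) :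
    ∑ i, walkClass (p ++ .c :: .b i :: .c :: .d :: l) = 0 := by
  have h := walkClass_c_d_c p (.d :: l)
  have h2 := walkClass_d_c_d (p ++ [.c]) l
  simp only [List.append_assoc, List.singleton_append] at h2
  rw [h2] at h
  exact neg_eq_zero.mp h.symm

theorem sum_sum_walkClass (p l : List Vtx) :
    ∑ i, ∑ j, walkClass (p ++ .c :: .b i :: .c :: .b j :: .c :: l) = 0 := by
  have h := sum_walkClass_b_c_d p (.c :: l)
  have h2 (i) := walkClass_c_d_c (p ++ [.c, .b i]) l
  simp only [List.append_assoc, List.cons_append, List.nil_append] at h2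
  simp only [h2, Finset.sum_neg_distrib] at h
  exact neg_eq_zero.mp h

/-! ### Collapsing coefficient functions -/

open CycInt

/-- The coefficient of `⋯ u c v ⋯` after the legs `z` between the odd vertices `u` and `v` have been
removed with `walkClass_b_z_b`; here `f x` is the coefficient of `⋯ u x v ⋯`. -/
def collapseEven (u v : Vtx) (f : Vtx → CycInt) : CycInt :=
  match u, v with
  | .b i, .b j => if i = j then f .c - (f (.z i)).mulTh else f .c
  | _, _ => f .c

/-- The coefficient of `⋯ u (b i) v ⋯` after `d` has been removed between the even vertices `u` and
`v` with `walkClass_c_d_c`; here `f x` is the coefficient of `⋯ u x v ⋯`. -/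
def collapseOdd (u v : Vtx) (f : Vtx → CycInt) (i : Fin 3) : CycInt :=
  match u, v with
  | .c, .c => f (.b i) - f .d
  | .c, .z j => if i = j then f (.b i) else 0
  | .z j, .c => if i = j then f (.b i) else 0
  | .z j, .z k => if i = j ∧ i = k then f (.b i) else 0
  | _, _ => 0

/-- In the sum over the even vertex between `u` and `v`, only `c` need be kept. -/
theorem sum_collapseEven (p l : List Vtx) {u v : Vtx} (hu : isEven u = false)
    (hv : isEven v = false) (f : Vtx → CycInt) :
    ∑ x, (f x).eval • walkClass (p ++ u :: x :: v :: l) =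
      (collapseEven u v f).eval • walkClass (p ++ u :: .c :: v :: l) := by
  have hl (x) (h : ¬ adj u x = true) : walkClass (p ++ u :: x :: v :: l) = 0 :=
    walkClass_of_not_adj_left _ _ h
  have hr (x) (h : ¬ adj x v = true) : walkClass (p ++ u :: x :: v :: l) = 0 :=
    walkClass_of_not_adj_right _ _ h
  rw [sum_vtx]
  match u, v, hu, hv with
  | .d, v, _, _ =>
    simp [hl (.z _) (by simp [adj]), hl (.b _) (by simp [adj]), hl .d (by simp [adj]),
      collapseEven]
  | .b i, .d, _, _ =>
    simp [hr (.z _) (by simp [adj]), hr (.b _) (by simp [adj]), hr .d (by simp [adj]),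
      collapseEven]
  | .b i, .b j, _, _ =>
    simp only [hl (.b _) (by simp [adj]), hl .d (by simp [adj]), smul_zero, Finset.sum_const_zero,
      add_zero, collapseEven]
    rw [Finset.sum_eq_single i]
    · split_ifs with hij
      · subst hij
        rw [walkClass_b_z_b, smul_smul, ← add_smul, eval_sub, eval_mulTh]
        congr 1
        ring
      · rw [hr _ (by simpa [adj] using hij)]
        simp
    · intro k _ hk
      rw [hl _ (by simpa [adj] using hk.symm), smul_zero]
    · simp

/-- In the sum over the odd vertex between `u` and `v`, only the legs `b i` need be kept. -/
theorem sum_collapseOdd (p l : List Vtx) {u v : Vtx} (hu : isEven u = true)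
    (hv : isEven v = true) (f : Vtx → CycInt) :
    ∑ x, (f x).eval • walkClass (p ++ u :: x :: v :: l) =
      ∑ i, (collapseOdd u v f i).eval • walkClass (p ++ u :: .b i :: v :: l) := by
  have hl (x) (h : ¬ adj u x = true) : walkClass (p ++ u :: x :: v :: l) = 0 :=
    walkClass_of_not_adj_left _ _ h
  have hr (x) (h : ¬ adj x v = true) : walkClass (p ++ u :: x :: v :: l) = 0 :=
    walkClass_of_not_adj_right _ _ h
  rw [sum_vtx]
  match u, v, hu, hv with
  | .c, .c, _, _ =>
    simp only [hl (.z _) (by simp [adj]), hl .c (by simp [adj]), smul_zero, Finset.sum_const_zero,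
      add_zero, zero_add, collapseOdd, walkClass_c_d_c, eval_sub, sub_smul, Finset.sum_sub_distrib,
      smul_neg, Finset.smul_sum, ← sub_eq_add_neg]
  | .z j, v, _, hv =>
    simp only [hl (.z _) (by simp [adj]), hl .c (by simp [adj]), hl .d (by simp [adj]), smul_zero,
      Finset.sum_const_zero, add_zero, zero_add]
    refine Finset.sum_congr rfl fun i _ => ?_
    by_cases hij : i = j
    · subst hij
      match v, hv with
      | .c, _ => simp [collapseOdd]
      | .z k, _ =>
        by_cases hik : i = k
        · simp [collapseOdd, hik]
        · rw [hr _ (by simpa [adj] using hik)]; simp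
    · rw [hl _ (by simpa [adj] using Ne.symm hij)]; simp
  | .c, .z j, _, _ =>
    simp only [hr (.z _) (by simp [adj]), hr .c (by simp [adj]), hr .d (by simp [adj]), smul_zero,
      Finset.sum_const_zero, add_zero, zero_add]
    refine Finset.sum_congr rfl fun i _ => ?_
    by_cases hij : i = j
    · subst hij
      simp [collapseOdd]
    · rw [hr _ (by simpa [adj] using hij)]; simp

theorem adj_eq_false_of_isEven_eq {x y : Vtx} (h : isEven x = isEven y) : ¬ adj x y = true := by
  cases x <;> cases y <;> simp_all [isEven, adj]

/-- The collapse of the coefficients `f x₁ x₂ x₃` of the walks `w x₁ x₂ x₃ e` between even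
vertices to those of the walks `w (b i) c (b j) e`. -/
def collapseEvenArc (w e : Vtx) (f : Vtx → Vtx → Vtx → CycInt) (i j : Fin 3) : CycInt :=
  collapseOdd w .c (fun x₁ => collapseOdd .c e (fun x₃ =>
    collapseEven x₁ x₃ fun x₂ => f x₁ x₂ x₃) j) i

/-- The collapse of the coefficients `f x₁ x₂ x₃` of the walks `w x₁ x₂ x₃ r` between odd
vertices to those of the walks `w c (b i) c r`. -/
def collapseOddArc (w r : Vtx) (f : Vtx → Vtx → Vtx → CycInt) (i : Fin 3) : CycInt :=
  collapseOdd .c .c (fun x₂ => collapseEven w x₂ fun x₁ => collapseEven x₂ r fun x₃ =>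
    f x₁ x₂ x₃) i

theorem sum_collapseEvenArc (p l : List Vtx) {w e : Vtx} (hw : isEven w = true)
    (he : isEven e = true) (f : Vtx → Vtx → Vtx → CycInt) :
    ∑ x₁, ∑ x₃, ∑ x₂, (f x₁ x₂ x₃).eval • walkClass (p ++ w :: x₁ :: x₂ :: x₃ :: e :: l) =
      ∑ i, ∑ j, (collapseEvenArc w e f i j).eval •
        walkClass (p ++ w :: .b i :: .c :: .b j :: e :: l) := by
  have h1 (x₁ x₃) : ∑ x₂, (f x₁ x₂ x₃).eval • walkClass (p ++ w :: x₁ :: x₂ :: x₃ :: e :: l) =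
      (collapseEven x₁ x₃ fun x₂ => f x₁ x₂ x₃).eval •
        walkClass (p ++ w :: x₁ :: .c :: x₃ :: e :: l) := by
    cases h₁ : isEven x₁
    · cases h₃ : isEven x₃
      · simpa using sum_collapseEven (p ++ [w]) (e :: l) h₁ h₃ fun x₂ => f x₁ x₂ x₃
      · have h0 (x₂) : walkClass (p ++ w :: x₁ :: x₂ :: x₃ :: e :: l) = 0 := by
          simpa using walkClass_of_not_adj_right (x := x₂) (p ++ [w, x₁]) l
            (adj_eq_false_of_isEven_eq (h₃.trans he.symm))
        simp [h0]
    · have h0 (x₂) : walkClass (p ++ w :: x₁ :: x₂ :: x₃ :: e :: l) = 0 :=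
        walkClass_of_not_adj_left _ _ (adj_eq_false_of_isEven_eq (hw.trans h₁.symm))
      simp [h0]
  have h2 (x₁) := sum_collapseOdd (p ++ [w, x₁]) l (u := .c) rfl he fun x₃ =>
    collapseEven x₁ x₃ fun x₂ => f x₁ x₂ x₃
  simp only [List.append_assoc, List.cons_append, List.nil_append] at h2
  simp only [h1, h2]
  rw [Finset.sum_comm]
  have h3 (j) := sum_collapseOdd p (.b j :: e :: l) hw (v := .c) rfl fun x₁ =>
    collapseOdd .c e (fun x₃ => collapseEven x₁ x₃ fun x₂ => f x₁ x₂ x₃) j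
  simp only [h3]
  rw [Finset.sum_comm]
  rfl

theorem sum_collapseOddArc (p l : List Vtx) {w r : Vtx} (hw : isEven w = false)
    (hr : isEven r = false) (f : Vtx → Vtx → Vtx → CycInt) :
    ∑ x₂, ∑ x₁, ∑ x₃, (f x₁ x₂ x₃).eval • walkClass (p ++ w :: x₁ :: x₂ :: x₃ :: r :: l) =
      ∑ i, (collapseOddArc w r f i).eval •
        walkClass (p ++ w :: .c :: .b i :: .c :: r :: l) := by
  have h1 (x₂) : ∑ x₁, ∑ x₃, (f x₁ x₂ x₃).eval •
      walkClass (p ++ w :: x₁ :: x₂ :: x₃ :: r :: l) =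
      (collapseEven w x₂ fun x₁ => collapseEven x₂ r fun x₃ => f x₁ x₂ x₃).eval •
        walkClass (p ++ w :: .c :: x₂ :: .c :: r :: l) := by
    cases h₂ : isEven x₂
    · have h3 (x₁) := sum_collapseEven (p ++ [w, x₁]) l h₂ hr fun x₃ => f x₁ x₂ x₃
      simp only [List.append_assoc, List.cons_append, List.nil_append] at h3
      simp only [h3]
      exact sum_collapseEven p (.c :: r :: l) hw h₂ _
    · have h0 (x₁ x₃) : walkClass (p ++ w :: x₁ :: x₂ :: x₃ :: r :: l) = 0 := by
        by_cases h : adj w x₁ = true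
        · refine walkClass_of_not_adj_right _ _ (adj_eq_false_of_isEven_eq ?_)
          rw [h₂]
          by_contra h'
          exact adj_eq_false_of_isEven_eq (hw.trans (by simpa using h')) h
        · exact walkClass_of_not_adj_left _ _ h
      simp [h0]
  simp only [h1]
  simpa [collapseOddArc] using sum_collapseOdd (p ++ [w]) (r :: l) (u := .c) (v := .c) rfl rfl
    fun x₂ => collapseEven w x₂ fun x₁ => collapseEven x₂ r fun x₃ => f x₁ x₂ x₃

/-! ### The generators in terms of tables over `ℤ[θ, ω]` -/

/-- Coefficients in `ℤ[θ, ω]` of a three-box, up to the factor `boxGauge`. -/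
abbrev Table : Type := (Fin 6 → Vtx) → CycInt

/-- The factor of `R` for a passage through `d`. -/
noncomputable def dFactor (x : Vtx) : ℝ := if x = .d then bigR else 1

/-- The factor between the coefficients of a three-box and its table.  With it the rotation has
no coefficients, and the coefficients of the generators lie in `ℤ[θ, ω]` up to a common scalar. -/
noncomputable def boxGauge (m : Fin 6 → Vtx) : ℝ :=
  (√(weight (m 0) * weight (m 3)))⁻¹ * ∏ i, dFactor (m i)

/-- The three-box with a given table. -/
noncomputable def gaugeBox (Y : Table) : ThreeBox := fun m => (boxGauge m : ℂ) * (Y m).eval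

namespace Table

/-- The table of `x • l`.  The comparison is spelled out to be cheap to evaluate. -/
def single (l : Fin 6 → Vtx) (x : CycInt) : Table := fun m =>
  if m 0 = l 0 ∧ m 1 = l 1 ∧ m 2 = l 2 ∧ m 3 = l 3 ∧ m 4 = l 4 ∧ m 5 = l 5 then x else 0

theorem single_apply (l : Fin 6 → Vtx) (x : CycInt) (m : Fin 6 → Vtx) :
    single l x m = if m = l then x else 0 := by
  refine if_congr ⟨fun h => ?_, ?_⟩ rfl rfl
  · funext i
    obtain ⟨h0, h1, h2, h3, h4, h5⟩ := h
    fin_cases i <;> assumption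
  · rintro rfl; simp

/-- The table of `ω • Y`. -/
def mulOm (Y : Table) : Table := fun m => (Y m).mulOm

/-- The table of `α Y`. -/
def alpha (Y : Table) : Table := fun m => Y fun i => shift (-1) (m i)

/-- The table of `(1 + α + α²) Y`. -/
def sumAlpha (Y : Table) : Table := Y + Y.alpha + Y.alpha.alpha

/-- The table of `ρ Y`; in the gauge `boxGauge` the rotation only permutes the loops. -/
def rho (Y : Table) : Table := fun m => Y ![m 2, m 3, m 4, m 5, m 0, m 1]

end Table

theorem gaugeBox_add (Y Z : Table) : gaugeBox (Y + Z) = gaugeBox Y + gaugeBox Z := by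
  funext m; simp only [gaugeBox, Pi.add_apply, eval_add]; ring

theorem gaugeBox_sub (Y Z : Table) : gaugeBox (Y - Z) = gaugeBox Y - gaugeBox Z := by
  funext m; simp only [gaugeBox, Pi.sub_apply, eval_sub]; ring

theorem gaugeBox_mulOm (Y : Table) : gaugeBox Y.mulOm = omega • gaugeBox Y := by
  funext m; simp only [gaugeBox, Pi.smul_apply, Table.mulOm, eval_mulOm, smul_eq_mul]; ring

theorem weight_shift (k : Fin 3) (x : Vtx) : weight (shift k x) = weight x := by
  cases x <;> rfl

theorem dFactor_shift (k : Fin 3) (x : Vtx) : dFactor (shift k x) = dFactor x := by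
  cases x <;> simp [dFactor, shift]

theorem alpha_gaugeBox (Y : Table) : alpha (gaugeBox Y) = gaugeBox Y.alpha := by
  funext m
  simp only [alpha, gaugeBox, boxGauge, weight_shift, dFactor_shift, Table.alpha]

theorem rho_gaugeBox (Y : Table) : rho (gaugeBox Y) = gaugeBox Y.rho := by
  funext m
  have hd : ∏ i, dFactor ((![m 2, m 3, m 4, m 5, m 0, m 1] : Fin 6 → Vtx) i) =
      ∏ i, dFactor (m i) := by
    simp [Fin.prod_univ_six]; ring
  simp only [rho, gaugeBox, boxGauge, hd, Table.rho, ← mul_assoc, ← Complex.ofReal_mul]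
  congr 3
  have h0 (i) := (weight_pos (m i)).le
  rw [Real.sqrt_div (mul_nonneg (h0 _) (h0 _))]
  have h1 : √(weight (m 2) * weight (m 5)) ≠ 0 :=
    (Real.sqrt_pos.mpr (mul_pos (weight_pos _) (weight_pos _))).ne'
  simp
  field_simp

theorem alpha_smul (c : ℂ) (X : ThreeBox) : alpha (c • X) = c • alpha X := rfl

theorem sumAlpha_smul (c : ℂ) (X : ThreeBox) : sumAlpha (c • X) = c • sumAlpha X := by
  simp only [sumAlpha, alpha_smul, smul_add]

theorem rho_smul (c : ℂ) (X : ThreeBox) : rho (c • X) = c • rho X := by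
  funext m; simp only [rho, Pi.smul_apply, smul_eq_mul]; ring

theorem sumAlpha_gaugeBox (Y : Table) : sumAlpha (gaugeBox Y) = gaugeBox Y.sumAlpha := by
  simp only [sumAlpha, Table.sumAlpha, gaugeBox_add, alpha_gaugeBox]

/-- `√(λ(c) λ(b))`. -/
noncomputable def kap : ℝ := √(weight .c * weight (.b 0))

theorem kap_pos : 0 < kap := Real.sqrt_pos.mpr (mul_pos (weight_pos _) (weight_pos _))

theorem gaugeBox_single (l : Fin 6 → Vtx) (x : CycInt) :
    gaugeBox (Table.single l x) = ((boxGauge l : ℂ) * x.eval) • basisLoop l := by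
  funext m
  simp only [gaugeBox, Table.single_apply, basisLoop, Pi.smul_apply, Pi.single_apply]
  by_cases h : m = l
  · subst h; simp
  · simp [h]

theorem basisLoop_eq {l : Fin 6 → Vtx} {i : Fin 3} (h0 : l 0 = .c) (h3 : l 3 = .b i)
    (hd : ∀ k, l k ≠ .d) (x : CycInt) :
    x.eval • basisLoop l = (kap : ℂ) • gaugeBox (Table.single l x) := by
  have hk : (kap : ℂ) ≠ 0 := by exact_mod_cast kap_pos.ne'
  have h : boxGauge l = kap⁻¹ := by
    simp [boxGauge, dFactor, hd, h0, h3, kap, weight]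
  rw [gaugeBox_single, smul_smul, h, Complex.ofReal_inv, ← mul_assoc, mul_inv_cancel₀ hk, one_mul]

theorem basisLoop_d_eq {l : Fin 6 → Vtx} {i : Fin 3} (h0 : l 0 = .c) (h1 : l 1 = .d)
    (h3 : l 3 = .b i) (hd : ∀ k, k ≠ 1 → l k ≠ .d) (x : CycInt) :
    (bigR * x.eval) • basisLoop l = (kap : ℂ) • gaugeBox (Table.single l x) := by
  have hk : (kap : ℂ) ≠ 0 := by exact_mod_cast kap_pos.ne'
  have hR : (bigR : ℂ) ≠ 0 := by exact_mod_cast bigR_pos.ne'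
  have h : boxGauge l = kap⁻¹ * bigR := by
    simp [boxGauge, Fin.prod_univ_six, dFactor, h0, h1, h3, hd, kap, weight]
  rw [gaugeBox_single, smul_smul, h, Complex.ofReal_mul, Complex.ofReal_inv]
  congr 1
  field_simp

theorem sqrt_weight_c_div_z (i : Fin 3) : √(weight .c / weight (.z i)) = theta := rfl

theorem kap_smul_sumAlpha {x : ℂ} {X : ThreeBox} {Y : Table}
    (h : x • X = (kap : ℂ) • gaugeBox Y) : (kap : ℂ) • gaugeBox Y.sumAlpha = x • sumAlpha X := by
  rw [← sumAlpha_smul, h, sumAlpha_smul, sumAlpha_gaugeBox]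

/-- The table of `x (1 + α + α²) (1 + f) (c bᵢ c bᵢ c bⱼ)`. -/
def flippedTable (i j : Fin 3) (x : CycInt) : Table :=
  Table.sumAlpha (Table.single ![.c, .b i, .c, .b i, .c, .b j] x -
    Table.single ![.c, .b i, .z i, .b i, .c, .b j] x.mulTh)

/-- The table of `x (1 + α + α²) (1 + f) (c d c bᵢ c bᵢ)`, up to a factor of `R`. -/
def flippedTableD (i : Fin 3) (x : CycInt) : Table :=
  Table.sumAlpha (Table.single ![.c, .d, .c, .b i, .c, .b i] x -
    Table.single ![.c, .d, .c, .b i, .z i, .b i] x.mulTh)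

/-- The table of `x (c bᵢ c bⱼ c bₖ)`. -/
def loopTable (i j k : Fin 3) (x : CycInt) : Table :=
  Table.single ![.c, .b i, .c, .b j, .c, .b k] x

/-- The table of `x (1 + α + α²) (c d c bᵢ c bⱼ)`, up to a factor of `R`. -/
def loopTableD (i j : Fin 3) (x : CycInt) : Table :=
  Table.sumAlpha (Table.single ![.c, .d, .c, .b i, .c, .b j] x)

theorem kap_smul_flippedTable (i j : Fin 3) (x : CycInt) :
    (kap : ℂ) • gaugeBox (flippedTable i j x) =
      x.eval • sumAlpha (withFlip 2 ![.c, .b i, .c, .b i, .c, .b j]) := by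
  have h (w) : Function.update (![.c, .b i, .c, .b i, .c, .b j] : Fin 6 → Vtx) 2 w =
      ![.c, .b i, w, .b i, .c, .b j] := by
    funext k; fin_cases k <;> rfl
  have hf : flip 2 ![.c, .b i, .c, .b i, .c, .b j] =
      -((theta : ℂ) • basisLoop ![.c, .b i, .z i, .b i, .c, .b j]) := by
    rw [flip, sum_vtx]
    simp only [h]
    simp [adj, sqrt_weight_c_div_z]
  have h1 := basisLoop_eq (l := ![.c, .b i, .c, .b i, .c, .b j]) (i := i) rfl rfl
    (by intro k; fin_cases k <;> simp) x
  have h2 := basisLoop_eq (l := ![.c, .b i, .z i, .b i, .c, .b j]) (i := i) rfl rfl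
    (by intro k; fin_cases k <;> simp) x.mulTh
  refine kap_smul_sumAlpha ?_
  rw [gaugeBox_sub, smul_sub, ← h1, ← h2, eval_mulTh, withFlip, hf]
  module

theorem kap_smul_flippedTableD (i : Fin 3) (x : CycInt) :
    (kap : ℂ) • gaugeBox (flippedTableD i x) =
      (bigR * x.eval) • sumAlpha (withFlip 4 ![.c, .d, .c, .b i, .c, .b i]) := by
  have h (w) : Function.update (![.c, .d, .c, .b i, .c, .b i] : Fin 6 → Vtx) 4 w =
      ![.c, .d, .c, .b i, w, .b i] := by
    funext k; fin_cases k <;> rfl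
  have hf : flip 4 ![.c, .d, .c, .b i, .c, .b i] =
      -((theta : ℂ) • basisLoop ![.c, .d, .c, .b i, .z i, .b i]) := by
    have e : (4 - 1 : Fin 6) = 3 := rfl
    rw [flip, sum_vtx, e]
    simp only [h]
    simp [adj, sqrt_weight_c_div_z]
  have h1 := basisLoop_d_eq (l := ![.c, .d, .c, .b i, .c, .b i]) (i := i) rfl rfl rfl
    (by intro k; fin_cases k <;> simp) x
  have h2 := basisLoop_d_eq (l := ![.c, .d, .c, .b i, .z i, .b i]) (i := i) rfl rfl rfl
    (by intro k; fin_cases k <;> simp) x.mulTh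
  refine kap_smul_sumAlpha ?_
  rw [gaugeBox_sub, smul_sub, ← h1, ← h2, eval_mulTh, withFlip, hf]
  module

theorem kap_smul_loopTable (i j k : Fin 3) (x : CycInt) :
    (kap : ℂ) • gaugeBox (loopTable i j k x) =
      x.eval • basisLoop ![.c, .b i, .c, .b j, .c, .b k] := by
  rw [loopTable, ← basisLoop_eq (i := j) rfl rfl (by intro k; fin_cases k <;> simp)]

theorem kap_smul_loopTableD (i j : Fin 3) (x : CycInt) :
    (kap : ℂ) • gaugeBox (loopTableD i j x) =
      (bigR * x.eval) • sumAlpha (basisLoop ![.c, .d, .c, .b i, .c, .b j]) :=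
  kap_smul_sumAlpha
    (basisLoop_d_eq (i := i) rfl rfl rfl (by intro k; fin_cases k <;> simp) x)

/-- The table of `18 seedT / √(λ(c) λ(b))`. -/
def seedTableT : Table :=
  flippedTable 0 1 (of (-9) (-21) 3 6 0 0 0 0)
  + flippedTable 0 2 (of (-9) 21 3 (-6) 0 0 0 0)
  + loopTable 0 1 2 (of 27 (-21) (-9) 6 0 (-42) 0 12)
  + loopTable 0 2 1 (of 27 21 (-9) (-6) 0 42 0 (-12))
  - flippedTableD 0 (of 6 0 0 0 0 0 0 0)
  - loopTableD 0 1 (of (-3) 6 0 (-1) 0 12 0 (-2))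
  + loopTableD 0 2 (of 3 6 0 (-1) 0 12 0 (-2))

/-- The table of `6 seedQ / (r √(λ(c) λ(b)))`. -/
def seedTableQ : Table :=
  flippedTable 0 1 (of 6 0 0 0 0 0 0 0)
  + flippedTable 0 2 (of 3 (-3) (-3) 0 0 0 0 0)
  - flippedTableD 0 (of 3 0 0 1 3 0 0 1)
  - loopTableD 0 1 (of 0 0 2 0 (-3) 0 (-2) (-1))
  - loopTableD 0 2 (of (-3) 0 (-2) (-1) 0 0 2 0)

theorem sqrt21_eq : √21 = 2 * theta ^ 2 - 3 := by linarith [theta_sq]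

theorem theta_sq_gt : (3.79 : ℝ) < theta ^ 2 := by linarith [theta_sq, sqrt21_gt]

theorem tT_eq : 18 * tT = -9 - 21 * theta + 3 * theta ^ 2 + 6 * theta ^ 3 := by
  have h : √(-114 + 26 * √21) = (4 * theta ^ 2 - 14) * theta := by
    rw [sqrt21_eq, Real.sqrt_eq_iff_eq_sq]
    · linear_combination (16 * theta ^ 2 - 64) * (-theta_pow_four)
    · nlinarith [theta_sq_gt]
    · exact mul_nonneg (by linarith [theta_sq_gt]) theta_pos.le
  rw [tT, h, sqrt21_eq]
  ring

theorem tT'_eq : 18 * tT' = -9 + 21 * theta + 3 * theta ^ 2 - 6 * theta ^ 3 := by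
  have h : √(54 + 14 * √21) = (2 * theta ^ 2 - 2) * theta := by
    rw [sqrt21_eq, Real.sqrt_eq_iff_eq_sq]
    · linear_combination (4 * theta ^ 2 + 4) * (-theta_pow_four)
    · nlinarith [theta_sq_gt]
    · exact mul_nonneg (by linarith [theta_sq_gt]) theta_pos.le
  have h1 : tT = (-9 - 21 * theta + 3 * theta ^ 2 + 6 * theta ^ 3) / 18 := by
    linarith [tT_eq]
  rw [tT', h, h1, sqrt21_eq]
  linear_combination (3 * theta ^ 2 - 3 / 2 * theta - 6) * theta_pow_four

theorem sT_aux : √((-57 + 13 * √21) / 6) = (2 * theta ^ 2 - 7) * theta / 3 * √3 := by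
  have h3 : √3 ^ 2 = (3 : ℝ) := Real.sq_sqrt (by norm_num)
  rw [sqrt21_eq, Real.sqrt_eq_iff_eq_sq]
  · rw [mul_pow, h3]
    linear_combination (4 / 3 * theta ^ 2 - 16 / 3) * (-theta_pow_four)
  · linarith [theta_sq_gt]
  · exact mul_nonneg (div_nonneg (mul_nonneg (by linarith [theta_sq_gt]) theta_pos.le)
      (by norm_num)) (Real.sqrt_nonneg 3)

theorem sqrt3_mul_I : ((√3 : ℝ) : ℂ) * Complex.I = 2 * omega + 1 := by
  rw [omega_eq]; ring

theorem sT_eq : 18 * sT = (of 27 (-21) (-9) 6 0 (-42) 0 12).eval := by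
  have h21 : ((√21 : ℝ) : ℂ) = 2 * (theta : ℂ) ^ 2 - 3 := by exact_mod_cast sqrt21_eq
  rw [sT, sT_aux, eval_of]
  push_cast
  rw [h21]
  linear_combination (3 * (2 * (theta : ℂ) ^ 2 - 7) * theta) * sqrt3_mul_I

theorem conj_sT_eq : 18 * (starRingEnd ℂ) sT = (of 27 21 (-9) (-6) 0 42 0 (-12)).eval := by
  have h21 : ((√21 : ℝ) : ℂ) = 2 * (theta : ℂ) ^ 2 - 3 := by exact_mod_cast sqrt21_eq
  rw [sT, sT_aux, eval_of]
  simp only [map_add, map_mul, Complex.conj_ofReal, Complex.conj_I]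
  push_cast
  rw [h21]
  linear_combination -(3 * (2 * (theta : ℂ) ^ 2 - 7) * theta) * sqrt3_mul_I

theorem bigR_inv_sq : (3 : ℂ) * ((bigR : ℂ)⁻¹ * (bigR : ℂ)⁻¹) = (theta : ℂ) ^ 2 := by
  have hR : (bigR : ℂ) ≠ 0 := by exact_mod_cast bigR_pos.ne'
  have h : (bigR : ℂ) ^ 2 = (theta : ℂ) ^ 2 - 3 := by exact_mod_cast bigR_sq
  field_simp
  rw [h]
  linear_combination -thetaC_pow_four

theorem seedT_eq : (18 : ℂ) • seedT = (kap : ℂ) • gaugeBox seedTableT := by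
  have h1 : 18 * (tT : ℂ) = (of (-9) (-21) 3 6 0 0 0 0).eval := by
    rw [eval_of]; push_cast; have := congrArg Complex.ofReal tT_eq; push_cast at this; rw [this]
    ring
  have h2 : 18 * (tT' : ℂ) = (of (-9) 21 3 (-6) 0 0 0 0).eval := by
    rw [eval_of]; push_cast; have := congrArg Complex.ofReal tT'_eq; push_cast at this; rw [this]
    ring
  have h3 := sT_eq
  have h4 := conj_sT_eq
  have hR := bigR_inv_sq
  have ht := thetaC_pow_four
  have h5 : 18 * (((tT : ℂ) + tT') * ((bigR : ℂ)⁻¹ * (bigR : ℂ)⁻¹)) =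
      (of 6 0 0 0 0 0 0 0).eval := by
    simp only [eval_of] at h1 h2 ⊢
    push_cast at h1 h2 ⊢
    linear_combination ((bigR : ℂ)⁻¹ * (bigR : ℂ)⁻¹) * (h1 + h2) +
      ((-18 + 6 * (theta : ℂ) ^ 2) / 3) * hR + 2 * ht
  have h6 : 18 * (((tT : ℂ) + tT' + sT) * ((bigR : ℂ)⁻¹ * (bigR : ℂ)⁻¹)) =
      (of (-3) 6 0 (-1) 0 12 0 (-2)).eval := by
    simp only [eval_of] at h1 h2 h3 ⊢
    push_cast at h1 h2 h3 ⊢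
    linear_combination ((bigR : ℂ)⁻¹ * (bigR : ℂ)⁻¹) * (h1 + h2 + h3) +
      ((9 - 21 * theta - 3 * (theta : ℂ) ^ 2 + 6 * (theta : ℂ) ^ 3 - 42 * theta * omega +
        12 * (theta : ℂ) ^ 3 * omega) / 3) * hR + (-1 + 2 * theta + 4 * theta * omega) * ht
  have h7 : 18 * ((2 * ((tT : ℂ) + tT') + sT) * ((bigR : ℂ)⁻¹ * (bigR : ℂ)⁻¹)) =
      (of 3 6 0 (-1) 0 12 0 (-2)).eval := by
    simp only [eval_of] at h1 h2 h3 ⊢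
    push_cast at h1 h2 h3 ⊢
    linear_combination ((bigR : ℂ)⁻¹ * (bigR : ℂ)⁻¹) * (2 * h1 + 2 * h2 + h3) +
      ((-9 - 21 * theta + 3 * (theta : ℂ) ^ 2 + 6 * (theta : ℂ) ^ 3 - 42 * theta * omega +
        12 * (theta : ℂ) ^ 3 * omega) / 3) * hR + (1 + 2 * theta + 4 * theta * omega) * ht
  have hi (x : ℂ) : (bigR : ℂ) * (18 * (x * ((bigR : ℂ)⁻¹ * (bigR : ℂ)⁻¹))) =
      18 * (x / bigR) := by
    have : (bigR : ℂ) ≠ 0 := by exact_mod_cast bigR_pos.ne'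
    field_simp
  simp only [seedT, seedTableT, gaugeBox_add, gaugeBox_sub, smul_add, smul_sub,
    kap_smul_flippedTable, kap_smul_flippedTableD, kap_smul_loopTable, kap_smul_loopTableD]
  rw [← h1, ← h2, ← h3, ← h4, ← h5, ← h6, ← h7, hi, hi, hi]
  module

theorem seedQ_eq : (6 : ℂ) • seedQ = ((tQ : ℂ) * kap) • gaugeBox seedTableQ := by
  have hR := bigR_inv_sq
  have ht := thetaC_pow_four
  have ho := omega_sq
  have hp : (tQ' : ℂ) = (1 - (theta : ℂ) ^ 2 - theta) / 2 * tQ := by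
    rw [tQ', psi]; push_cast; ring
  have h1 : (of 6 0 0 0 0 0 0 0).eval = 6 := by rw [eval_of]; simp
  have h2 : tQ * (of 3 (-3) (-3) 0 0 0 0 0).eval = 6 * (tQ' : ℂ) := by
    rw [eval_of, hp]; push_cast; ring
  have h5 : tQ * (of 3 0 0 1 3 0 0 1).eval =
      6 * (omega ^ 2 * (bigR : ℂ)⁻¹ * ((tQ : ℂ) + tQ') * (bigR : ℂ)⁻¹) := by
    rw [eval_of, hp]; push_cast
    linear_combination (-(omega ^ 2 * tQ * (3 - (theta : ℂ) ^ 2 - theta))) * hR -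
      (tQ * (theta : ℂ) ^ 2 * (3 - (theta : ℂ) ^ 2 - theta)) * ho - (tQ * (1 + omega)) * ht
  have h6 : tQ * (of 0 0 2 0 (-3) 0 (-2) (-1)).eval =
      6 * (1 * (bigR : ℂ)⁻¹ * ((tQ : ℂ) + omega * tQ') * (bigR : ℂ)⁻¹) := by
    rw [eval_of, hp]; push_cast
    linear_combination (-(tQ * (2 + omega * (1 - (theta : ℂ) ^ 2 - theta)))) * hR +
      (tQ * omega) * ht
  have h7 : tQ * (of (-3) 0 (-2) (-1) 0 0 2 0).eval =
      6 * (1 * (bigR : ℂ)⁻¹ * ((tQ' : ℂ) + omega * tQ) * (bigR : ℂ)⁻¹) := by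
    rw [eval_of, hp]; push_cast
    linear_combination (-(tQ * (1 - (theta : ℂ) ^ 2 - theta + 2 * omega))) * hR + tQ * ht
  have hi (x : ℂ) : (bigR : ℂ) * (6 * (x * (bigR : ℂ)⁻¹)) = 6 * x := by
    have : (bigR : ℂ) ≠ 0 := by exact_mod_cast bigR_pos.ne'
    field_simp
  rw [mul_smul (tQ : ℂ)]
  simp only [seedQ, seedTableQ, gaugeBox_add, gaugeBox_sub, smul_add, smul_sub,
    kap_smul_flippedTable, kap_smul_flippedTableD, kap_smul_loopTableD]
  simp only [smul_smul, mul_left_comm (tQ : ℂ) (bigR : ℂ)]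
  rw [h1, h2, h5, h6, h7, hi, hi, hi]
  simp only [div_eq_mul_inv]
  module

/-! ### The tables of the generators on all loops -/

/-- A closed walk of length six based at an even vertex. -/
def IsLoop6 (m : Fin 6 → Vtx) : Prop :=
  isEven (m 0) = true ∧ ∀ i, adj (m i) (m (i + 1)) = true

theorem isEven_of_adj {x y : Vtx} (h : adj x y = true) : isEven y = !isEven x := by
  cases x <;> cases y <;> simp_all [isEven, adj]

theorem IsLoop6.rotate {m : Fin 6 → Vtx}
    (h : IsLoop6 ![m 2, m 3, m 4, m 5, m 0, m 1]) : IsLoop6 m := by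
  obtain ⟨h0, h1⟩ := h
  have h2 := h1 0
  have h3 := h1 1
  have h4 := h1 2
  have h5 := h1 3
  have h6 := h1 4
  have h7 := h1 5
  simp at h0 h2 h3 h4 h5 h6 h7
  refine ⟨?_, fun i => ?_⟩
  · have e4 := isEven_of_adj h2
    have e5 := isEven_of_adj h3
    have e6 := isEven_of_adj h4
    have e7 := isEven_of_adj h5
    simp_all
  · fin_cases i <;> assumption

/-- Vanishing off the even-based closed walks. -/
def LoopTable (Y : Table) : Prop := ∀ m, ¬ IsLoop6 m → Y m = 0

theorem adj_shift (k : Fin 3) (x y : Vtx) : adj (shift k x) (shift k y) = adj x y := by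
  cases x <;> cases y <;> simp [adj, shift]

theorem isEven_shift (k : Fin 3) (x : Vtx) : isEven (shift k x) = isEven x := by
  cases x <;> rfl

namespace LoopTable

theorem add {Y Z : Table} (hY : LoopTable Y) (hZ : LoopTable Z) : LoopTable (Y + Z) :=
  fun m hm => by rw [Pi.add_apply, hY m hm, hZ m hm]; rfl

theorem sub {Y Z : Table} (hY : LoopTable Y) (hZ : LoopTable Z) : LoopTable (Y - Z) :=
  fun m hm => by rw [Pi.sub_apply, hY m hm, hZ m hm]; rfl

theorem mulOm {Y : Table} (hY : LoopTable Y) : LoopTable Y.mulOm :=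
  fun m hm => by rw [Table.mulOm, hY m hm]; rfl

theorem single {l : Fin 6 → Vtx} (hl : IsLoop6 l) (x : CycInt) : LoopTable (.single l x) :=
  fun m hm => by rw [Table.single_apply, if_neg (by rintro rfl; exact hm hl)]

theorem rho {Y : Table} (hY : LoopTable Y) : LoopTable Y.rho :=
  fun _ hm => hY _ fun h => hm h.rotate

theorem alpha {Y : Table} (hY : LoopTable Y) : LoopTable Y.alpha :=
  fun m hm => hY _ fun h => hm (by simpa [IsLoop6, adj_shift, isEven_shift] using h)

theorem sumAlpha {Y : Table} (hY : LoopTable Y) : LoopTable Y.sumAlpha :=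
  (hY.add hY.alpha).add hY.alpha.alpha

end LoopTable

theorem isLoop6_iff (x y z t u v : Vtx) : IsLoop6 ![x, y, z, t, u, v] ↔
    isEven x = true ∧ adj x y = true ∧ adj y z = true ∧ adj z t = true ∧ adj t u = true ∧
      adj u v = true ∧ adj v x = true := by
  simp [IsLoop6, Fin.forall_fin_succ]

theorem loopTable_flippedTable (i j : Fin 3) (x : CycInt) : LoopTable (flippedTable i j x) :=
  ((LoopTable.single (by simp [isLoop6_iff, adj, isEven]) _).sub
    (LoopTable.single (by simp [isLoop6_iff, adj, isEven]) _)).sumAlpha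

theorem loopTable_flippedTableD (i : Fin 3) (x : CycInt) : LoopTable (flippedTableD i x) :=
  ((LoopTable.single (by simp [isLoop6_iff, adj, isEven]) _).sub
    (LoopTable.single (by simp [isLoop6_iff, adj, isEven]) _)).sumAlpha

theorem loopTable_loopTable (i j k : Fin 3) (x : CycInt) : LoopTable (loopTable i j k x) :=
  LoopTable.single (by simp [isLoop6_iff, adj, isEven]) _

theorem loopTable_loopTableD (i j : Fin 3) (x : CycInt) : LoopTable (loopTableD i j x) :=
  (LoopTable.single (by simp [isLoop6_iff, adj, isEven]) _).sumAlpha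

/-- The sum over the rotations of `T` up to a scalar. -/
def rotatedTableT : Table := seedTableT + seedTableT.rho + seedTableT.rho.rho

/-- The weighted sum over the rotations of `Q` up to a scalar. -/
def rotatedTableQ : Table :=
  seedTableQ + seedTableQ.rho.mulOm.mulOm + seedTableQ.rho.rho.mulOm

theorem loopTable_T : LoopTable rotatedTableT := by
  have h : LoopTable seedTableT :=
    ((((((loopTable_flippedTable 0 1 _).add (loopTable_flippedTable 0 2 _)).add
      (loopTable_loopTable 0 1 2 _)).add (loopTable_loopTable 0 2 1 _)).sub
      (loopTable_flippedTableD 0 _)).sub (loopTable_loopTableD 0 1 _)).add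
      (loopTable_loopTableD 0 2 _)
  exact (h.add h.rho).add h.rho.rho

theorem loopTable_Q : LoopTable rotatedTableQ := by
  have h : LoopTable seedTableQ :=
    ((((loopTable_flippedTable 0 1 _).add (loopTable_flippedTable 0 2 _)).sub
      (loopTable_flippedTableD 0 _)).sub (loopTable_loopTableD 0 1 _)).sub
      (loopTable_loopTableD 0 2 _)
  exact (h.add h.rho.mulOm.mulOm).add h.rho.rho.mulOm

/-- Coefficients of a three-box on the loops, as a function of the six vertices. -/
abbrev BoxTable : Type := Vtx → Vtx → Vtx → Vtx → Vtx → Vtx → CycInt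

/-- The table, as a function of six vertices, with entries `y x₁ x₃ x₅` on the loops whose even
vertices are all `c`, and with a factor `-θ` for a `z`. -/
def letterTable (y : Vtx → Vtx → Vtx → CycInt) (x0 x1 x2 x3 x4 x5 : Vtx) : CycInt :=
  match x0, x2, x4 with
  | .c, .c, .c => y x1 x3 x5
  | .z _, .c, .c | .c, .z _, .c | .c, .c, .z _ => 0 - (y x1 x3 x5).mulTh
  | _, _, _ => 0

/-- The entry of the table of `T` at `c (b 0) c (b i) c (b j)`, as a function of `i` and `j`. -/
def bbbT : Fin 3 → Fin 3 → CycInt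
  | 0, 1 | 1, 0 | 2, 2 => of (-9) (-21) 3 6 0 0 0 0
  | 0, 2 | 1, 1 | 2, 0 => of (-9) 21 3 (-6) 0 0 0 0
  | 1, 2 => of 27 (-21) (-9) 6 0 (-42) 0 12
  | 2, 1 => of 27 21 (-9) (-6) 0 42 0 (-12)
  | 0, 0 => 0

/-- The entry of the table of `T` at `c d c (b 0) c (b i)`, as a function of `i`. -/
def dbbT : Fin 3 → CycInt
  | 0 => of (-6) 0 0 0 0 0 0 0
  | 1 => of 3 (-6) 0 1 0 (-12) 0 2
  | 2 => of 3 6 0 (-1) 0 12 0 (-2)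

/-- The table of `T` on the loops `c x c y c z`, which is invariant under the rotation. -/
def lettersT : Vtx → Vtx → Vtx → CycInt
  | .b i, .b j, .b k => bbbT (j - i) (k - i)
  | .d, .b i, .b j | .b i, .b j, .d | .b j, .d, .b i => dbbT (j - i)
  | _, _, _ => 0

/-- The entry of the table of `Q` at `c (b 0) c (b i) c (b j)`, as a function of `i` and `j`. -/
def bbbQ : Fin 3 → Fin 3 → CycInt
  | 0, 1 => of 6 0 0 0 0 0 0 0
  | 0, 2 => of 3 (-3) (-3) 0 0 0 0 0
  | 1, 0 => of 0 0 0 0 6 0 0 0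
  | 1, 1 => of (-3) 3 3 0 (-3) 3 3 0
  | 2, 0 => of 0 0 0 0 3 (-3) (-3) 0
  | 2, 2 => of (-6) 0 0 0 (-6) 0 0 0
  | _, _ => 0

/-- The entry of the table of `Q` at `c d c (b 0) c (b i)`, as a function of `i`. -/
def dbbQ : Fin 3 → CycInt
  | 0 => of (-3) 0 0 (-1) (-3) 0 0 (-1)
  | 1 => of 0 0 (-2) 0 3 0 2 1
  | 2 => of 3 0 2 1 0 0 (-2) 0

/-- The table of `Q` on the loops `c x c y c z`; the rotation multiplies it by `ω`. -/
def lettersQ : Vtx → Vtx → Vtx → CycInt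
  | .b i, .b j, .b k => bbbQ (j - i) (k - i)
  | .d, .b i, .b j => dbbQ (j - i)
  | .b i, .b j, .d => (dbbQ (j - i)).mulOm
  | .b j, .d, .b i => (dbbQ (j - i)).mulOm.mulOm
  | _, _, _ => 0

/-- The vertices of `H`. -/
def vertices : List Vtx := [.z 0, .z 1, .z 2, .b 0, .b 1, .b 2, .c, .d]

theorem mem_vertices (x : Vtx) : x ∈ vertices := by
  cases x with
  | z i => fin_cases i <;> simp [vertices]
  | b i => fin_cases i <;> simp [vertices]
  | c => simp [vertices]
  | d => simp [vertices]

/-- Whether `p` holds on all even-based closed walks of length six. -/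
def allLoops6 (p : (Fin 6 → Vtx) → Bool) : Bool :=
  vertices.all fun x => !isEven x || vertices.all fun y => !adj x y ||
    vertices.all fun z => !adj y z || vertices.all fun t => !adj z t ||
      vertices.all fun u => !adj t u || vertices.all fun v => !adj u v || !adj v x ||
        p ![x, y, z, t, u, v]

theorem vec6_eta (m : Fin 6 → Vtx) : m = ![m 0, m 1, m 2, m 3, m 4, m 5] := by
  funext i; fin_cases i <;> rfl

theorem of_allLoops6 {p : (Fin 6 → Vtx) → Bool} (h : allLoops6 p = true) {m : Fin 6 → Vtx}
    (hm : IsLoop6 m) : p m = true := by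
  rw [vec6_eta m, isLoop6_iff] at hm
  rw [vec6_eta m]
  obtain ⟨h0, h1, h2, h3, h4, h5, h6⟩ := hm
  simp only [allLoops6, List.all_eq_true, Bool.or_eq_true, Bool.not_eq_true'] at h
  have k0 := (h (m 0) (mem_vertices _)).resolve_left (by simp [h0]) (m 1) (mem_vertices _)
  have k1 := k0.resolve_left (by simp [h1]) (m 2) (mem_vertices _)
  have k2 := k1.resolve_left (by simp [h2]) (m 3) (mem_vertices _)
  have k3 := k2.resolve_left (by simp [h3]) (m 4) (mem_vertices _)
  have k4 := k3.resolve_left (by simp [h4]) (m 5) (mem_vertices _)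
  exact k4.resolve_left (by simp [h5, h6])

/-- The rotated seeds, tabulated.  A `z` in a loop only arises from flipping a `c`, which multiplies
the coefficient by `-θ`, and no two even vertices are flipped at once; so the loops with all even
vertices equal to `c` determine the others. -/
theorem rotatedTables_eq : allLoops6 (fun m =>
    decide (rotatedTableT m = letterTable lettersT (m 0) (m 1) (m 2) (m 3) (m 4) (m 5)) &&
      decide (rotatedTableQ m = letterTable lettersQ (m 0) (m 1) (m 2) (m 3) (m 4) (m 5))) =
        true := by
  decide +kernel

/-- The coefficients of `X` on even-based loops are `κ` times those of the table `Y`, up to the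
gauge, and the others are zero. -/
structure HasTable (X : ThreeBox) (κ : ℂ) (Y : BoxTable) : Prop where
  of_loop : ∀ x y z t u v, IsLoop6 ![x, y, z, t, u, v] →
    X ![x, y, z, t, u, v] = κ * (boxGauge ![x, y, z, t, u, v] * (Y x y z t u v).eval)
  of_not : ∀ m, ¬ IsLoop6 m → X m = 0

theorem hasTable_gaugeBox {X : ThreeBox} {κ : ℂ} {Y : Table}
    {Y' : BoxTable} (hX : X = κ • gaugeBox Y) (hY : LoopTable Y)
    (h : ∀ m, IsLoop6 m → Y m = Y' (m 0) (m 1) (m 2) (m 3) (m 4) (m 5)) : HasTable X κ Y' where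
  of_loop x y z t u v hm := by
    have h' := h _ hm
    simp only [Matrix.cons_val] at h'
    rw [hX, ← h']; rfl
  of_not m hm := by rw [hX, Pi.smul_apply, gaugeBox, hY m hm]; simp

/-- The scalar is `√(λ(c) λ(b)) / 18`. -/
theorem hasTable_T : HasTable genT (kap / 18) (letterTable lettersT) := by
  refine hasTable_gaugeBox (Y := rotatedTableT) ?_ loopTable_T fun m hm => ?_
  · have h : seedT = ((kap : ℂ) / 18) • gaugeBox seedTableT := by
      rw [div_eq_inv_mul, mul_smul, ← seedT_eq, smul_smul]; norm_num
    rw [genT, rotatedTableT, gaugeBox_add, gaugeBox_add, ← rho_gaugeBox, ← rho_gaugeBox, h]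
    simp only [rho_smul, smul_add, rho_gaugeBox]
  · have := of_allLoops6 rotatedTables_eq hm
    simp only [Bool.and_eq_true, decide_eq_true_eq] at this
    exact this.1

/-- The scalar is `η r √(λ(c) λ(b)) / 6`. -/
theorem hasTable_Q : HasTable genQ (eta * (tQ * kap / 6)) (letterTable lettersQ) := by
  refine hasTable_gaugeBox (Y := rotatedTableQ) ?_ loopTable_Q fun m hm => ?_
  · have h : seedQ = ((tQ : ℂ) * kap / 6) • gaugeBox seedTableQ := by
      rw [div_eq_inv_mul, mul_smul, ← seedQ_eq, smul_smul]; norm_num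
    rw [genQ, rotatedTableQ, gaugeBox_add, gaugeBox_add, gaugeBox_mulOm, gaugeBox_mulOm,
      gaugeBox_mulOm, ← rho_gaugeBox, ← rho_gaugeBox, h, mul_smul]
    simp only [rho_smul, smul_add, rho_gaugeBox, smul_smul, sq, mul_comm ((tQ : ℂ) * kap / 6)]
  · have := of_allLoops6 rotatedTables_eq hm
    simp only [Bool.and_eq_true, decide_eq_true_eq] at this
    exact this.2

/-! ### The diagrams before the idempotent is attached -/

/-- Vanishing off the lists of `n` vertices. -/
def SupportedOnLength (n : ℤ) (ψ : WalkVec) : Prop := ∀ l : List Vtx, (l.length : ℤ) ≠ n → ψ l = 0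

theorem SupportedOnLength.whisker {k : ℤ} {f : WalkVec → WalkVec}
    (hf : ∀ n ψ, SupportedOnLength n ψ → SupportedOnLength (n + k) (f ψ)) (i : ℕ) {n : ℤ}
    {ψ : WalkVec} (hψ : SupportedOnLength n ψ) :
    SupportedOnLength (n + k) (whisker i f ψ) := by
  induction i generalizing n ψ with
  | zero => exact hf n ψ hψ
  | succ i ih =>
    intro l hl
    match l with
    | [] => rfl
    | x :: l =>
      refine ih (n := n - 1) (ψ := fun m => ψ (x :: m)) (fun m hm => hψ _ ?_) l ?_
      · simp only [List.length_cons, Nat.cast_add, Nat.cast_one]; omega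
      · simp only [List.length_cons, Nat.cast_add, Nat.cast_one] at hl; omega

theorem SupportedOnLength.capLeft (n : ℤ) (ψ : WalkVec) (hψ : SupportedOnLength n ψ) :
    SupportedOnLength (n + 2) (capLeft ψ) := by
  intro l hl
  match l with
  | [] | [_] | [_, _] => rfl
  | x :: y :: x' :: l =>
    rw [Haagerup2221.capLeft, hψ, mul_zero, ite_self]
    simp only [List.length_cons, Nat.cast_add, Nat.cast_one] at hl ⊢; omega

theorem SupportedOnLength.cupLeft (n : ℤ) (ψ : WalkVec) (hψ : SupportedOnLength n ψ) :
    SupportedOnLength (n + -2) (cupLeft ψ) := by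
  intro l hl
  match l with
  | [] => rfl
  | x :: l =>
    refine Finset.sum_eq_zero fun y _ => ?_
    rw [hψ, mul_zero, ite_self]
    simp only [List.length_cons, Nat.cast_add, Nat.cast_one] at hl ⊢; omega

theorem SupportedOnLength.boxLeft (X : ThreeBox) (n : ℤ) (ψ : WalkVec)
    (hψ : SupportedOnLength n ψ) : SupportedOnLength (n + 0) (boxLeft X ψ) := by
  intro l hl
  match l with
  | [] | [_] | [_, _] | [_, _, _] => rfl
  | w :: x :: y :: v :: l =>
    refine Finset.sum_eq_zero fun a _ => Finset.sum_eq_zero fun e _ => ?_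
    rw [hψ, mul_zero]
    simpa using hl

/-- The number of regions at the bottom added by a layer. -/
def Layer.degree : Layer → ℤ
  | .cap _ => 2
  | .cup _ => -2
  | .box _ _ => 0

theorem SupportedOnLength.evalDiagram {n : ℤ} {ψ : WalkVec} (hψ : SupportedOnLength n ψ)
    (L : List Layer) :
    SupportedOnLength (n + (L.map Layer.degree).sum) (evalDiagram ψ L) := by
  induction L generalizing n ψ with
  | nil => simpa [Haagerup2221.evalDiagram] using hψ
  | cons a L ih =>
    rw [List.map_cons, List.sum_cons, ← add_assoc]
    refine ih (n := n + a.degree) ?_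
    cases a with
    | cap i => exact hψ.whisker SupportedOnLength.capLeft i
    | cup i => exact hψ.whisker SupportedOnLength.cupLeft i
    | box i X => exact hψ.whisker (SupportedOnLength.boxLeft X) i

theorem SupportedOnLength.evalDiagram_of_eq {n m : ℤ} {ψ : WalkVec} (hψ : SupportedOnLength n ψ)
    {L : List Layer} (h : n + (L.map Layer.degree).sum = m) :
    SupportedOnLength m (Haagerup2221.evalDiagram ψ L) :=
  h ▸ hψ.evalDiagram L

theorem supportedOnLength_emptyUnshaded : SupportedOnLength 1 emptyUnshaded := by
  intro l hl
  match l with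
  | [] | _ :: _ :: _ => rfl
  | [_] => simp at hl

theorem supportedOnLength_emptyShaded : SupportedOnLength 1 emptyShaded := by
  intro l hl
  match l with
  | [] | _ :: _ :: _ => rfl
  | [_] => simp at hl

open Layer

/-- The diagram of `underStrand`. -/
noncomputable def underVec (X : ThreeBox) : WalkVec :=
  evalDiagram emptyUnshaded [cap 0, cap 1, cap 3, cap 4, box 2 X]

/-- The diagram of `pair`. -/
noncomputable def pairVec (F G : ThreeBox) : WalkVec :=
  evalDiagram emptyUnshaded
    [cap 0, cap 1, cap 2, box 0 F, cap 6, cap 7, cap 8, box 6 G, cup 5, cup 4]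

/-- The diagram of `underStrandShaded`. -/
noncomputable def underVecShaded (X : ThreeBox) : WalkVec :=
  evalDiagram emptyShaded [cap 0, cap 1, cap 2, cap 3, box 1 X]

/-- The diagram of `pairShaded`. -/
noncomputable def pairVecShaded (F G : ThreeBox) : WalkVec :=
  evalDiagram emptyShaded
    [cap 0, cap 2, cap 3, box 1 F, cap 6, cap 7, cap 8, cap 9, box 7 G, cup 6, cup 5, cup 4]

theorem ite_mul_eq_zero {p : Prop} [Decidable p] {x y : ℂ} (h : y = 0) :
    (if p then x * y else 0) = 0 := by
  rw [h, mul_zero, ite_self]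

theorem ite_false_zero' (p : Prop) [Decidable p] (x : ℂ) :
    (if p then 0 else x) = if ¬ p then x else 0 := by
  rw [ite_not]

/-- The square root of the weight. -/
noncomputable def sw (x : Vtx) : ℂ := ((√(weight x) : ℝ) : ℂ)

theorem sw_ne (x : Vtx) : sw x ≠ 0 := sqrt_weight_ne x

theorem ofReal_sqrt_weight_div (x y : Vtx) :
    ((√(weight x / weight y) : ℝ) : ℂ) = sw x / sw y := by
  rw [Real.sqrt_div (weight_pos x).le, Complex.ofReal_div, sw, sw]

theorem ite_congr_of_imp {p q : Prop} [Decidable p] [Decidable q] {x y : ℂ} (hpq : p ↔ q)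
    (h : q → x = y) : (if p then x else 0) = if q then y else 0 := by
  by_cases hq : q
  · rw [if_pos hq, if_pos (hpq.mpr hq), h hq]
  · rw [if_neg hq, if_neg (mt hpq.mp hq)]

/-- The closed form: the box is read clockwise from the region between the first and the second of
its strings, and the strand over it forces `x1 = x7`. -/
theorem underVec_apply (X : ThreeBox) (x0 x1 x2 x3 x4 x5 x6 x7 x8 : Vtx) :
    underVec X [x0, x1, x2, x3, x4, x5, x6, x7, x8] =
      if x0 = x8 ∧ x1 = x7 ∧ isEven x0 = true ∧ adj x0 x1 = true ∧ adj x1 x2 = true ∧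
          adj x1 x6 = true ∧ adj x6 x5 = true then
        sw x2 * sw x5 / (sw x0 * sw x1) * X ![x2, x1, x6, x5, x4, x3] else 0 := by
  have h0 := sw_ne
  simp only [underVec, evalDiagram, List.foldl, Layer.act, whisker, boxLeft, capLeft,
    emptyUnshaded, ofReal_sqrt_weight_div]
  -- the local maxima above the box determine the labels of the regions above it
  rw [Finset.sum_eq_single x1 ?_ (by simp), Finset.sum_eq_single x6 ?_ (by simp)]
  · simp only [mul_ite, mul_zero, mul_one, ← ite_and]
    refine ite_congr_of_imp ?_ ?_
    · grind
    · rintro ⟨rfl, rfl, -⟩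
      field_simp [h0]
  · intro e _ he; simp [he]
  · intro a _ ha
    refine Finset.sum_eq_zero fun e _ => ?_
    simp [Ne.symm ha]

theorem underVecShaded_apply (X : ThreeBox) (x0 x1 x2 x3 x4 x5 x6 x7 x8 : Vtx) :
    underVecShaded X [x0, x1, x2, x3, x4, x5, x6, x7, x8] =
      if x0 = x8 ∧ x1 = x7 ∧ isEven x0 = false ∧ adj x0 x1 = true ∧ adj x1 x6 = true ∧
          adj x6 x5 = true ∧ adj x5 x4 = true then
        sw x4 / sw x0 * X ![x1, x6, x5, x4, x3, x2] else 0 := by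
  have h0 := sw_ne
  simp only [underVecShaded, evalDiagram, List.foldl, Layer.act, whisker, boxLeft, capLeft,
    emptyShaded, ofReal_sqrt_weight_div]
  rw [Finset.sum_eq_single x6 ?_ (by simp), Finset.sum_eq_single x5 ?_ (by simp)]
  · simp only [mul_ite, mul_zero, mul_one, ← ite_and, ite_false_zero']
    refine ite_congr_of_imp ?_ ?_
    · grind
    · rintro ⟨rfl, rfl, -⟩
      field_simp [h0]
  · intro e _ he; simp [he]
  · intro a _ ha
    refine Finset.sum_eq_zero fun e _ => ?_
    simp [ha]

/-- The closed form: `a` is the label of the region enclosed by the two joining strings. -/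
theorem pairVec_apply (F G : ThreeBox) (x0 x1 x2 x3 x4 x5 x6 x7 x8 : Vtx) :
    pairVec F G [x0, x1, x2, x3, x4, x5, x6, x7, x8] =
      ∑ a, if x0 = x8 ∧ isEven x0 = true ∧ adj x0 a = true ∧ adj a x4 = true ∧ adj x4 x3 = true ∧
          adj x0 x7 = true ∧ adj x7 x6 = true ∧ adj x6 x5 = true then
        sw x3 * sw x5 / (sw x0 * sw x4) *
          (F ![x0, a, x4, x3, x2, x1] * G ![x0, x7, x6, x5, x4, a]) else 0 := by
  have h0 := sw_ne
  simp only [pairVec, evalDiagram, List.foldl, Layer.act, whisker, boxLeft, capLeft, cupLeft,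
    emptyUnshaded, ofReal_sqrt_weight_div]
  refine Finset.sum_congr rfl fun a _ => ?_
  rw [Finset.sum_eq_single x0 ?_ (by simp), Finset.sum_eq_single x7 ?_ (by simp),
    Finset.sum_eq_single x6 ?_ (by simp), Finset.sum_eq_single a ?_ (by simp),
    Finset.sum_eq_single x4 ?_ (by simp)]
  · have := adj_comm x4 a
    have := adj_comm x0 a
    simp only [mul_ite, mul_zero, mul_one, ← ite_and]
    refine ite_congr_of_imp ?_ ?_
    · grind
    · rintro ⟨rfl, -⟩
      field_simp [h0]
  · intro e _ he; simp [he]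
  · intro e _ he
    refine Finset.sum_eq_zero fun e _ => ?_
    simp [he]
  · intro e _ he; simp [he]
  · intro e _ he
    refine Finset.sum_eq_zero fun e _ => ?_
    simp [he]
  · intro e _ he
    refine ite_mul_eq_zero (Finset.sum_eq_zero fun x _ => Finset.sum_eq_zero fun y _ => ?_)
    simp only [Ne.symm he, false_and, if_false, mul_zero, ite_self, Finset.sum_const_zero]

/-- The closed form: `p` is the label of the region enclosed by the two joining strings. -/
theorem pairVecShaded_apply (F G : ThreeBox) (x0 x1 x2 x3 x4 x5 x6 x7 x8 : Vtx) :
    pairVecShaded F G [x0, x1, x2, x3, x4, x5, x6, x7, x8] =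
      ∑ p, if x0 = x8 ∧ isEven x0 = false ∧ adj x0 x1 = true ∧ adj x0 p = true ∧ adj p x4 = true ∧
          adj x0 x7 = true ∧ adj x7 x6 = true ∧ adj x6 x5 = true ∧ adj x5 x4 = true then
        sw x1 * sw x4 * sw x7 / sw x0 ^ 3 *
          (F ![x1, x0, p, x4, x3, x2] * G ![x7, x6, x5, x4, p, x0]) else 0 := by
  have h0 := sw_ne
  simp only [pairVecShaded, evalDiagram, List.foldl, Layer.act, whisker, boxLeft, capLeft, cupLeft,
    emptyShaded, ofReal_sqrt_weight_div]
  refine Finset.sum_congr rfl fun p _ => ?_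
  rw [Finset.sum_eq_single x0 ?_ (by simp), Finset.sum_eq_single x7 ?_ (by simp),
    Finset.sum_eq_single x6 ?_ (by simp), Finset.sum_eq_single x5 ?_ (by simp),
    Finset.sum_eq_single x0 ?_ (by simp), Finset.sum_eq_single p ?_ (by simp)]
  · have := adj_comm x4 p
    have := adj_comm x0 p
    simp only [mul_ite, mul_zero, mul_one, ← ite_and, ite_false_zero']
    refine ite_congr_of_imp ?_ ?_
    · grind
    · rintro ⟨rfl, -⟩
      field_simp [h0]
  · intro e _ he; simp [he]
  · intro e _ he
    refine Finset.sum_eq_zero fun e _ => ?_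
    simp [he]
  · intro e _ he; simp [he]
  · intro e _ he
    refine Finset.sum_eq_zero fun e _ => ?_
    simp [he]
  · intro e _ he
    refine ite_mul_eq_zero (Finset.sum_eq_zero fun x _ => Finset.sum_eq_zero fun y _ => ?_)
    simp only [he, false_and, if_false, mul_zero, ite_self]
  · intro e _ he
    refine ite_mul_eq_zero (Finset.sum_eq_zero fun y _ => ite_mul_eq_zero ?_)
    refine Finset.sum_eq_zero fun z _ => Finset.sum_eq_zero fun t _ => ?_
    rw [Finset.sum_eq_zero (s := Finset.univ) (f := fun u => ∑ v, _)]
    · simp only [mul_zero, ite_self]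
    intro u _
    refine Finset.sum_eq_zero fun v _ => ?_
    by_cases hu : u = e
    · simp only [hu, Ne.symm he, false_and, if_false, mul_zero, ite_self]
    · simp only [hu, false_and, if_false, mul_zero, ite_self]

/-! ### The diagrams as combinations of classes of walks -/

/-- Vanishing off the closed walks of length eight. -/
def SupportedOnClosedWalks (ψ : WalkVec) : Prop := ∀ l, ψ l ≠ 0 → IsWalk8 l ∧
  ∃ x0 x1 x2 x3 x4 x5 x6 x7, l = [x0, x1, x2, x3, x4, x5, x6, x7, x0]

theorem map_eq_sum_single {ι M : Type*} [Fintype ι] [AddCommGroup M] [Module ℂ M]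
    {g : ι → List Vtx} (hg : g.Injective) (L : WalkVec →ₗ[ℂ] M) {ψ : WalkVec}
    (hψ : ∀ l, ψ l ≠ 0 → ∃ i, g i = l) :
    L ψ = ∑ i, ψ (g i) • L (Pi.single (g i) 1) := by
  have h : ψ = ∑ i, ψ (g i) • (Pi.single (g i) 1 : WalkVec) := by
    funext l
    simp only [Finset.sum_apply, Pi.smul_apply, Pi.single_apply, smul_eq_mul, mul_ite, mul_one,
      mul_zero]
    by_cases hl : ψ l = 0
    · rw [hl, Finset.sum_eq_zero]
      intro i _
      split_ifs with h
      · rw [← h, hl]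
      · rfl
    · obtain ⟨i, rfl⟩ := hψ l hl
      rw [Finset.sum_eq_single i]
      · simp
      · intro j _ hj
        rw [if_neg fun h => hj (hg h).symm]
      · simp
  conv_lhs => rw [h]
  simp only [map_sum, map_smul]

theorem SupportedOnClosedWalks.jonesWenzl_eq {ψ : WalkVec} (hψ : SupportedOnClosedWalks ψ)
    {ι : Type*} [Fintype ι] {g : ι → List Vtx} (hg : g.Injective)
    (h : ∀ x0 x1 x2 x3 x4 x5 x6 x7, ∃ i, g i = [x0, x1, x2, x3, x4, x5, x6, x7, x0]) :
    jonesWenzl 8 ψ = ∑ i, ψ (g i) • jwWalk (g i) := by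
  have h0 : walkProj ψ = ψ := walkProj_eq_self fun l hl => by
    by_contra h0
    exact hl (hψ l h0).1
  have h1 := map_eq_sum_single hg ((jw 8).comp walkProj) fun l hl => by
    obtain ⟨-, x0, x1, x2, x3, x4, x5, x6, x7, rfl⟩ := hψ l hl
    exact h ..
  rw [LinearMap.comp_apply, h0] at h1
  rw [jonesWenzl_eq_jw 8 h0, h1]
  rfl

/-- The sum over the walks, in an order fit for `sum_collapseEvenArc`. -/
theorem SupportedOnClosedWalks.jonesWenzl_eq_even {ψ : WalkVec} (hψ : SupportedOnClosedWalks ψ) :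
    jonesWenzl 8 ψ = ∑ x0, ∑ x4, ∑ x1, ∑ x3, ∑ x2, ∑ x5, ∑ x7, ∑ x6,
      ψ [x0, x1, x2, x3, x4, x5, x6, x7, x0] • jwWalk [x0, x1, x2, x3, x4, x5, x6, x7, x0] := by
  have := hψ.jonesWenzl_eq (ι := Vtx × Vtx × Vtx × Vtx × Vtx × Vtx × Vtx × Vtx)
    (g := fun x => [x.1, x.2.2.1, x.2.2.2.2.1, x.2.2.2.1, x.2.1, x.2.2.2.2.2.1,
      x.2.2.2.2.2.2.2, x.2.2.2.2.2.2.1, x.1])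
    (by rintro ⟨_, _, _, _, _, _, _, _⟩ ⟨_, _, _, _, _, _, _, _⟩ h; simp at h ⊢; tauto)
    (fun x0 x1 x2 x3 x4 x5 x6 x7 => ⟨(x0, x4, x1, x3, x2, x5, x7, x6), rfl⟩)
  simpa only [Fintype.sum_prod_type] using this

/-- The sum over the walks, in an order fit for `sum_collapseOddArc`. -/
theorem SupportedOnClosedWalks.jonesWenzl_eq_odd {ψ : WalkVec} (hψ : SupportedOnClosedWalks ψ) :
    jonesWenzl 8 ψ = ∑ x0, ∑ x4, ∑ x2, ∑ x1, ∑ x3, ∑ x6, ∑ x5, ∑ x7,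
      ψ [x0, x1, x2, x3, x4, x5, x6, x7, x0] • jwWalk [x0, x1, x2, x3, x4, x5, x6, x7, x0] := by
  have := hψ.jonesWenzl_eq (ι := Vtx × Vtx × Vtx × Vtx × Vtx × Vtx × Vtx × Vtx)
    (g := fun x => [x.1, x.2.2.2.1, x.2.2.1, x.2.2.2.2.1, x.2.1, x.2.2.2.2.2.2.1,
      x.2.2.2.2.2.1, x.2.2.2.2.2.2.2, x.1])
    (by rintro ⟨_, _, _, _, _, _, _, _⟩ ⟨_, _, _, _, _, _, _, _⟩ h; simp at h ⊢; tauto)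
    (fun x0 x1 x2 x3 x4 x5 x6 x7 => ⟨(x0, x4, x2, x1, x3, x6, x5, x7), rfl⟩)
  simpa only [Fintype.sum_prod_type] using this

theorem isWalk8_iff {x0 x1 x2 x3 x4 x5 x6 x7 x8 : Vtx} :
    IsWalk8 [x0, x1, x2, x3, x4, x5, x6, x7, x8] ↔ adj x0 x1 = true ∧ adj x1 x2 = true ∧
      adj x2 x3 = true ∧ adj x3 x4 = true ∧ adj x4 x5 = true ∧ adj x5 x6 = true ∧
      adj x6 x7 = true ∧ adj x7 x8 = true := by
  simp [IsWalk8]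

theorem supportedOnClosedWalks_of_length {ψ : WalkVec} (hψ : SupportedOnLength 9 ψ)
    (h : ∀ x0 x1 x2 x3 x4 x5 x6 x7 x8, ψ [x0, x1, x2, x3, x4, x5, x6, x7, x8] ≠ 0 →
      x0 = x8 ∧ IsWalk8 [x0, x1, x2, x3, x4, x5, x6, x7, x8]) : SupportedOnClosedWalks ψ := by
  intro l hl
  have h9 : l.length = 9 := by
    by_contra h9
    exact hl (hψ l (by exact_mod_cast h9))
  match l, h9 with
  | [x0, x1, x2, x3, x4, x5, x6, x7, x8], _ =>
    obtain ⟨rfl, h'⟩ := h _ _ _ _ _ _ _ _ _ hl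
    exact ⟨h', x0, x1, x2, x3, x4, x5, x6, x7, rfl⟩

theorem HasTable.of_ne_zero {X : ThreeBox} {κ : ℂ} {Y : BoxTable} (h : HasTable X κ Y)
    {x y z t u v : Vtx} (hx : X ![x, y, z, t, u, v] ≠ 0) :
    isEven x = true ∧ adj x y = true ∧ adj y z = true ∧ adj z t = true ∧ adj t u = true ∧
      adj u v = true ∧ adj v x = true := by
  rw [← isLoop6_iff]
  by_contra h'
  exact hx (h.of_not _ h')

variable {X F G : ThreeBox} {κ κ' : ℂ} {Y Z : BoxTable}

theorem supportedOnClosedWalks_underVec (hX : HasTable X κ Y) :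
    SupportedOnClosedWalks (underVec X) := by
  refine supportedOnClosedWalks_of_length
    (supportedOnLength_emptyUnshaded.evalDiagram_of_eq rfl) ?_
  intro x0 x1 x2 x3 x4 x5 x6 x7 x8 h
  rw [underVec_apply] at h
  obtain ⟨⟨rfl, rfl, -, h1, -⟩, h'⟩ := ite_ne_right_iff.mp h
  have := hX.of_ne_zero (right_ne_zero_of_mul h')
  grind [isWalk8_iff, adj_comm]

theorem supportedOnClosedWalks_underVecShaded (hX : HasTable X κ Y) :
    SupportedOnClosedWalks (underVecShaded X) := by
  refine supportedOnClosedWalks_of_length (supportedOnLength_emptyShaded.evalDiagram_of_eq rfl) ?_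
  intro x0 x1 x2 x3 x4 x5 x6 x7 x8 h
  rw [underVecShaded_apply] at h
  obtain ⟨⟨rfl, rfl, -, h1, -⟩, h'⟩ := ite_ne_right_iff.mp h
  have := hX.of_ne_zero (right_ne_zero_of_mul h')
  grind [isWalk8_iff, adj_comm]

theorem supportedOnClosedWalks_pairVec (hF : HasTable F κ Y) (hG : HasTable G κ' Z) :
    SupportedOnClosedWalks (pairVec F G) := by
  refine supportedOnClosedWalks_of_length
    (supportedOnLength_emptyUnshaded.evalDiagram_of_eq rfl) ?_
  intro x0 x1 x2 x3 x4 x5 x6 x7 x8 h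
  rw [pairVec_apply] at h
  obtain ⟨a, -, ha⟩ := Finset.exists_ne_zero_of_sum_ne_zero h
  obtain ⟨⟨rfl, -⟩, h'⟩ := ite_ne_right_iff.mp ha
  have h1 := hF.of_ne_zero (left_ne_zero_of_mul (right_ne_zero_of_mul h'))
  have h2 := hG.of_ne_zero (right_ne_zero_of_mul (right_ne_zero_of_mul h'))
  grind [isWalk8_iff, adj_comm]

theorem supportedOnClosedWalks_pairVecShaded (hF : HasTable F κ Y)
    (hG : HasTable G κ' Z) :
    SupportedOnClosedWalks (pairVecShaded F G) := by
  refine supportedOnClosedWalks_of_length (supportedOnLength_emptyShaded.evalDiagram_of_eq rfl) ?_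
  intro x0 x1 x2 x3 x4 x5 x6 x7 x8 h
  rw [pairVecShaded_apply] at h
  obtain ⟨a, -, ha⟩ := Finset.exists_ne_zero_of_sum_ne_zero h
  obtain ⟨⟨rfl, -⟩, h'⟩ := ite_ne_right_iff.mp ha
  have h1 := hF.of_ne_zero (left_ne_zero_of_mul (right_ne_zero_of_mul h'))
  have h2 := hG.of_ne_zero (right_ne_zero_of_mul (right_ne_zero_of_mul h'))
  grind [isWalk8_iff, adj_comm]

/-- The product with `√(λ(c) / λ(x))`, for an even vertex `x`. -/
def twistEven (x : Vtx) (y : CycInt) : CycInt :=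
  match x with
  | .z _ => y.mulTh
  | _ => y

theorem sw_c (i : Fin 3) : sw .c = theta * sw (.z i) := sqrt_weight_c i

theorem sw_d (i : Fin 3) : sw .d = bigR * sw (.b i) := sqrt_weight_d i

theorem bigRC_ne : (bigR : ℂ) ≠ 0 := by exact_mod_cast bigR_pos.ne'

theorem eval_twistEven {x : Vtx} (hx : isEven x = true) (y : CycInt) :
    (twistEven x y).eval = sw .c / sw x * y.eval := by
  match x, hx with
  | .c, _ => rw [div_self (sw_ne _), one_mul]; rfl
  | .z i, _ => rw [sw_c i, mul_div_cancel_right₀ _ (sw_ne _), twistEven, eval_mulTh]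

/-- The product with `3 √(λ(b) / λ(x))`, divided by `R` if `x = d`, for an odd vertex `x`.  The
factor `3` clears the denominator of `R⁻² = θ² / 3`. -/
def twistOdd (x : Vtx) (y : CycInt) : CycInt :=
  match x with
  | .d => y.mulTh.mulTh
  | _ => y + y + y

theorem eval_twistOdd {x : Vtx} (hx : isEven x = false) (y : CycInt) :
    (twistOdd x y).eval = 3 * sw (.b 0) / (sw x * dFactor x) * y.eval := by
  have h0 := bigRC_ne
  have h1 := sw_ne (.b 0)
  match x, hx with
  | .d, _ =>
    rw [sw_d 0, twistOdd, eval_mulTh, eval_mulTh]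
    have h2 : (bigR : ℂ) ^ 2 = (theta : ℂ) ^ 2 - 3 := by exact_mod_cast bigR_sq
    simp only [dFactor, if_true]
    field_simp
    rw [h2]
    linear_combination y.eval * thetaC_pow_four
  | .b i, _ =>
    have : sw (.b i) = sw (.b 0) := rfl
    change (y + y + y).eval = _
    rw [eval_add, eval_add, this]
    simp only [dFactor, reduceCtorEq, if_false, Complex.ofReal_one]
    field_simp
    ring

theorem dFactor_of_isEven {x : Vtx} (h : isEven x = true) : dFactor x = 1 := by
  cases x <;> simp_all [isEven, dFactor]

theorem sw_eq_of_isEven_eq_false {x : Vtx} (h : isEven x = false) :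
    sw x = dFactor x * sw (.b 0) := by
  match x, h with
  | .d, _ => simp [dFactor, sw_d 0]
  | .b i, _ => simp only [dFactor, reduceCtorEq, if_false, Complex.ofReal_one, one_mul]; rfl

theorem dFactor_ne (x : Vtx) : (dFactor x : ℂ) ≠ 0 := by
  rw [dFactor]
  split_ifs
  · exact bigRC_ne
  · simp

theorem bigR_pow_count (l : List Vtx) :
    (bigR : ℂ) ^ l.count .d = (l.map fun x => (dFactor x : ℂ)).prod := by
  induction l with
  | nil => simp
  | cons x l ih =>
    rw [List.map_cons, List.prod_cons, ← ih, List.count_cons, dFactor]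
    by_cases h : x = .d
    · simp [h, pow_succ, mul_comm]
    · simp [h]

theorem boxGauge_apply (x y z t u v : Vtx) : (boxGauge ![x, y, z, t, u, v] : ℂ) =
    (sw x * sw t)⁻¹ * (dFactor x * dFactor y * dFactor z * dFactor t * dFactor u * dFactor v) := by
  simp [boxGauge, Fin.prod_univ_six, sw, Real.sqrt_mul (weight_pos _).le]

/-- The coefficients of `underVec X` in terms of the table of `X`, up to a factor that depends on
the outer region only. -/
def underTable (Y : BoxTable) (x1 x2 x3 x4 x5 x6 x7 : Vtx) : CycInt :=
  if x1 = x7 then twistOdd x1 (Y x2 x1 x6 x5 x4 x3) else 0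

theorem underVec_smul_jwWalk (hX : HasTable X κ Y) (w x1 x2 x3 x4 x5 x6 x7 : Vtx) :
    underVec X [w, x1, x2, x3, x4, x5, x6, x7, w] • jwWalk [w, x1, x2, x3, x4, x5, x6, x7, w] =
      (if isEven w = true then κ / (3 * sw (.b 0) * sw w) else 0) •
        (underTable Y x1 x2 x3 x4 x5 x6 x7).eval •
          walkClass [w, x1, x2, x3, x4, x5, x6, x7, w] := by
  by_cases hl : IsWalk8 [w, x1, x2, x3, x4, x5, x6, x7, w]
  swap
  · rw [walkClass, jwWalk_of_not hl]; simp
  rw [walkClass, smul_smul, smul_smul]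
  congr 1
  rw [isWalk8_iff] at hl
  rw [underVec_apply, underTable, bigR_pow_count]
  by_cases h : isEven w = true ∧ x1 = x7
  swap
  · rw [if_neg (by tauto)]
    by_cases hw : isEven w = true
    · rw [if_neg fun h7 => h ⟨hw, h7⟩]; simp
    · simp [hw]
  obtain ⟨hw, rfl⟩ := h
  obtain ⟨h1, h2, h3, h4, h5, h6, h7, -⟩ := hl
  have e1 : isEven x1 = false := by rw [isEven_of_adj h1, hw]; rfl
  have e2 : isEven x2 = true := by rw [isEven_of_adj h2, e1]; rfl
  have e3 : isEven x3 = false := by rw [isEven_of_adj h3, e2]; rfl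
  have e4 : isEven x4 = true := by rw [isEven_of_adj h4, e3]; rfl
  have e5 : isEven x5 = false := by rw [isEven_of_adj h5, e4]; rfl
  have e6 : isEven x6 = true := by rw [isEven_of_adj h6, e5]; rfl
  rw [if_pos ⟨rfl, rfl, hw, h1, h2, adj_symm h7, adj_symm h6⟩, if_pos hw, if_pos rfl,
    hX.of_loop _ _ _ _ _ _ (by rw [isLoop6_iff]; grind [adj_comm]), boxGauge_apply,
    eval_twistOdd e1]
  simp only [List.map_cons, List.map_nil, List.prod_cons, List.prod_nil, dFactor_of_isEven, hw, e2,
    e4, e6, Complex.ofReal_one, mul_one, one_mul]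
  have hd := dFactor_ne x1
  field_simp [sw_ne]

/-- The coefficients of `underVecShaded X` in terms of the table of `X`, up to a factor that depends
on the outer region only. -/
def underTableShaded (Y : BoxTable) (x1 x2 x3 x4 x5 x6 x7 : Vtx) : CycInt :=
  if x1 = x7 then twistEven x1 (Y x1 x6 x5 x4 x3 x2) else 0

theorem underVecShaded_smul_jwWalk (hX : HasTable X κ Y) (w x1 x2 x3 x4 x5 x6 x7 : Vtx) :
    underVecShaded X [w, x1, x2, x3, x4, x5, x6, x7, w] •
        jwWalk [w, x1, x2, x3, x4, x5, x6, x7, w] =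
      (if isEven w = true then 0 else κ / (sw .c * sw w * dFactor w ^ 2)) •
        (underTableShaded Y x1 x2 x3 x4 x5 x6 x7).eval •
          walkClass [w, x1, x2, x3, x4, x5, x6, x7, w] := by
  by_cases hl : IsWalk8 [w, x1, x2, x3, x4, x5, x6, x7, w]
  swap
  · rw [walkClass, jwWalk_of_not hl]; simp
  rw [walkClass, smul_smul, smul_smul]
  congr 1
  rw [isWalk8_iff] at hl
  rw [underVecShaded_apply, underTableShaded, bigR_pow_count]
  by_cases h : isEven w = false ∧ x1 = x7
  swap
  · rw [if_neg (by tauto)]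
    by_cases hw : isEven w = true
    · simp [hw]
    · rw [if_neg fun h7 => h ⟨by simpa using hw, h7⟩]; simp
  obtain ⟨hw, rfl⟩ := h
  obtain ⟨h1, h2, h3, h4, h5, h6, h7, -⟩ := hl
  have e1 : isEven x1 = true := by rw [isEven_of_adj h1, hw]; rfl
  have e2 : isEven x2 = false := by rw [isEven_of_adj h2, e1]; rfl
  have e3 : isEven x3 = true := by rw [isEven_of_adj h3, e2]; rfl
  have e4 : isEven x4 = false := by rw [isEven_of_adj h4, e3]; rfl
  have e5 : isEven x5 = true := by rw [isEven_of_adj h5, e4]; rfl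
  rw [if_pos ⟨rfl, rfl, hw, h1, adj_symm h7, adj_symm h6, adj_symm h5⟩, if_neg (by simp [hw]),
    if_pos rfl, hX.of_loop _ _ _ _ _ _ (by rw [isLoop6_iff]; grind [adj_comm]), boxGauge_apply,
    eval_twistEven e1]
  simp only [List.map_cons, List.map_nil, List.prod_cons, List.prod_nil, dFactor_of_isEven, e1, e3,
    e5, Complex.ofReal_one, mul_one, one_mul]
  have hd := dFactor_ne w
  field_simp [sw_ne]

/-- The sum over the common neighbours `x` of two even vertices, with a factor of `R² = θ² - 3` for
`d`. -/
def sumOddBetween (w e : Vtx) (f : Vtx → CycInt) : CycInt :=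
  match w, e with
  | .c, .c => f (.b 0) + f (.b 1) + f (.b 2) + of (-3) 0 1 0 0 0 0 0 * f .d
  | .c, .z i => f (.b i)
  | .z i, .c => f (.b i)
  | .z i, .z j => if i = j then f (.b i) else 0
  | _, _ => 0

theorem eval_sumOddBetween {w e : Vtx} (hw : isEven w = true) (he : isEven e = true)
    (f : Vtx → CycInt) : (sumOddBetween w e f).eval =
      ∑ a, if adj w a = true ∧ adj a e = true then (dFactor a : ℂ) ^ 2 * (f a).eval else 0 := by
  have hb (i) : dFactor (.b i) = 1 := by simp [dFactor]
  have hd : (dFactor .d : ℂ) ^ 2 = (of (-3) 0 1 0 0 0 0 0).eval := by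
    have h2 : (bigR : ℂ) ^ 2 = (theta : ℂ) ^ 2 - 3 := by exact_mod_cast bigR_sq
    rw [eval_of, dFactor, if_pos rfl, h2]
    push_cast
    ring
  rw [sum_vtx]
  match w, e, hw, he with
  | .c, .c, _, _ =>
    simp [adj, sumOddBetween, eval_add, eval_mul, hb, hd, Fin.sum_univ_three]
  | .c, .z i, _, _ => simp [adj, sumOddBetween, hb]
  | .z i, .c, _, _ => simp [adj, sumOddBetween, hb]
  | .z i, .z j, _, _ =>
    by_cases h : i = j
    · subst h
      have h' (x) : i = x ∧ x = i ↔ i = x := and_iff_left_of_imp Eq.symm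
      simp [adj, sumOddBetween, hb, h']
    · have h' (x) : ¬(i = x ∧ x = j) := fun h2 => h (h2.1.trans h2.2)
      simp [adj, sumOddBetween, h, h']

/-- The sum over the common neighbours of two odd vertices. -/
def sumEvenBetween (w r : Vtx) (f : Vtx → CycInt) : CycInt :=
  match w, r with
  | .b i, .b j => if i = j then f .c + f (.z i) else f .c
  | _, _ => f .c

theorem eval_sumEvenBetween {w r : Vtx} (hw : isEven w = false) (hr : isEven r = false)
    (f : Vtx → CycInt) : (sumEvenBetween w r f).eval =
      ∑ a, if adj w a = true ∧ adj a r = true then (f a).eval else 0 := by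
  rw [sum_vtx]
  match w, r, hw, hr with
  | .d, .d, _, _ => simp [adj, sumEvenBetween]
  | .d, .b i, _, _ => simp [adj, sumEvenBetween]
  | .b i, .d, _, _ => simp [adj, sumEvenBetween]
  | .b i, .b j, _, _ =>
    by_cases h : i = j
    · subst h
      have h' (x) : i = x ∧ x = i ↔ i = x := and_iff_left_of_imp Eq.symm
      simp [adj, sumEvenBetween, eval_add, add_comm, h']
    · have h' (x) : ¬(i = x ∧ x = j) := fun h2 => h (h2.1.trans h2.2)
      simp [adj, sumEvenBetween, h, h']

/-- The coefficients of `pairVec F G` in terms of the tables of `F` and `G`, up to a factor that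
depends on the outer region only. -/
def pairTable (Y Z : BoxTable) (w x1 x2 x3 x4 x5 x6 x7 : Vtx) : CycInt :=
  twistEven w (twistEven w (twistEven x4
    (sumOddBetween w x4 fun a => Y w a x4 x3 x2 x1 * Z w x7 x6 x5 x4 a)))

theorem pairVec_smul_jwWalk (hF : HasTable F κ Y) (hG : HasTable G κ' Z)
    (w x1 x2 x3 x4 x5 x6 x7 : Vtx) :
    pairVec F G [w, x1, x2, x3, x4, x5, x6, x7, w] • jwWalk [w, x1, x2, x3, x4, x5, x6, x7, w] =
      (if isEven w = true then κ * κ' / (sw .c ^ 3 * sw w) else 0) •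
        (pairTable Y Z w x1 x2 x3 x4 x5 x6 x7).eval •
          walkClass [w, x1, x2, x3, x4, x5, x6, x7, w] := by
  by_cases hl : IsWalk8 [w, x1, x2, x3, x4, x5, x6, x7, w]
  swap
  · rw [walkClass, jwWalk_of_not hl]; simp
  rw [walkClass, smul_smul, smul_smul]
  congr 1
  rw [isWalk8_iff] at hl
  rw [pairVec_apply, bigR_pow_count]
  by_cases hw : isEven w = true
  swap
  · simp [hw]
  obtain ⟨h1, h2, h3, h4, h5, h6, h7, h8⟩ := hl
  have e1 : isEven x1 = false := by rw [isEven_of_adj h1, hw]; rfl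
  have e2 : isEven x2 = true := by rw [isEven_of_adj h2, e1]; rfl
  have e3 : isEven x3 = false := by rw [isEven_of_adj h3, e2]; rfl
  have e4 : isEven x4 = true := by rw [isEven_of_adj h4, e3]; rfl
  have e5 : isEven x5 = false := by rw [isEven_of_adj h5, e4]; rfl
  have e6 : isEven x6 = true := by rw [isEven_of_adj h6, e5]; rfl
  rw [if_pos hw, pairTable, eval_twistEven hw, eval_twistEven hw, eval_twistEven e4,
    eval_sumOddBetween hw e4]
  simp only [Finset.mul_sum, Finset.sum_mul]
  refine Finset.sum_congr rfl fun a _ => ?_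
  by_cases ha : adj w a = true ∧ adj a x4 = true
  swap
  · rw [if_neg ha, if_neg (by tauto)]; simp
  rw [if_pos ha, if_pos ⟨trivial, hw, ha.1, ha.2, adj_symm h4, adj_symm h8, adj_symm h7,
      adj_symm h6⟩,
    hF.of_loop _ _ _ _ _ _ (by rw [isLoop6_iff]; grind [adj_comm]),
    hG.of_loop _ _ _ _ _ _ (by rw [isLoop6_iff]; grind [adj_comm]), boxGauge_apply,
    boxGauge_apply, eval_mul]
  simp only [List.map_cons, List.map_nil, List.prod_cons, List.prod_nil, dFactor_of_isEven, hw, e2,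
    e4, e6, Complex.ofReal_one, mul_one, one_mul]
  have hw := sw_ne w
  have h3 := sw_ne x3
  have h4 := sw_ne x4
  have h5 := sw_ne x5
  have hc := sw_ne .c
  generalize sw w = s at *
  generalize sw x3 = s3 at *
  generalize sw x4 = s4 at *
  generalize sw x5 = s5 at *
  generalize sw .c = s' at *
  generalize (Y _ _ _ _ _ _).eval = y
  generalize (Z _ _ _ _ _ _).eval = z
  field_simp

/-- The coefficients of `pairVecShaded F G` in terms of the tables of `F` and `G`, up to a factor
that depends on the outer region only. -/
def pairTableShaded (Y Z : BoxTable) (w x1 x2 x3 x4 x5 x6 x7 : Vtx) : CycInt :=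
  sumEvenBetween w x4 fun p => Y x1 w p x4 x3 x2 * Z x7 x6 x5 x4 p w

theorem pairVecShaded_smul_jwWalk (hF : HasTable F κ Y) (hG : HasTable G κ' Z)
    (w x1 x2 x3 x4 x5 x6 x7 : Vtx) :
    pairVecShaded F G [w, x1, x2, x3, x4, x5, x6, x7, w] •
        jwWalk [w, x1, x2, x3, x4, x5, x6, x7, w] =
      (if isEven w = true then 0 else κ * κ' / (sw (.b 0) * sw w ^ 3)) •
        (pairTableShaded Y Z w x1 x2 x3 x4 x5 x6 x7).eval •
          walkClass [w, x1, x2, x3, x4, x5, x6, x7, w] := by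
  by_cases hl : IsWalk8 [w, x1, x2, x3, x4, x5, x6, x7, w]
  swap
  · rw [walkClass, jwWalk_of_not hl]; simp
  rw [walkClass, smul_smul, smul_smul]
  congr 1
  rw [isWalk8_iff] at hl
  rw [pairVecShaded_apply, bigR_pow_count]
  by_cases hw : isEven w = false
  swap
  · simp [hw]
  obtain ⟨h1, h2, h3, h4, h5, h6, h7, h8⟩ := hl
  have e1 : isEven x1 = true := by rw [isEven_of_adj h1, hw]; rfl
  have e2 : isEven x2 = false := by rw [isEven_of_adj h2, e1]; rfl
  have e3 : isEven x3 = true := by rw [isEven_of_adj h3, e2]; rfl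
  have e4 : isEven x4 = false := by rw [isEven_of_adj h4, e3]; rfl
  have e5 : isEven x5 = true := by rw [isEven_of_adj h5, e4]; rfl
  have e6 : isEven x6 = false := by rw [isEven_of_adj h6, e5]; rfl
  have e7 : isEven x7 = true := by rw [isEven_of_adj h7, e6]; rfl
  rw [if_neg (by simp [hw]), pairTableShaded, eval_sumEvenBetween hw e4]
  simp only [Finset.mul_sum, Finset.sum_mul]
  refine Finset.sum_congr rfl fun a _ => ?_
  by_cases ha : adj w a = true ∧ adj a x4 = true
  swap
  · rw [if_neg ha, if_neg (by tauto)]; simp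
  have ea : isEven a = true := by rw [isEven_of_adj ha.1, hw]; rfl
  rw [if_pos ha, if_pos ⟨trivial, hw, h1, ha.1, ha.2, adj_symm h8, adj_symm h7, adj_symm h6,
      adj_symm h5⟩,
    hF.of_loop _ _ _ _ _ _ (by rw [isLoop6_iff]; grind [adj_comm]),
    hG.of_loop _ _ _ _ _ _ (by rw [isLoop6_iff]; grind [adj_comm]), boxGauge_apply,
    boxGauge_apply, eval_mul]
  simp only [List.map_cons, List.map_nil, List.prod_cons, List.prod_nil, dFactor_of_isEven, ea, e1,
    e3, e5, e7, Complex.ofReal_one, mul_one, one_mul]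
  have hd := dFactor_ne x4
  rw [sw_eq_of_isEven_eq_false e4]
  field_simp [sw_ne]

/-! ### The diagrams as combinations of words in the legs -/

theorem map_sum_smul {ι M N : Type*} [Fintype ι] [AddCommGroup M] [Module ℂ M] [AddCommGroup N]
    [Module ℂ N] (L : M →ₗ[ℂ] N) (r : ι → ℂ) (v : ι → M) :
    L (∑ a, r a • v a) = ∑ a, r a • L (v a) := by
  simp only [map_sum, map_smul]

/-- The combination of the walks `w x₁ x₂ x₃ e x₅ x₆ x₇ w` with coefficients
`f x₁ x₃ x₂ x₅ x₇ x₆`. -/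
noncomputable def evenArcsSum (w e : Vtx) :
    (Vtx → Vtx → Vtx → Vtx → Vtx → Vtx → ℂ) →ₗ[ℂ] WalkVec where
  toFun f := ∑ x1, ∑ x3, ∑ x2, ∑ x5, ∑ x7, ∑ x6,
    f x1 x3 x2 x5 x7 x6 • walkClass [w, x1, x2, x3, e, x5, x6, x7, w]
  map_add' f g := by simp only [Pi.add_apply, add_smul, Finset.sum_add_distrib]
  map_smul' r f := by
    simp only [Pi.smul_apply, smul_assoc, Finset.smul_sum, RingHom.id_apply]

/-- The combination of the walks `w (b i) c (b j) e (b k) c (b l) w` with coefficients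
`f i j k l`. -/
noncomputable def evenWordsSum (w e : Vtx) :
    (Fin 3 → Fin 3 → Fin 3 → Fin 3 → ℂ) →ₗ[ℂ] WalkVec where
  toFun f := ∑ i, ∑ j, ∑ k, ∑ l, f i j k l • walkClass [w, .b i, .c, .b j, e, .b k, .c, .b l, w]
  map_add' f g := by simp only [Pi.add_apply, add_smul, Finset.sum_add_distrib]
  map_smul' r f := by
    simp only [Pi.smul_apply, smul_assoc, Finset.smul_sum, RingHom.id_apply]

/-- The combination of the walks `w x₁ x₂ x₃ r x₅ x₆ x₇ w` with coefficients
`f x₂ x₁ x₃ x₆ x₅ x₇`. -/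
noncomputable def oddArcsSum (w r : Vtx) :
    (Vtx → Vtx → Vtx → Vtx → Vtx → Vtx → ℂ) →ₗ[ℂ] WalkVec where
  toFun f := ∑ x2, ∑ x1, ∑ x3, ∑ x6, ∑ x5, ∑ x7,
    f x2 x1 x3 x6 x5 x7 • walkClass [w, x1, x2, x3, r, x5, x6, x7, w]
  map_add' f g := by simp only [Pi.add_apply, add_smul, Finset.sum_add_distrib]
  map_smul' r f := by
    simp only [Pi.smul_apply, smul_assoc, Finset.smul_sum, RingHom.id_apply]

/-- The combination of the walks `w c (b i) c r c (b k) c w` with coefficients `f i k`. -/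
noncomputable def oddWordsSum (w r : Vtx) : (Fin 3 → Fin 3 → ℂ) →ₗ[ℂ] WalkVec where
  toFun f := ∑ i, ∑ k, f i k • walkClass [w, .c, .b i, .c, r, .c, .b k, .c, w]
  map_add' f g := by simp only [Pi.add_apply, add_smul, Finset.sum_add_distrib]
  map_smul' r f := by
    simp only [Pi.smul_apply, smul_assoc, Finset.smul_sum, RingHom.id_apply]

theorem evenArcsSum_eq {w e : Vtx} (hw : isEven w = true) (he : isEven e = true)
    (f : Vtx → Vtx → Vtx → Vtx → Vtx → Vtx → CycInt) :
    evenArcsSum w e (fun x1 x3 x2 x5 x7 x6 => (f x1 x2 x3 x5 x6 x7).eval) =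
      evenWordsSum w e fun i j k l =>
        (collapseEvenArc w e (fun x1 x2 x3 => collapseEvenArc e w (f x1 x2 x3) k l) i j).eval := by
  have h1 (x1 x3 x2) := sum_collapseEvenArc [w, x1, x2, x3] [] he hw (f x1 x2 x3)
  have h2 (k l) := sum_collapseEvenArc [] [.b k, .c, .b l, w] hw he fun x1 x2 x3 =>
    collapseEvenArc e w (f x1 x2 x3) k l
  simp only [List.cons_append, List.nil_append] at h1 h2
  simp only [evenArcsSum, evenWordsSum, LinearMap.coe_mk, AddHom.coe_mk, h1]
  have h3 (F : Vtx → Vtx → Vtx → Fin 3 → Fin 3 → WalkVec) :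
      ∑ x1, ∑ x3, ∑ x2, ∑ k, ∑ l, F x1 x3 x2 k l =
        ∑ k, ∑ l, ∑ x1, ∑ x3, ∑ x2, F x1 x3 x2 k l := by
    simp only [← Fintype.sum_prod_type']
    exact Fintype.sum_equiv
      ⟨fun x => (x.2.2.2.1, x.2.2.2.2, x.1, x.2.1, x.2.2.1),
        fun x => (x.2.2.1, x.2.2.2.1, x.2.2.2.2, x.1, x.2.1), fun _ => rfl, fun _ => rfl⟩ _ _
      fun _ => rfl
  have h4 (F : Fin 3 → Fin 3 → Fin 3 → Fin 3 → WalkVec) :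
      ∑ k, ∑ l, ∑ i, ∑ j, F i j k l = ∑ i, ∑ j, ∑ k, ∑ l, F i j k l := by
    simp only [← Fintype.sum_prod_type']
    exact Fintype.sum_equiv
      ⟨fun x => (x.2.2.1, x.2.2.2, x.1, x.2.1), fun x => (x.2.2.1, x.2.2.2, x.1, x.2.1),
        fun _ => rfl, fun _ => rfl⟩ _ _ fun _ => rfl
  rw [h3]
  simp only [h2]
  exact h4 _

theorem oddArcsSum_eq {w r : Vtx} (hw : isEven w = false) (hr : isEven r = false)
    (f : Vtx → Vtx → Vtx → Vtx → Vtx → Vtx → CycInt) :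
    oddArcsSum w r (fun x2 x1 x3 x6 x5 x7 => (f x1 x2 x3 x5 x6 x7).eval) =
      oddWordsSum w r fun i k =>
        (collapseOddArc w r (fun x1 x2 x3 => collapseOddArc r w (f x1 x2 x3) k) i).eval := by
  have h1 (x2 x1 x3) := sum_collapseOddArc [w, x1, x2, x3] [] hr hw (f x1 x2 x3)
  have h2 (k) := sum_collapseOddArc [] [.c, .b k, .c, w] hw hr fun x1 x2 x3 =>
    collapseOddArc r w (f x1 x2 x3) k
  simp only [List.cons_append, List.nil_append] at h1 h2
  simp only [oddArcsSum, oddWordsSum, LinearMap.coe_mk, AddHom.coe_mk, h1]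
  have h3 (F : Vtx → Vtx → Vtx → Fin 3 → WalkVec) :
      ∑ x2, ∑ x1, ∑ x3, ∑ k, F x2 x1 x3 k = ∑ k, ∑ x2, ∑ x1, ∑ x3, F x2 x1 x3 k := by
    simp only [← Fintype.sum_prod_type']
    exact Fintype.sum_equiv
      ⟨fun x => (x.2.2.2, x.1, x.2.1, x.2.2.1), fun x => (x.2.1, x.2.2.1, x.2.2.2, x.1),
        fun _ => rfl, fun _ => rfl⟩ _ _ fun _ => rfl
  rw [h3]
  simp only [h2]
  exact Finset.sum_comm

/-- Collapsing is linear over `ℂ`.  Coefficients are compared by their values, since no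
ring structure is put on `CycInt`. -/
theorem eval_collapseEven_of_eval {u v : Vtx} {f g : Vtx → CycInt} {t : ℂ}
    (h : ∀ x, (f x).eval = t * (g x).eval) :
    (collapseEven u v f).eval = t * (collapseEven u v g).eval := by
  unfold collapseEven
  split
  · split_ifs
    · simp only [eval_sub, eval_mulTh, h]; ring
    · exact h _
  · exact h _

theorem eval_collapseOdd_of_eval {u v : Vtx} {f g : Vtx → CycInt} {t : ℂ}
    (h : ∀ x, (f x).eval = t * (g x).eval) (i : Fin 3) :
    (collapseOdd u v f i).eval = t * (collapseOdd u v g i).eval := by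
  unfold collapseOdd
  split <;> (try split_ifs) <;> simp [eval_sub, h, mul_sub]

theorem eval_collapseEvenArc_of_eval {w e : Vtx} {f g : Vtx → Vtx → Vtx → CycInt} {t : ℂ}
    (h : ∀ x y z, (f x y z).eval = t * (g x y z).eval) (i j : Fin 3) :
    (collapseEvenArc w e f i j).eval = t * (collapseEvenArc w e g i j).eval :=
  eval_collapseOdd_of_eval (fun _ => eval_collapseOdd_of_eval
    (fun _ => eval_collapseEven_of_eval fun _ => h _ _ _) _) _

theorem eval_collapseOddArc_of_eval {w r : Vtx} {f g : Vtx → Vtx → Vtx → CycInt} {t : ℂ}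
    (h : ∀ x y z, (f x y z).eval = t * (g x y z).eval) (i : Fin 3) :
    (collapseOddArc w r f i).eval = t * (collapseOddArc w r g i).eval :=
  eval_collapseOdd_of_eval (fun _ => eval_collapseEven_of_eval
    fun _ => eval_collapseEven_of_eval fun _ => h _ _ _) _

/-- If the coefficients are products of one factor for each arc between `w` and `e`, then so are
those of the words.  This keeps the number of ring operations in the pairs small. -/
theorem evenArcsSum_mul {w e : Vtx} (hw : isEven w = true) (he : isEven e = true)
    (f g : Vtx → Vtx → Vtx → CycInt) :
    evenArcsSum w e (fun x1 x3 x2 x5 x7 x6 => (f x1 x2 x3 * g x5 x6 x7).eval) =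
      evenWordsSum w e fun i j k l =>
        (collapseEvenArc w e f i j * collapseEvenArc e w g k l).eval := by
  rw [evenArcsSum_eq hw he fun x1 x2 x3 x5 x6 x7 => f x1 x2 x3 * g x5 x6 x7]
  congr 1
  funext i j k l
  rw [eval_mul, mul_comm]
  refine eval_collapseEvenArc_of_eval (fun x1 x2 x3 => ?_) i j
  rw [mul_comm]
  exact eval_collapseEvenArc_of_eval (fun x5 x6 x7 => eval_mul _ _) k l

theorem oddArcsSum_mul {w r : Vtx} (hw : isEven w = false) (hr : isEven r = false)
    (f g : Vtx → Vtx → Vtx → CycInt) :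
    oddArcsSum w r (fun x2 x1 x3 x6 x5 x7 => (f x1 x2 x3 * g x5 x6 x7).eval) =
      oddWordsSum w r fun i k =>
        (collapseOddArc w r f i * collapseOddArc r w g k).eval := by
  rw [oddArcsSum_eq hw hr fun x1 x2 x3 x5 x6 x7 => f x1 x2 x3 * g x5 x6 x7]
  congr 1
  funext i k
  rw [eval_mul, mul_comm]
  refine eval_collapseOddArc_of_eval (fun x1 x2 x3 => ?_) i
  rw [mul_comm]
  exact eval_collapseOddArc_of_eval (fun x5 x6 x7 => eval_mul _ _) k

theorem evenArcsSum_of_odd {w e : Vtx} (hw : isEven w = true) (he : isEven e = false)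
    (f : Vtx → Vtx → Vtx → Vtx → Vtx → Vtx → ℂ) : evenArcsSum w e f = 0 := by
  have h (x1 x2 x3 x5 x6 x7) : walkClass [w, x1, x2, x3, e, x5, x6, x7, w] = 0 := by
    refine walkClass_of_not fun hl => ?_
    obtain ⟨h1, h2, h3, h4, -⟩ := isWalk8_iff.mp hl
    rw [isEven_of_adj h4, isEven_of_adj h3, isEven_of_adj h2, isEven_of_adj h1, hw] at he
    simp at he
  simp [evenArcsSum, h]

theorem oddArcsSum_of_even {w r : Vtx} (hw : isEven w = false) (hr : isEven r = true)
    (f : Vtx → Vtx → Vtx → Vtx → Vtx → Vtx → ℂ) : oddArcsSum w r f = 0 := by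
  have h (x1 x2 x3 x5 x6 x7) : walkClass [w, x1, x2, x3, r, x5, x6, x7, w] = 0 := by
    refine walkClass_of_not fun hl => ?_
    obtain ⟨h1, h2, h3, h4, -⟩ := isWalk8_iff.mp hl
    rw [isEven_of_adj h4, isEven_of_adj h3, isEven_of_adj h2, isEven_of_adj h1, hw] at hr
    simp at hr
  simp [oddArcsSum, h]

/-- After the two arcs the middle vertex `e` is collapsed to `c`. -/
theorem sum_evenArcsSum {w : Vtx} (hw : isEven w = true)
    (F : Vtx → Vtx → Vtx → Vtx → Vtx → Vtx → Vtx → ℂ)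
    (D : Fin 3 → Fin 3 → Fin 3 → Fin 3 → Vtx → CycInt)
    (h : ∀ e, isEven e = true →
      evenArcsSum w e (F e) = evenWordsSum w e fun i j k l => (D i j k l e).eval) :
    ∑ e, evenArcsSum w e (F e) =
      evenWordsSum w .c fun i j k l => (collapseEven (.b j) (.b k) (D i j k l)).eval := by
  have h1 (e) : evenArcsSum w e (F e) = evenWordsSum w e fun i j k l => (D i j k l e).eval := by
    cases he : isEven e
    · rw [evenArcsSum_of_odd hw he]
      have h0 (i j k l) : walkClass [w, .b i, .c, .b j, e, .b k, .c, .b l, w] = 0 :=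
        walkClass_of_not_adj_left [w, .b i, .c] _ (adj_eq_false_of_isEven_eq he.symm)
      simp [evenWordsSum, h0]
    · exact h e he
  have h2 (i j k l) := sum_collapseEven [w, .b i, .c] [.c, .b l, w] (u := .b j) (v := .b k) rfl rfl
    (D i j k l)
  simp only [List.cons_append, List.nil_append] at h2
  simp only [h1, evenWordsSum, LinearMap.coe_mk, AddHom.coe_mk, ← h2]
  rw [Finset.sum_comm]
  refine Finset.sum_congr rfl fun i _ => ?_
  rw [Finset.sum_comm]
  refine Finset.sum_congr rfl fun j _ => ?_
  rw [Finset.sum_comm]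
  refine Finset.sum_congr rfl fun k _ => ?_
  rw [Finset.sum_comm]

/-- After the two arcs the middle vertex `r` is collapsed to the legs `b j`. -/
theorem sum_oddArcsSum {w : Vtx} (hw : isEven w = false)
    (F : Vtx → Vtx → Vtx → Vtx → Vtx → Vtx → Vtx → ℂ)
    (D : Fin 3 → Fin 3 → Vtx → CycInt)
    (h : ∀ r, isEven r = false →
      oddArcsSum w r (F r) = oddWordsSum w r fun i k => (D i k r).eval) :
    ∑ r, oddArcsSum w r (F r) = ∑ j, oddWordsSum w (.b j) fun i k =>
      (collapseOdd .c .c (D i k) j).eval := by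
  have h1 (r) : oddArcsSum w r (F r) = oddWordsSum w r fun i k => (D i k r).eval := by
    cases hr : isEven r
    · exact h r hr
    · rw [oddArcsSum_of_even hw hr]
      have h0 (i k) : walkClass [w, .c, .b i, .c, r, .c, .b k, .c, w] = 0 :=
        walkClass_of_not_adj_left [w, .c, .b i] _ (adj_eq_false_of_isEven_eq hr.symm)
      simp [oddWordsSum, h0]
  have h2 (i k) := sum_collapseOdd [w, .c, .b i] [.b k, .c, w] (u := .c) (v := .c) rfl rfl (D i k)
  simp only [List.cons_append, List.nil_append] at h2
  simp only [h1, oddWordsSum, LinearMap.coe_mk, AddHom.coe_mk]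
  rw [Finset.sum_comm]
  conv_rhs => rw [Finset.sum_comm]
  refine Finset.sum_congr rfl fun i _ => ?_
  rw [Finset.sum_comm]
  conv_rhs => rw [Finset.sum_comm]
  exact Finset.sum_congr rfl fun k _ => h2 i k

/-- The coefficient of `w (b i) c (b j) c (b k) c (b l) w` in `underVec`. -/
def underCoeff (Y : BoxTable) (w : Vtx) (i j k l : Fin 3) : CycInt :=
  collapseEven (.b j) (.b k) fun e => collapseEvenArc w e (fun x1 x2 x3 =>
    collapseEvenArc e w (fun x5 x6 x7 => underTable Y x1 x2 x3 e x5 x6 x7) k l) i j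

/-- The coefficient of `w (b i) c (b j) c (b k) c (b l) w` in `pairVec`.  The collapses are carried
out in each factor of `pairTable` separately, as `evenArcsSum_mul` allows. -/
def pairCoeff (Y Z : BoxTable) (w : Vtx) (i j k l : Fin 3) : CycInt :=
  collapseEven (.b j) (.b k) fun e => twistEven w (twistEven w (twistEven e
    (sumOddBetween w e fun a =>
      collapseEvenArc w e (fun x1 x2 x3 => Y w a e x3 x2 x1) i j *
        collapseEvenArc e w (fun x5 x6 x7 => Z w x7 x6 x5 e a) k l)))

/-- The coefficient of `w c (b i) c (b j) c (b k) c w` in `underVecShaded`. -/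
def underCoeffShaded (Y : BoxTable) (w : Vtx) (i j k : Fin 3) : CycInt :=
  collapseOdd .c .c (fun r => collapseOddArc w r (fun x1 x2 x3 =>
    collapseOddArc r w (fun x5 x6 x7 => underTableShaded Y x1 x2 x3 r x5 x6 x7) k) i) j

/-- The coefficient of `w c (b i) c (b j) c (b k) c w` in `pairVecShaded`.  The collapses are
carried out in each factor of `pairTableShaded` separately, as `oddArcsSum_mul` allows. -/
def pairCoeffShaded (Y Z : BoxTable) (w : Vtx) (i j k : Fin 3) : CycInt :=
  collapseOdd .c .c (fun r => sumEvenBetween w r fun p =>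
    collapseOddArc w r (fun x1 x2 x3 => Y x1 w p r x3 x2) i *
      collapseOddArc r w (fun x5 x6 x7 => Z x7 x6 x5 r p w) k) j

theorem sum_underTable {w : Vtx} (hw : isEven w = true) (Y : BoxTable) :
    ∑ e, evenArcsSum w e (fun x1 x3 x2 x5 x7 x6 => (underTable Y x1 x2 x3 e x5 x6 x7).eval) =
      evenWordsSum w .c fun i j k l => (underCoeff Y w i j k l).eval :=
  sum_evenArcsSum hw _ (fun i j k l e => collapseEvenArc w e (fun x1 x2 x3 =>
    collapseEvenArc e w (fun x5 x6 x7 => underTable Y x1 x2 x3 e x5 x6 x7) k l) i j)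
    fun e he => evenArcsSum_eq hw he fun x1 x2 x3 x5 x6 x7 => underTable Y x1 x2 x3 e x5 x6 x7

theorem sum_underTableShaded {w : Vtx} (hw : isEven w = false) (Y : BoxTable) :
    ∑ r, oddArcsSum w r (fun x2 x1 x3 x6 x5 x7 =>
        (underTableShaded Y x1 x2 x3 r x5 x6 x7).eval) =
      ∑ j, oddWordsSum w (.b j) fun i k => (underCoeffShaded Y w i j k).eval :=
  sum_oddArcsSum hw _ (fun i k r => collapseOddArc w r (fun x1 x2 x3 =>
    collapseOddArc r w (fun x5 x6 x7 => underTableShaded Y x1 x2 x3 r x5 x6 x7) k) i)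
    fun r hr => oddArcsSum_eq hw hr fun x1 x2 x3 x5 x6 x7 => underTableShaded Y x1 x2 x3 r x5 x6 x7

theorem sum_pairTable {w : Vtx} (hw : isEven w = true) (Y Z : BoxTable) :
    ∑ e, evenArcsSum w e (fun x1 x3 x2 x5 x7 x6 => (pairTable Y Z w x1 x2 x3 e x5 x6 x7).eval) =
      evenWordsSum w .c fun i j k l => (pairCoeff Y Z w i j k l).eval := by
  refine sum_evenArcsSum hw _ (fun i j k l e => twistEven w (twistEven w (twistEven e
    (sumOddBetween w e fun a =>
      collapseEvenArc w e (fun x1 x2 x3 => Y w a e x3 x2 x1) i j *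
        collapseEvenArc e w (fun x5 x6 x7 => Z w x7 x6 x5 e a) k l)))) fun e he => ?_
  set t : ℂ := sw .c / sw w * (sw .c / sw w * (sw .c / sw e)) with ht
  set m : Vtx → ℂ := fun a => if adj w a = true ∧ adj a e = true then (dFactor a : ℂ) ^ 2 else 0
    with hm
  have h1 (f : Vtx → CycInt) : (twistEven w (twistEven w (twistEven e
      (sumOddBetween w e f)))).eval = t * ∑ a, m a * (f a).eval := by
    rw [eval_twistEven hw, eval_twistEven hw, eval_twistEven he, eval_sumOddBetween hw he]
    simp only [hm, ite_mul, zero_mul, ht]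
    ring
  simp only [pairTable, h1]
  have h2 := fun a => evenArcsSum_mul hw he (fun x1 x2 x3 => Y w a e x3 x2 x1)
    (fun x5 x6 x7 => Z w x7 x6 x5 e a)
  have h3 : ∑ a, (t * m a) • evenArcsSum w e (fun x1 x3 x2 x5 x7 x6 =>
      (Y w a e x3 x2 x1 * Z w x7 x6 x5 e a).eval) =
      ∑ a, (t * m a) • evenWordsSum w e (fun i j k l =>
        (collapseEvenArc w e (fun x1 x2 x3 => Y w a e x3 x2 x1) i j *
        collapseEvenArc e w (fun x5 x6 x7 => Z w x7 x6 x5 e a) k l).eval) := by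
    simp only [h2]
  rw [← map_sum_smul, ← map_sum_smul] at h3
  convert h3 using 2
  · funext x1 x3 x2 x5 x7 x6
    simp [Finset.sum_apply, Finset.mul_sum, mul_assoc]
  · funext i j k l
    simp [Finset.sum_apply, Finset.mul_sum, mul_assoc]

theorem sum_pairTableShaded {w : Vtx} (hw : isEven w = false) (Y Z : BoxTable) :
    ∑ r, oddArcsSum w r (fun x2 x1 x3 x6 x5 x7 =>
        (pairTableShaded Y Z w x1 x2 x3 r x5 x6 x7).eval) =
      ∑ j, oddWordsSum w (.b j) fun i k => (pairCoeffShaded Y Z w i j k).eval := by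
  refine sum_oddArcsSum hw _ (fun i k r => sumEvenBetween w r fun p =>
    collapseOddArc w r (fun x1 x2 x3 => Y x1 w p r x3 x2) i *
      collapseOddArc r w (fun x5 x6 x7 => Z x7 x6 x5 r p w) k) fun r hr => ?_
  set m : Vtx → ℂ := fun a => if adj w a = true ∧ adj a r = true then 1 else 0 with hm
  have h1 (f : Vtx → CycInt) : (sumEvenBetween w r f).eval = ∑ a, m a * (f a).eval := by
    rw [eval_sumEvenBetween hw hr]
    simp only [hm, ite_mul, zero_mul, one_mul]
  simp only [pairTableShaded, h1]
  have h2 := fun p => oddArcsSum_mul hw hr (fun x1 x2 x3 => Y x1 w p r x3 x2)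
    (fun x5 x6 x7 => Z x7 x6 x5 r p w)
  have h3 : ∑ p, m p • oddArcsSum w r (fun x2 x1 x3 x6 x5 x7 =>
      (Y x1 w p r x3 x2 * Z x7 x6 x5 r p w).eval) =
      ∑ p, m p • oddWordsSum w r (fun i k =>
        (collapseOddArc w r (fun x1 x2 x3 => Y x1 w p r x3 x2) i *
        collapseOddArc r w (fun x5 x6 x7 => Z x7 x6 x5 r p w) k).eval) := by
    simp only [h2]
  rw [← map_sum_smul, ← map_sum_smul] at h3
  convert h3 using 2
  · funext x2 x1 x3 x6 x5 x7
    simp [Finset.sum_apply]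
  · funext i k
    simp [Finset.sum_apply]

/-! ### Relations among the words -/

theorem sum_rotate₃ {α β γ M : Type*} [Fintype α] [Fintype β] [Fintype γ] [AddCommMonoid M]
    (F : α → β → γ → M) : ∑ i, ∑ j, ∑ k, F i j k = ∑ k, ∑ i, ∑ j, F i j k := by
  simp only [← Fintype.sum_prod_type']
  exact Fintype.sum_equiv
    ⟨fun x => (x.2.2, x.1, x.2.1), fun x => (x.2.1, x.2.2, x.1), fun _ => rfl, fun _ => rfl⟩
    _ _ fun _ => rfl

theorem sum_rotate₄ {α β γ δ M : Type*} [Fintype α] [Fintype β] [Fintype γ] [Fintype δ]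
    [AddCommMonoid M] (F : α → β → γ → δ → M) :
    ∑ i, ∑ j, ∑ k, ∑ l, F i j k l = ∑ k, ∑ l, ∑ i, ∑ j, F i j k l := by
  simp only [← Fintype.sum_prod_type']
  exact Fintype.sum_equiv
    ⟨fun x => (x.2.2.1, x.2.2.2, x.1, x.2.1), fun x => (x.2.2.1, x.2.2.2, x.1, x.2.1),
      fun _ => rfl, fun _ => rfl⟩ _ _ fun _ => rfl

/-- The relations with outer region `c`: words `b i c b i c b i` vanish, and so do the sums over the
first, the middle and the last two legs. -/
theorem evenWordsSum_c_eq_zero (f : Fin 3 → Fin 3 → Fin 3 → Fin 3 → CycInt)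
    (g₁ g₂ g₃ : Fin 3 → CycInt) (h : ∀ i j k l, (i = j ∧ j = k) ∨ (j = k ∧ k = l) ∨
      f i j k l = g₁ (l - k) + g₂ (l - i) + g₃ (j - i)) :
    evenWordsSum .c .c (fun i j k l => (f i j k l).eval) = 0 := by
  set W : Fin 3 → Fin 3 → Fin 3 → Fin 3 → WalkVec := fun i j k l =>
    walkClass [.c, .b i, .c, .b j, .c, .b k, .c, .b l, .c] with hW
  have h1 (i j k l) : (f i j k l).eval • W i j k l = (g₁ (l - k)).eval • W i j k l +
      (g₂ (l - i)).eval • W i j k l + (g₃ (j - i)).eval • W i j k l := by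
    rcases h i j k l with ⟨rfl, rfl⟩ | ⟨rfl, rfl⟩ | h
    · have : W i i i l = 0 := walkClass_b_c_b_c_b [.c] [.c, .b l, .c] i
      simp [this]
    · have : W i j j j = 0 := walkClass_b_c_b_c_b [.c, .b i, .c] [.c] j
      simp [this]
    · rw [h, eval_add, eval_add, add_smul, add_smul]
  have e1 (k l) : ∑ i, ∑ j, W i j k l = 0 := sum_sum_walkClass [] [.b k, .c, .b l, .c]
  have e2 (i l) : ∑ j, ∑ k, W i j k l = 0 := sum_sum_walkClass [.c, .b i] [.b l, .c]
  have e3 (i j) : ∑ k, ∑ l, W i j k l = 0 := sum_sum_walkClass [.c, .b i, .c, .b j] []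
  have h2 : evenWordsSum .c .c (fun i j k l => (f i j k l).eval) =
      ∑ i, ∑ j, ∑ k, ∑ l, (f i j k l).eval • W i j k l := rfl
  rw [h2]
  simp only [h1, Finset.sum_add_distrib]
  have s1 : ∑ i, ∑ j, ∑ k, ∑ l, (g₁ (l - k)).eval • W i j k l =
      ∑ k, ∑ l, (g₁ (l - k)).eval • ∑ i, ∑ j, W i j k l := by
    simp only [Finset.smul_sum]
    exact sum_rotate₄ _
  have s2 : ∑ i, ∑ j, ∑ k, ∑ l, (g₂ (l - i)).eval • W i j k l =
      ∑ i, ∑ l, (g₂ (l - i)).eval • ∑ j, ∑ k, W i j k l := by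
    simp only [Finset.smul_sum]
    exact Finset.sum_congr rfl fun i _ => sum_rotate₃ _
  have s3 : ∑ i, ∑ j, ∑ k, ∑ l, (g₃ (j - i)).eval • W i j k l =
      ∑ i, ∑ j, (g₃ (j - i)).eval • ∑ k, ∑ l, W i j k l := by
    simp only [Finset.smul_sum]
  rw [s1, s2, s3]
  simp only [e1, e2, e3, smul_zero, Finset.sum_const_zero, add_zero]

/-- The relations with outer region `z m`: the outer legs are `b m`, words with another `b m`
vanish, and so does the sum over the inner two legs. -/
theorem evenWordsSum_z_eq_zero (m : Fin 3) (f : Fin 3 → Fin 3 → Fin 3 → Fin 3 → CycInt)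
    (s : CycInt) (h : ∀ j k, j = m ∨ k = m ∨ f m j k m = s) :
    evenWordsSum (.z m) .c (fun i j k l => (f i j k l).eval) = 0 := by
  set W : Fin 3 → Fin 3 → Fin 3 → Fin 3 → WalkVec := fun i j k l =>
    walkClass [.z m, .b i, .c, .b j, .c, .b k, .c, .b l, .z m] with hW
  have h0 (i j k l) (hi : ¬(i = m ∧ l = m)) : W i j k l = 0 := by
    by_cases him : i = m
    · exact walkClass_of_not_adj_left [.z m, .b i, .c, .b j, .c, .b k, .c] []
        (by simpa [adj] using fun h => hi ⟨him, h⟩)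
    · exact walkClass_of_not_adj_left [] [.c, .b j, .c, .b k, .c, .b l, .z m]
        (by simpa [adj] using Ne.symm him)
  have h1 (j k) : (f m j k m).eval • W m j k m = s.eval • W m j k m := by
    rcases h j k with rfl | rfl | h
    · have : W j j k j = 0 := walkClass_z_b_c_b [] [.c, .b k, .c, .b j, .z j] j
      simp [this]
    · have : W k j k k = 0 := walkClass_b_c_b_z [.z k, .b k, .c, .b j, .c] [] k
      simp [this]
    · rw [h]
  have h2 : evenWordsSum (.z m) .c (fun i j k l => (f i j k l).eval) =
      ∑ i, ∑ j, ∑ k, ∑ l, (f i j k l).eval • W i j k l := rfl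
  rw [h2, Finset.sum_eq_single m ?_ (by simp)]
  · have h3 (j k) : ∑ l, (f m j k l).eval • W m j k l = s.eval • W m j k m := by
      rw [Finset.sum_eq_single m ?_ (by simp), h1]
      intro l _ hl
      rw [h0 _ _ _ _ (by tauto), smul_zero]
    simp only [h3, ← Finset.smul_sum]
    have : ∑ j, ∑ k, W m j k m = 0 := sum_sum_walkClass [.z m, .b m] [.b m, .z m]
    rw [this, smul_zero]
  · intro i _ hi
    have h' (j k l) := h0 i j k l (by tauto)
    simp [h']

/-- The relations with outer region `b m`: words `b i c b i c b i` vanish, also with the outer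
`b m`, and so do the sums over the first and the last two legs. -/
theorem oddWordsSum_b_eq_zero (m : Fin 3) (f : Fin 3 → Fin 3 → Fin 3 → CycInt)
    (g₁ g₂ : Fin 3 → CycInt) (h : ∀ i j k, (m = i ∧ i = j) ∨ (j = k ∧ k = m) ∨ (i = j ∧ j = k) ∨
      f i j k = g₁ (k - m) + g₂ (i - m)) :
    ∑ j, oddWordsSum (.b m) (.b j) (fun i k => (f i j k).eval) = 0 := by
  set W : Fin 3 → Fin 3 → Fin 3 → WalkVec := fun i j k =>
    walkClass [.b m, .c, .b i, .c, .b j, .c, .b k, .c, .b m] with hW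
  have h1 (i j k) : (f i j k).eval • W i j k =
      (g₁ (k - m)).eval • W i j k + (g₂ (i - m)).eval • W i j k := by
    rcases h i j k with ⟨rfl, rfl⟩ | ⟨rfl, rfl⟩ | ⟨rfl, rfl⟩ | h
    · have : W m m k = 0 := walkClass_b_c_b_c_b [] [.c, .b k, .c, .b m] m
      simp [this]
    · have : W i j j = 0 := walkClass_b_c_b_c_b [.b j, .c, .b i, .c] [] j
      simp [this]
    · have : W i i i = 0 := walkClass_b_c_b_c_b [.b m, .c] [.c, .b m] i
      simp [this]
    · rw [h, eval_add, add_smul]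
  have e1 (k) : ∑ i, ∑ j, W i j k = 0 := sum_sum_walkClass [.b m] [.b k, .c, .b m]
  have e2 (i) : ∑ j, ∑ k, W i j k = 0 := sum_sum_walkClass [.b m, .c, .b i] [.b m]
  have h2 : ∑ j, oddWordsSum (.b m) (.b j) (fun i k => (f i j k).eval) =
      ∑ j, ∑ i, ∑ k, (f i j k).eval • W i j k := rfl
  rw [h2, Finset.sum_comm]
  simp only [h1, Finset.sum_add_distrib]
  have s1 : ∑ i, ∑ j, ∑ k, (g₁ (k - m)).eval • W i j k =
      ∑ k, (g₁ (k - m)).eval • ∑ i, ∑ j, W i j k := by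
    simp only [Finset.smul_sum]
    exact sum_rotate₃ _
  have s2 : ∑ i, ∑ j, ∑ k, (g₂ (i - m)).eval • W i j k =
      ∑ i, (g₂ (i - m)).eval • ∑ j, ∑ k, W i j k := by
    simp only [Finset.smul_sum]
  rw [s1, s2]
  simp only [e1, e2, smul_zero, Finset.sum_const_zero, add_zero]

/-- The relations with outer region `d`: words `b i c b i c b i` vanish, and so do the sums over the
first and over the last leg. -/
theorem oddWordsSum_d_eq_zero (f : Fin 3 → Fin 3 → Fin 3 → CycInt)
    (g₁ g₂ : Fin 3 → CycInt) (h : ∀ i j k, (i = j ∧ j = k) ∨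
      f i j k = g₁ (k - j) + g₂ (j - i)) :
    ∑ j, oddWordsSum .d (.b j) (fun i k => (f i j k).eval) = 0 := by
  set W : Fin 3 → Fin 3 → Fin 3 → WalkVec := fun i j k =>
    walkClass [.d, .c, .b i, .c, .b j, .c, .b k, .c, .d] with hW
  have h1 (i j k) : (f i j k).eval • W i j k =
      (g₁ (k - j)).eval • W i j k + (g₂ (j - i)).eval • W i j k := by
    rcases h i j k with ⟨rfl, rfl⟩ | h
    · have : W i i i = 0 := walkClass_b_c_b_c_b [.d, .c] [.c, .d] i
      simp [this]
    · rw [h, eval_add, add_smul]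
  have e1 (j k) : ∑ i, W i j k = 0 := sum_walkClass_d_c_b [] [.b j, .c, .b k, .c, .d]
  have e2 (i j) : ∑ k, W i j k = 0 := sum_walkClass_b_c_d [.d, .c, .b i, .c, .b j] []
  have h2 : ∑ j, oddWordsSum .d (.b j) (fun i k => (f i j k).eval) =
      ∑ j, ∑ i, ∑ k, (f i j k).eval • W i j k := rfl
  rw [h2]
  simp only [h1, Finset.sum_add_distrib]
  have s1 (j) : ∑ i, ∑ k, (g₁ (k - j)).eval • W i j k =
      ∑ k, (g₁ (k - j)).eval • ∑ i, W i j k := by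
    simp only [Finset.smul_sum]
    exact Finset.sum_comm
  simp only [s1, ← Finset.smul_sum, e1, e2, smul_zero, Finset.sum_const_zero, add_zero]

/-! ### The explicit combinations -/

/-- The table of `T`, up to a scalar. -/
def tableT : BoxTable := letterTable lettersT

/-- The table of `Q`, up to a scalar. -/
def tableQ : BoxTable := letterTable lettersQ

/-- A presentation of an element as a combination of those belonging to `(T, T)`, `(T, Q)` and
`(Q, T)`, with the coefficients `cTT / n`, `cTQ / n`, `cQT / n`. -/
structure Combination where
  n : ℤ
  cTT : CycInt
  cTQ : CycInt
  cQT : CycInt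

/-- The difference of `n x` and the combination of `xTT`, `xTQ` and `xQT`. -/
def Combination.defect (r : Combination) (x xTT xTQ xQT : CycInt) : CycInt :=
  of r.n 0 0 0 0 0 0 0 * x - (r.cTT * xTT + r.cTQ * xTQ + r.cQT * xQT)

/-- The defect of the words of `underVec`. -/
def evenDefect (r : Combination) (Y : BoxTable) (w : Vtx) (i j k l : Fin 3) : CycInt :=
  r.defect (underCoeff Y w i j k l) (pairCoeff tableT tableT w i j k l)
    (pairCoeff tableT tableQ w i j k l) (pairCoeff tableQ tableT w i j k l)

/-- The defect of the words of `underVecShaded`. -/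
def oddDefect (r : Combination) (Y : BoxTable) (w : Vtx) (i j k : Fin 3) : CycInt :=
  r.defect (underCoeffShaded Y w i j k) (pairCoeffShaded tableT tableT w i j k)
    (pairCoeffShaded tableT tableQ w i j k) (pairCoeffShaded tableQ tableT w i j k)

/-- Whether `p` holds on `Fin 3`. -/
def allFin (p : Fin 3 → Bool) : Bool := p 0 && p 1 && p 2

theorem of_allFin {p : Fin 3 → Bool} (h : allFin p = true) (i : Fin 3) : p i = true := by
  simp only [allFin, Bool.and_eq_true] at h
  fin_cases i
  exacts [h.1.1, h.1.2, h.2]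

/-- The hypothesis of `evenWordsSum_c_eq_zero` on the defect. -/
def checkC (r : Combination) (Y : BoxTable) (g₁ g₂ g₃ : Fin 3 → CycInt) : Bool :=
  allFin fun i => allFin fun j => allFin fun k => allFin fun l =>
    (decide (i = j) && decide (j = k)) || ((decide (j = k) && decide (k = l)) ||
      decide (evenDefect r Y .c i j k l = g₁ (l - k) + g₂ (l - i) + g₃ (j - i)))

/-- The hypothesis of `evenWordsSum_z_eq_zero` on the defect. -/
def checkZ (r : Combination) (Y : BoxTable) (s : CycInt) : Bool :=
  allFin fun m => allFin fun j => allFin fun k => decide (j = m) || (decide (k = m) ||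
    decide (evenDefect r Y (.z m) m j k m = s))

/-- The hypothesis of `oddWordsSum_b_eq_zero` on the defect. -/
def checkB (r : Combination) (Y : BoxTable) (g₁ g₂ : Fin 3 → CycInt) : Bool :=
  allFin fun m => allFin fun i => allFin fun j => allFin fun k =>
    (decide (m = i) && decide (i = j)) || ((decide (j = k) && decide (k = m)) ||
      ((decide (i = j) && decide (j = k)) ||
        decide (oddDefect r Y (.b m) i j k = g₁ (k - m) + g₂ (i - m))))

/-- The hypothesis of `oddWordsSum_d_eq_zero` on the defect. -/
def checkD (r : Combination) (Y : BoxTable) (g₁ g₂ : Fin 3 → CycInt) : Bool :=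
  allFin fun i => allFin fun j => allFin fun k => (decide (i = j) && decide (j = k)) ||
    decide (oddDefect r Y .d i j k = g₁ (k - j) + g₂ (j - i))

/-- The combination for `u`.  This and the coefficients of the relations in the checks below solve a
linear system over `ℚ(θ, ω)`, normalized so that the entries are integral. -/
def combinationT : Combination where
  n := 180
  cTT := of 24 0 (-12) 0 0 0 0 0
  cTQ := of (-90) (-25) 25 5 45 10 (-10) (-5)
  cQT := of 45 10 (-10) (-5) (-90) (-25) 25 5

theorem check_c_T : checkC combinationT tableT
    (![of (-1296) 0 1728 (-1080) 0 1620 2700 (-1620),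
    of (-1296) (-1080) (-432) (-1080) 0 1080 0 (-1080),
    of (-1296) 1080 (-432) (-1080) 0 2160 0 (-2160)])
    (![of 0 (-540) (-1620) 540 0 (-1080) 0 1080,
    of 0 (-1080) 0 1080 0 (-2160) 0 2160,
    0])
    (![of 0 540 (-540) 540 0 (-540) (-2700) 540,
    of 0 1080 0 1080 0 (-1080) 0 1080,
    0]) = true := by
  decide +kernel

theorem check_z_T : checkZ combinationT tableT
    (of 12960 0 9720 0 0 0 0 0) = true := by
  decide +kernel

/-- The combination for `v`. -/
def combinationQ : Combination where
  n := 450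
  cTT := of 12 9 9 13 12 9 9 13
  cTQ := of (-10) 0 5 0 (-20) 0 10 0
  cQT := of 10 0 (-5) 0 (-10) 0 5 0

theorem check_c_Q : checkC combinationQ tableQ
    (![of (-3078) 1134 (-2646) 1188 5022 2484 6804 2538,
    of (-108) 2754 594 3078 5292 4104 7344 4428,
    of (-3618) 1674 (-3726) 2268 7182 4374 9774 4968])
    (![of 2700 (-1350) 1350 (-1350) (-2700) (-2700) (-5400) (-2700),
    of 5400 1350 6750 1350 (-5400) (-1350) (-6750) (-1350),
    0])
    (![of (-270) (-1620) (-540) (-1890) (-2970) (-1620) (-3240) (-1890),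
    of 1890 270 2430 540 (-3510) (-1080) (-4320) (-810),
    0]) = true := by
  decide +kernel

theorem check_z_Q : checkZ combinationQ tableQ
    (of (-8100) (-12150) (-12150) (-14850) (-8100) (-12150) (-12150) (-14850)) = true := by
  decide +kernel

/-- The combination for `u₀`. -/
def combinationShadedT : Combination where
  n := 180
  cTT := of 24 0 (-12) 0 0 0 0 0
  cTQ := of (-45) (-10) 10 5 (-135) (-35) 35 10
  cQT := of (-135) (-35) 35 10 (-45) (-10) 10 5

theorem check_b_T : checkB combinationShadedT tableT
    (![of 1836 0 2592 (-180) 0 1620 2700 180,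
    of 216 1620 972 180 0 3240 0 360,
    of 216 (-1620) 972 (-540) 0 0 0 0])
    (![of 1620 0 (-1080) 180 0 (-1620) (-2700) (-180),
    of 0 0 0 360 0 (-3240) 0 (-360),
    0]) = true := by
  decide +kernel

theorem check_d_T : checkD combinationShadedT tableT
    (![of (-756) 0 648 180 0 0 0 360,
    of 864 0 (-432) 0 0 0 0 0,
    of 864 0 (-432) 360 0 0 0 720])
    (![of (-1620) 0 1080 (-180) 0 0 0 (-360),
    of 0 0 0 (-360) 0 0 0 (-720),
    0]) = true := by
  decide +kernel

/-- The combination for `v₀`. -/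
def combinationShadedQ : Combination where
  n := 450
  cTT := of 0 0 0 0 (-12) (-9) (-9) (-13)
  cTQ := of (-10) 0 5 0 (-20) 0 10 0
  cQT := of 10 0 (-5) 0 20 0 (-10) 0

theorem check_b_Q : checkB combinationShadedQ tableQ
    (![of (-3240) (-2970) (-4230) (-3690) (-1728) 324 (-2196) 468,
    of (-2430) (-540) (-3060) (-630) 702 1674 414 2268,
    of 0 0 0 0 (-1728) 1134 (-2646) 1638])
    (![of 3240 2970 4230 3690 3240 2160 4680 2520,
    of 2430 540 3060 630 4860 1080 6120 1260,
    0]) = true := by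
  decide +kernel

theorem check_d_Q : checkD combinationShadedQ tableQ
    (![of (-1620) (-2160) (-1440) (-2520) (-2052) (-1404) (-2664) (-1728),
    of 0 0 0 0 (-2862) (-594) (-3834) (-1008),
    of 810 (-270) 1170 360 378 (-324) 396 (-18)])
    (![of 1620 2160 1440 2520 2430 1350 2610 1800,
    of (-810) 270 (-1170) (-360) 2430 540 3060 630,
    0]) = true := by
  decide +kernel

/-! ### Membership in the span -/

/-- The factor of the unshaded diagrams that depends on the outer region only. -/
noncomputable def evenFactor (w : Vtx) : ℂ := if isEven w = true then (sw w)⁻¹ else 0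

/-- The factor of the shaded diagrams that depends on the outer region only. -/
noncomputable def oddFactor (w : Vtx) : ℂ :=
  if isEven w = true then 0 else (sw w * dFactor w ^ 2)⁻¹

/-- The words with outer region `w` of `underVec X`, where `X` has the table `Y`. -/
noncomputable def underWords (Y : BoxTable) (w : Vtx) : WalkVec :=
  evenWordsSum w .c fun i j k l => (underCoeff Y w i j k l).eval

/-- The words with outer region `w` of `pairVec F G`, where `F` and `G` have the tables `Y` and
`Z`. -/
noncomputable def pairWords (Y Z : BoxTable) (w : Vtx) : WalkVec :=
  evenWordsSum w .c fun i j k l => (pairCoeff Y Z w i j k l).eval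

/-- The words with outer region `w` of `underVecShaded X`, where `X` has the table `Y`. -/
noncomputable def underWordsShaded (Y : BoxTable) (w : Vtx) : WalkVec :=
  ∑ j, oddWordsSum w (.b j) fun i k => (underCoeffShaded Y w i j k).eval

/-- The words with outer region `w` of `pairVecShaded F G`, where `F` and `G` have the tables `Y`
and `Z`. -/
noncomputable def pairWordsShaded (Y Z : BoxTable) (w : Vtx) : WalkVec :=
  ∑ j, oddWordsSum w (.b j) fun i k => (pairCoeffShaded Y Z w i j k).eval

theorem underStrand_eq (hX : HasTable X κ Y) :
    underStrand X = (κ / (3 * sw (.b 0))) • ∑ w, evenFactor w • underWords Y w := by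
  have h : underStrand X = jonesWenzl 8 (underVec X) := rfl
  rw [h, (supportedOnClosedWalks_underVec hX).jonesWenzl_eq_even, Finset.smul_sum]
  refine Finset.sum_congr rfl fun w _ => ?_
  simp only [underVec_smul_jwWalk hX, ← Finset.smul_sum, evenFactor]
  split_ifs with hw
  · rw [smul_smul, underWords, ← sum_underTable hw]
    congr 1
    field_simp
  · simp

theorem pair_eq (hF : HasTable F κ Y) (hG : HasTable G κ' Z) :
    pair F G = (κ * κ' / sw .c ^ 3) • ∑ w, evenFactor w • pairWords Y Z w := by
  have h : pair F G = jonesWenzl 8 (pairVec F G) := rfl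
  rw [h, (supportedOnClosedWalks_pairVec hF hG).jonesWenzl_eq_even, Finset.smul_sum]
  refine Finset.sum_congr rfl fun w _ => ?_
  simp only [pairVec_smul_jwWalk hF hG, ← Finset.smul_sum, evenFactor]
  split_ifs with hw
  · rw [smul_smul, pairWords, ← sum_pairTable hw]
    congr 1
    field_simp
  · simp

theorem underStrandShaded_eq (hX : HasTable X κ Y) :
    underStrandShaded X = (κ / sw .c) • ∑ w, oddFactor w • underWordsShaded Y w := by
  have h : underStrandShaded X = jonesWenzl 8 (underVecShaded X) := rfl
  rw [h, (supportedOnClosedWalks_underVecShaded hX).jonesWenzl_eq_odd, Finset.smul_sum]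
  refine Finset.sum_congr rfl fun w _ => ?_
  simp only [underVecShaded_smul_jwWalk hX, ← Finset.smul_sum, oddFactor]
  split_ifs with hw
  · simp
  · rw [smul_smul, underWordsShaded, ← sum_underTableShaded (by simpa using hw)]
    congr 1
    field_simp

theorem pairShaded_eq (hF : HasTable F κ Y) (hG : HasTable G κ' Z) :
    pairShaded F G = (κ * κ' / sw (.b 0) ^ 3) • ∑ w, oddFactor w • pairWordsShaded Y Z w := by
  have h : pairShaded F G = jonesWenzl 8 (pairVecShaded F G) := rfl
  rw [h, (supportedOnClosedWalks_pairVecShaded hF hG).jonesWenzl_eq_odd, Finset.smul_sum]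
  refine Finset.sum_congr rfl fun w _ => ?_
  simp only [pairVecShaded_smul_jwWalk hF hG, ← Finset.smul_sum, oddFactor]
  split_ifs with hw
  · simp
  · have hw' : isEven w = false := by simpa using hw
    rw [smul_smul, pairWordsShaded, ← sum_pairTableShaded hw']
    congr 1
    have h1 := sw_eq_of_isEven_eq_false hw'
    have h2 := sw_ne (.b 0)
    have h3 := dFactor_ne w
    rw [h1]
    field_simp

/-- The combination expresses `U` in terms of `P₁`, `P₂` and `P₃`. -/
def Combination.Expresses (r : Combination) (U P₁ P₂ P₃ : WalkVec) : Prop :=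
  (r.n : ℂ) • U = r.cTT.eval • P₁ + r.cTQ.eval • P₂ + r.cQT.eval • P₃

theorem Combination.eval_defect (r : Combination) (x x₁ x₂ x₃ : CycInt) :
    (r.defect x x₁ x₂ x₃).eval = (r.n : ℂ) * x.eval -
      (r.cTT.eval * x₁.eval + r.cTQ.eval * x₂.eval + r.cQT.eval * x₃.eval) := by
  have h : (of r.n 0 0 0 0 0 0 0).eval = r.n := by rw [eval_of]; simp
  simp only [defect, eval_sub, eval_add, eval_mul, h]

theorem expresses_even {r : Combination} {w : Vtx}
    (h : evenWordsSum w .c (fun i j k l => (evenDefect r Y w i j k l).eval) = 0) :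
    r.Expresses (underWords Y w) (pairWords tableT tableT w) (pairWords tableT tableQ w)
      (pairWords tableQ tableT w) := by
  rw [Combination.Expresses, ← sub_eq_zero, ← h]
  simp only [underWords, pairWords, ← map_smul, ← map_add, ← map_sub]
  congr 1
  funext i j k l
  simp only [evenDefect, Combination.eval_defect]
  rfl

theorem expresses_odd {r : Combination} {w : Vtx}
    (h : ∑ j, oddWordsSum w (.b j) (fun i k => (oddDefect r Y w i j k).eval) = 0) :
    r.Expresses (underWordsShaded Y w) (pairWordsShaded tableT tableT w)
      (pairWordsShaded tableT tableQ w) (pairWordsShaded tableQ tableT w) := by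
  rw [Combination.Expresses, ← sub_eq_zero, ← h]
  simp only [underWordsShaded, pairWordsShaded, Finset.smul_sum, ← Finset.sum_add_distrib,
    ← Finset.sum_sub_distrib]
  refine Finset.sum_congr rfl fun j _ => ?_
  simp only [← map_smul, ← map_add, ← map_sub]
  congr 1
  funext i k
  simp only [oddDefect, Combination.eval_defect]
  rfl

theorem expresses_of_checkC {r : Combination} {g₁ g₂ g₃ : Fin 3 → CycInt} {s : CycInt}
    (hc : checkC r Y g₁ g₂ g₃ = true) (hz : checkZ r Y s = true) {w : Vtx}
    (hw : isEven w = true) : r.Expresses (underWords Y w) (pairWords tableT tableT w)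
      (pairWords tableT tableQ w) (pairWords tableQ tableT w) := by
  refine expresses_even ?_
  match w, hw with
  | .c, _ =>
    refine evenWordsSum_c_eq_zero _ g₁ g₂ g₃ fun i j k l => ?_
    have := of_allFin (of_allFin (of_allFin (of_allFin hc i) j) k) l
    simpa only [Bool.or_eq_true, Bool.and_eq_true, decide_eq_true_eq] using this
  | .z m, _ =>
    refine evenWordsSum_z_eq_zero m _ s fun j k => ?_
    have := of_allFin (of_allFin (of_allFin hz m) j) k
    simpa only [Bool.or_eq_true, Bool.and_eq_true, decide_eq_true_eq] using this

theorem expresses_of_checkB {r : Combination} {g₁ g₂ g₃ g₄ : Fin 3 → CycInt}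
    (hb : checkB r Y g₁ g₂ = true) (hd : checkD r Y g₃ g₄ = true) {w : Vtx}
    (hw : isEven w = false) :
    r.Expresses (underWordsShaded Y w) (pairWordsShaded tableT tableT w)
      (pairWordsShaded tableT tableQ w) (pairWordsShaded tableQ tableT w) := by
  refine expresses_odd ?_
  match w, hw with
  | .b m, _ =>
    refine oddWordsSum_b_eq_zero m _ g₁ g₂ fun i j k => ?_
    have := of_allFin (of_allFin (of_allFin (of_allFin hb m) i) j) k
    simpa only [Bool.or_eq_true, Bool.and_eq_true, decide_eq_true_eq] using this
  | .d, _ =>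
    refine oddWordsSum_d_eq_zero _ g₃ g₄ fun i j k => ?_
    have := of_allFin (of_allFin (of_allFin hd i) j) k
    simpa only [Bool.or_eq_true, Bool.and_eq_true, decide_eq_true_eq] using this

/-- The diagrams `u` and `p₁`, `p₂`, `p₃` have the same dependence `ν` on the outer region, so a
combination that works for the words of each outer region works for the diagrams. -/
theorem Combination.mem_span {r : Combination} (hr : r.n ≠ 0) {ν : Vtx → ℂ}
    {U P₁ P₂ P₃ : Vtx → WalkVec}
    (h : ∀ w, ν w ≠ 0 → r.Expresses (U w) (P₁ w) (P₂ w) (P₃ w)) {u p₁ p₂ p₃ p₄ : WalkVec}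
    {t k₁ k₂ k₃ : ℂ} (h₁ : k₁ ≠ 0) (h₂ : k₂ ≠ 0) (h₃ : k₃ ≠ 0) (hu : u = t • ∑ w, ν w • U w)
    (hp₁ : p₁ = k₁ • ∑ w, ν w • P₁ w) (hp₂ : p₂ = k₂ • ∑ w, ν w • P₂ w)
    (hp₃ : p₃ = k₃ • ∑ w, ν w • P₃ w) : u ∈ Submodule.span ℂ {p₁, p₄, p₂, p₃} := by
  have hn : (r.n : ℂ) ≠ 0 := by exact_mod_cast hr
  have e : ∑ w, ν w • U w = (r.n : ℂ)⁻¹ • (r.cTT.eval • ∑ w, ν w • P₁ w +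
      r.cTQ.eval • ∑ w, ν w • P₂ w + r.cQT.eval • ∑ w, ν w • P₃ w) := by
    simp only [Finset.smul_sum, ← Finset.sum_add_distrib]
    refine Finset.sum_congr rfl fun w _ => ?_
    by_cases hw : ν w = 0
    · simp [hw]
    · have hU : U w = (r.n : ℂ)⁻¹ • (r.cTT.eval • P₁ w + r.cTQ.eval • P₂ w +
          r.cQT.eval • P₃ w) := by
        rw [← h w hw, smul_smul, inv_mul_cancel₀ hn, one_smul]
      rw [hU]
      module
  have e₁ : ∑ w, ν w • P₁ w = k₁⁻¹ • p₁ := by rw [hp₁, smul_smul, inv_mul_cancel₀ h₁, one_smul]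
  have e₂ : ∑ w, ν w • P₂ w = k₂⁻¹ • p₂ := by rw [hp₂, smul_smul, inv_mul_cancel₀ h₂, one_smul]
  have e₃ : ∑ w, ν w • P₃ w = k₃⁻¹ • p₃ := by rw [hp₃, smul_smul, inv_mul_cancel₀ h₃, one_smul]
  rw [hu, e, e₁, e₂, e₃]
  refine Submodule.smul_mem _ _ (Submodule.smul_mem _ _ (Submodule.add_mem _
    (Submodule.add_mem _ ?_ ?_) ?_)) <;>
  refine Submodule.smul_mem _ _ (Submodule.smul_mem _ _ (Submodule.subset_span ?_)) <;>
  simp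

theorem tQ_pos : 0 < tQ := by
  refine Real.sqrt_pos.mpr (mul_pos (div_pos (qnum_pos 3) (by positivity)) (by positivity))

theorem eta_ne : eta ≠ 0 := by
  intro h
  have := congrArg Complex.re h
  simp [eta] at this

theorem kapC_ne : (kap : ℂ) ≠ 0 := by exact_mod_cast kap_pos.ne'

theorem scalarT_ne : ((kap : ℂ) / 18) ≠ 0 := div_ne_zero kapC_ne (by norm_num)

theorem scalarQ_ne : eta * ((tQ : ℂ) * kap / 6) ≠ 0 := by
  have : (tQ : ℂ) ≠ 0 := by exact_mod_cast tQ_pos.ne'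
  exact mul_ne_zero eta_ne (div_ne_zero (mul_ne_zero this kapC_ne) (by norm_num))

theorem underStrand_mem_span (hX : HasTable X κ Y) {r : Combination} (hr : r.n ≠ 0)
    (h : ∀ w, isEven w = true → r.Expresses (underWords Y w) (pairWords tableT tableT w)
      (pairWords tableT tableQ w) (pairWords tableQ tableT w)) :
    underStrand X ∈ Submodule.span ℂ
      {pair genT genT, pair genQ genQ, pair genT genQ, pair genQ genT} := by
  have hc := pow_ne_zero 3 (sw_ne .c)
  refine r.mem_span hr (ν := evenFactor) (fun w hw => h w ?_) ?_ ?_ ?_ (underStrand_eq hX)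
    (pair_eq hasTable_T hasTable_T) (pair_eq hasTable_T hasTable_Q)
    (pair_eq hasTable_Q hasTable_T)
  · by_contra h'
    exact hw (if_neg h')
  · exact div_ne_zero (mul_ne_zero scalarT_ne scalarT_ne) hc
  · exact div_ne_zero (mul_ne_zero scalarT_ne scalarQ_ne) hc
  · exact div_ne_zero (mul_ne_zero scalarQ_ne scalarT_ne) hc

theorem underStrandShaded_mem_span (hX : HasTable X κ Y) {r : Combination} (hr : r.n ≠ 0)
    (h : ∀ w, isEven w = false → r.Expresses (underWordsShaded Y w)
      (pairWordsShaded tableT tableT w) (pairWordsShaded tableT tableQ w)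
      (pairWordsShaded tableQ tableT w)) :
    underStrandShaded X ∈ Submodule.span ℂ
      {pairShaded genT genT, pairShaded genQ genQ, pairShaded genT genQ, pairShaded genQ genT} := by
  have hc := pow_ne_zero 3 (sw_ne (.b 0))
  refine r.mem_span hr (ν := oddFactor) (fun w hw => h w ?_) ?_ ?_ ?_ (underStrandShaded_eq hX)
    (pairShaded_eq hasTable_T hasTable_T) (pairShaded_eq hasTable_T hasTable_Q)
    (pairShaded_eq hasTable_Q hasTable_T)
  · by_contra h'
    exact hw (if_pos (by simpa using h'))
  · exact div_ne_zero (mul_ne_zero scalarT_ne scalarT_ne) hc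
  · exact div_ne_zero (mul_ne_zero scalarT_ne scalarQ_ne) hc
  · exact div_ne_zero (mul_ne_zero scalarQ_ne scalarT_ne) hc

end Haagerup2221

theorem mainTheorem9 :
    (Haagerup2221.underStrand Haagerup2221.genT ∈ Submodule.span ℂ
        {Haagerup2221.pair Haagerup2221.genT Haagerup2221.genT,
         Haagerup2221.pair Haagerup2221.genQ Haagerup2221.genQ,
         Haagerup2221.pair Haagerup2221.genT Haagerup2221.genQ,
         Haagerup2221.pair Haagerup2221.genQ Haagerup2221.genT} ∧
      Haagerup2221.underStrand Haagerup2221.genQ ∈ Submodule.span ℂ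
        {Haagerup2221.pair Haagerup2221.genT Haagerup2221.genT,
         Haagerup2221.pair Haagerup2221.genQ Haagerup2221.genQ,
         Haagerup2221.pair Haagerup2221.genT Haagerup2221.genQ,
         Haagerup2221.pair Haagerup2221.genQ Haagerup2221.genT}) ∧
    (Haagerup2221.underStrandShaded Haagerup2221.genT ∈ Submodule.span ℂ
        {Haagerup2221.pairShaded Haagerup2221.genT Haagerup2221.genT,
         Haagerup2221.pairShaded Haagerup2221.genQ Haagerup2221.genQ,
         Haagerup2221.pairShaded Haagerup2221.genT Haagerup2221.genQ,
         Haagerup2221.pairShaded Haagerup2221.genQ Haagerup2221.genT} ∧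
      Haagerup2221.underStrandShaded Haagerup2221.genQ ∈ Submodule.span ℂ
        {Haagerup2221.pairShaded Haagerup2221.genT Haagerup2221.genT,
         Haagerup2221.pairShaded Haagerup2221.genQ Haagerup2221.genQ,
         Haagerup2221.pairShaded Haagerup2221.genT Haagerup2221.genQ,
         Haagerup2221.pairShaded Haagerup2221.genQ Haagerup2221.genT}) := by
  open Haagerup2221 in
  exact ⟨⟨underStrand_mem_span hasTable_T (by decide) fun _ =>
        expresses_of_checkC check_c_T check_z_T,
      underStrand_mem_span hasTable_Q (by decide) fun _ =>
        expresses_of_checkC check_c_Q check_z_Q⟩,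
    underStrandShaded_mem_span hasTable_T (by decide) fun _ =>
      expresses_of_checkB check_b_T check_d_T,
    underStrandShaded_mem_span hasTable_Q (by decide) fun _ =>
      expresses_of_checkB check_b_Q check_d_Q⟩
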